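/- **Convergence of weight-dependent random connection models (WDRCMs) locally in probability.** Let $d\ge 1$, let $\rho:\mathbb R_+\to[0,1]$ (the profile) and $h:[0,1]\times[0,1]\times\mathbb R_+\to\mathbb R_+$ (the kernel), and put $\kappa(t,x,y):=\rho(h(x,y,t))$ for $t\in\mathbb R_+$, $x,y\in[0,1]$. Assume that $\kappa$ is measurable and symmetric in $(x,y)$ and that there are $t_0>0$ and $\alpha>d$ such that, for independent $W^{(1)},W^{(2)}$ uniform on $[0,1]$, $$\mathbb E\big[\kappa(t,W^{(1)},W^{(2)})\big]\le t^{-\alpha}\qquad\text{for all } t>t_0 .$$ For locations $\mathbf Y=(Y_i)_{i\in S}$ in $\mathbb R^d$ and weights $\mathbf W=(W_i)_{i\in S}$ in $[0,1]$, let $G(\mathbf Y,\mathbf W,\kappa)$ be the random graph with vertex set $S$ in which, conditionally on $(\mathbf Y,\mathbf W)$, the edges $\{i,j\}$, $i\ne j$, are present independently with probabilities $\kappa(\|Y_i-Y_j\|,W_i,W_j)$, where $\|\cdot\|$ is the Euclidean norm. *Finite models.* For each $n\ge1$ let $X^{(n)}_1,\dots,X^{(n)}_n$ be i.i.d. uniform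 on $[-\frac12,\frac12]^d$, let $W^{(n)}_1,\dots,W^{(n)}_n$ be i.i.d. uniform on $[0,1]$ and independent of the $X^{(n)}_i$, put $Y^{(n)}_i=n^{1/d}X^{(n)}_i$, and let $\mathbb G_n=G(\mathbf Y^{(n)},\mathbf W^{(n)},\kappa)$; that is, $i$ and $j$ are joined with conditional probability $\rho\big(h(W^{(n)}_i,W^{(n)}_j,n^{1/d}\|X^{(n)}_i-X^{(n)}_j\|)\big)$. *Infinite model.* Let $Y_0=\mathbf 0$, let $(Y_i)_{i\ge1}$ enumerate the atoms of a unit-rate homogeneous Poisson point process on $\mathbb R^d$, let $(W_i)_{i\ge0}$ be i.i.d. uniform on $[0,1]$ and independent of $(Y_i)_{i\ge 0}$, and let $\mathbb G_\infty=G(\mathbf Y,\mathbf W,\kappa)$, with vertex set $\mathbb N\cup\{0\}$. Then $(\mathbb G_n)_{n\ge1}$ converges locally in probability to the rooted graph $(\mathbb G_\infty,0)$. That is, $\mathbb G_\infty$ is almost surely locally finite and, for every integer $r\ge 0$ and every locally finite rooted graph $(H,a)$, $$\frac1n\sum_{i=1}^n \mathbf 1\{B^{\mathbb G_n}_i(r)\cong(H,a)\}\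 \longrightarrow\ \mathbb P\big(B^{\mathbb G_\infty}_0(r)\cong(H,a)\big)\quad\text{in probability as } n\to\infty,$$ where $B^{G}_v(r)$ is the subgraph of $G$ induced by the vertices at graph distance at most $r$ from $v$, rooted at $v$, and $\cong$ is isomorphism of rooted graphs. -/

import Mathlib

open MeasureTheory ProbabilityTheory Filter Topology
open scoped NNReal ENNReal unitInterval

/-- Every vertex has finite degree. -/
def IsLocFinite {V : Type*} (G : SimpleGraph V) : Prop :=
  ∀ v, (G.neighborSet v).Finite

/-- The vertices at graph distance at most `r` from `o`
(`edist` is infinite between different components). -/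
def ballSet {V : Type*} (G : SimpleGraph V) (o : V) (r : ℕ) : Set V :=
  {v | G.edist o v ≤ (r : ℕ∞)}

/-- The root, as a vertex of its own ball. -/
def ballRoot {V : Type*} (G : SimpleGraph V) (o : V) (r : ℕ) : ballSet G o r :=
  ⟨o, by simp [ballSet]⟩

/-- Isomorphism of the rooted graphs `(G₁, o₁)` and `(G₂, o₂)`. -/
def RootedIso {V₁ V₂ : Type*} (G₁ : SimpleGraph V₁) (o₁ : V₁)
    (G₂ : SimpleGraph V₂) (o₂ : V₂) : Prop :=
  ∃ φ : G₁ ≃g G₂, φ o₁ = o₂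

/-- The `r`-neighbourhood of `o` in `G`, an induced subgraph rooted at `o`, is rooted isomorphic
to `(H, a)`. -/
def BallIso {V K : Type*} (G : SimpleGraph V) (o : V) (r : ℕ) (H : SimpleGraph K) (a : K) : Prop :=
  RootedIso (G.induce (ballSet G o r)) (ballRoot G o r) H a

/-- The proportion of the vertices of a finite graph whose `r`-neighbourhood is `(H, a)`. -/
noncomputable def ballFraction {V K : Type*} [Fintype V] (G : SimpleGraph V) (r : ℕ)
    (H : SimpleGraph K) (a : K) : ℝ :=
  (Nat.card {i : V // BallIso G i r H a} : ℝ) / (Fintype.card V : ℝ)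

/-- Convergence locally in probability of the finite random graphs `G n` (on the probability spaces
`(Ω n, P n)`) to the random rooted graph `(G', o)` on `(Ω', Q)`. The limit is almost surely locally
finite, and for every radius `r` and every locally finite rooted graph `(H, a)` the proportion of
vertices with `r`-neighbourhood `(H, a)` converges in probability to the probability that the
`r`-neighbourhood of the root in the limit is `(H, a)`. -/
def ConvergesLocallyInProbability {Ω : ℕ → Type*} [∀ n, MeasurableSpace (Ω n)]
    (P : ∀ n, Measure (Ω n)) {V : ℕ → Type*} [∀ n, Fintype (V n)]
    (G : ∀ n, Ω n → SimpleGraph (V n))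
    {Ω' : Type*} [MeasurableSpace Ω'] (Q : Measure Ω') {V' : Type*}
    (G' : Ω' → SimpleGraph V') (o : V') : Prop :=
  (∀ᵐ ω ∂Q, IsLocFinite (G' ω)) ∧
  ∀ (r : ℕ) (K : Type) (H : SimpleGraph K) (a : K), IsLocFinite H →
    ∀ ε : ℝ, 0 < ε →
      Tendsto (fun n => P n {ω | ε ≤ |ballFraction (G n ω) r H a
        - Q.real {ω' | BallIso (G' ω') o r H a}|}) atTop (𝓝 0)

/-- The random graph `G` is a spatial inhomogeneous random graph with vertex set `V`, locations `Y`,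
weights `W` and connection function `κ`: conditionally on all locations and weights, the edges
`{i, j}`, `i < j`, are present independently with probabilities `κ (‖Y i - Y j‖) (W i) (W j)`,
i.e. for every finite set `T` of pairs the conditional probability that all pairs in `T` are edges
is the product of these numbers. -/
structure IsSIRG {Ω : Type*} [MeasurableSpace Ω] (P : Measure Ω) {V : Type*} [LinearOrder V]
    {E : Type*} [NormedAddCommGroup E] [MeasurableSpace E] {S : Type*} [MeasurableSpace S]
    (Y : V → Ω → E) (W : V → Ω → S) (κ : ℝ≥0 → S → S → I)
    (G : Ω → SimpleGraph V) : Prop where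
  measurable_location : ∀ i, Measurable (Y i)
  measurable_weight : ∀ i, Measurable (W i)
  measurable_adj : ∀ i j, MeasurableSet {ω | (G ω).Adj i j}
  condProb_edges : ∀ T : Finset (V × V), (∀ p ∈ T, p.1 < p.2) →
    P⟦{ω | ∀ p ∈ T, (G ω).Adj p.1 p.2} |
        MeasurableSpace.comap (fun ω (i : V) => (Y i ω, W i ω)) inferInstance⟧
      =ᵐ[P] fun ω => ∏ p ∈ T, (κ ‖Y p.1 ω - Y p.2 ω‖₊ (W p.1 ω) (W p.2 ω) : ℝ)

/-- The number of indices `i` with `Z i ω ∈ B`. -/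
noncomputable def countIn {Ω E : Type*} (Z : ℕ → Ω → E) (B : Set E) (ω : Ω) : ℕ∞ :=
  {i | Z i ω ∈ B}.encard

/-- The points `Z 0, Z 1, …` enumerate the atoms of a Poisson point process with intensity
measure `m`. -/
structure IsPoissonProcess {Ω : Type*} [MeasurableSpace Ω] (P : Measure Ω)
    {E : Type*} [MeasurableSpace E] (Z : ℕ → Ω → E) (m : Measure E) : Prop where
  measurable_point : ∀ i, Measurable (Z i)
  count_law : ∀ B : Set E, MeasurableSet B → m B ≠ ∞ → ∀ k : ℕ,
    P {ω | countIn Z B ω = (k : ℕ∞)} = poissonMeasure (m B).toNNReal {k}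
  count_indep : ∀ (l : ℕ) (B : Fin l → Set E), (∀ j, MeasurableSet (B j)) →
    Pairwise (fun i j => Disjoint (B i) (B j)) → iIndepFun (fun j => countIn Z (B j)) P

/-- `W` is a family of independent random weights, uniform on `[0, 1]`, and jointly independent of
the family `X` of locations. -/
structure IsUniformWeights {Ω : Type*} [MeasurableSpace Ω] (P : Measure Ω) {V : Type*}
    {E : Type*} [MeasurableSpace E] (W : V → Ω → I) (X : V → Ω → E) : Prop where
  measurable : ∀ i, Measurable (W i)
  law : ∀ i, P.map (W i) = volume
  indep : iIndepFun W P
  indep_location : IndepFun (fun ω i => X i ω) (fun ω i => W i ω) P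

/-- The box `[-1/2, 1/2]^d`. -/
def unitBox (d : ℕ) : Set (EuclideanSpace ℝ (Fin d)) :=
  {x | ∀ k, x k ∈ Set.Icc (-(1 / 2) : ℝ) (1 / 2)}

/-- `X` is a family of independent random points, uniform on the box `[-1/2, 1/2]^d`, which has
volume one. -/
structure IsUniformLocations {Ω : Type*} [MeasurableSpace Ω] (P : Measure Ω) {V : Type*} {d : ℕ}
    (X : V → Ω → EuclideanSpace ℝ (Fin d)) : Prop where
  measurable : ∀ i, Measurable (X i)
  law : ∀ i, P.map (X i) = volume.restrict (unitBox d)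
  indep : iIndepFun X P

/-- The connection function `κ(t, x, y) = ρ(h(x, y, t))` of the weight-dependent random connection
model with profile `ρ` and kernel `h`. -/
def wdrcmKernel (ρ : ℝ≥0 → I) (h : I → I → ℝ≥0 → ℝ≥0) : ℝ≥0 → I → I → I :=
  fun t x y => ρ (h x y t)

/-! The `r`-neighbourhood of a vertex depends, up to small probability, only on the points within a
fixed Euclidean distance. The connection probability is at most one and its mean over the weights
decays like `t ^ (-α)` with `α > d`, so `meanConnection` is integrable over space
(`lintegral_meanConnection_ne_top`). Hence there are radii `R 0 ≤ ... ≤ R r` such that the expected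
number of edges from within `R j` of the root to beyond `R (j + 1)`, summed over `j < r`, is small,
uniformly over all finite models and in the infinite one (`exists_radii`,
`IsSIRG.measure_longEdgeEvent_le`). In the absence of such edges the graph spanned by the points
within `R r` determines the ball (`ballIso_iff_of_mem_patternEvent`). The same integrability gives
local finiteness of the limit.

For the truncated neighbourhood all laws are explicit. Let `b` be the volume of the Euclidean ball.
In the Poisson model, seeing `m` points in it that span a prescribed graph with the root has
probability `exp (-b) / m!` times an integral over `m` points of the ball
(`IsSIRG.factorial_mul_measure_localEvent_le`). For two vertices of the `n`-th finite model, one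
counts the choices of the nearby vertices, each of density `1 / n`, and multiplies by the
probability that all other vertices avoid both balls, which tends to `exp (-2 * b)`. The two roots
are, with probability tending to one, far from each other and from the boundary. So the joint
probability is asymptotically at least the product of the Poisson probabilities
(`eventually_le_measure_localEvent_inter`).

Lower bounds are enough. The answers "ball is `(H, a)`" and "ball is not `(H, a)`" at two vertices
give four cases whose limiting probabilities add up to one, so asymptotic lower bounds for all four
force convergence. The indicators at distinct vertices are then asymptotically uncorrelated around
the limit probability, and Chebyshev's inequality concludes (`integral_centered_mul_le`,
`measureReal_le_abs_sub_le`). Working with lower bounds also reduces the sum over the number of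
nearby points to finite partial sums. -/

/-! ### Graph balls and their dependence on a vertex subset. -/

section Balls

variable {V V₁ K : Type*}

lemma mem_ballSet_zero (G : SimpleGraph V) (o v : V) : v ∈ ballSet G o 0 ↔ v = o := by
  simp [ballSet, eq_comm (a := o)]

lemma mem_ballSet_iff_exists_walk (G : SimpleGraph V) (o v : V) (r : ℕ) :
    v ∈ ballSet G o r ↔ ∃ p : G.Walk o v, p.length ≤ r := by
  constructor
  · intro hv
    have hne : G.edist o v ≠ ⊤ := ne_top_of_le_ne_top (ENat.natCast_ne_top r) hv
    obtain ⟨p, hp⟩ := SimpleGraph.exists_walk_of_edist_ne_top hne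
    refine ⟨p, ?_⟩
    have : (p.length : ℕ∞) ≤ r := hp ▸ hv
    exact_mod_cast this
  · rintro ⟨p, hp⟩
    exact (SimpleGraph.edist_le p).trans (by exact_mod_cast hp)

lemma mem_ballSet_succ (G : SimpleGraph V) (o v : V) (r : ℕ) :
    v ∈ ballSet G o (r + 1) ↔ v ∈ ballSet G o r ∨ ∃ u ∈ ballSet G o r, G.Adj u v := by
  simp only [mem_ballSet_iff_exists_walk]
  constructor
  · rintro ⟨p, hp⟩
    by_cases hn : p.Nil
    · left
      refine ⟨p, ?_⟩
      simp [SimpleGraph.Walk.length_eq_zero_iff.2 hn]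
    · right
      refine ⟨_, ⟨p.dropLast, ?_⟩, p.adj_penultimate hn⟩
      have := p.length_dropLast_add_one hn
      omega
  · rintro (⟨p, hp⟩ | ⟨u, ⟨p, hp⟩, huv⟩)
    · exact ⟨p, by omega⟩
    · exact ⟨p.concat huv, by simp [SimpleGraph.Walk.length_concat, hp]⟩

/-- If no edge leaves `S j` to the outside of `S (j + 1)`, then balls stay in these sets. -/
lemma ballSet_subset_of_nested (G : SimpleGraph V) (o : V) (S : ℕ → Set V) (r : ℕ)
    (ho : o ∈ S 0) (hS : Monotone S)
    (hedge : ∀ j < r, ∀ u ∈ S j, ∀ v, G.Adj u v → v ∈ S (j + 1)) (j : ℕ) (hj : j ≤ r) :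
    ballSet G o j ⊆ S j := by
  induction j with
  | zero =>
    intro v hv
    rw [mem_ballSet_zero] at hv
    exact hv ▸ ho
  | succ j ih =>
    intro v hv
    rcases (mem_ballSet_succ G o v j).1 hv with h | ⟨u, hu, huv⟩
    · exact hS (Nat.le_succ j) (ih (by omega) h)
    · exact hedge j (by omega) u (ih (by omega) hu) v huv

/-- The ball in an induced subgraph that contains a neighbourhood of the ball. -/
lemma ballSet_eq_image_comap (G : SimpleGraph V) (f : V₁ → V) (o₁ : V₁)
    (S : ℕ → Set V) (r : ℕ) (ho : f o₁ ∈ S 0) (hS : Monotone S)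
    (hedge : ∀ j < r, ∀ u ∈ S j, ∀ v, G.Adj u v → v ∈ S (j + 1)) (hf : Function.Injective f)
    (hrange : S r ⊆ Set.range f) (j : ℕ) (hj : j ≤ r) :
    ballSet G (f o₁) j = f '' ballSet (G.comap f) o₁ j := by
  have hsub := ballSet_subset_of_nested G (f o₁) S r ho hS hedge
  induction j with
  | zero =>
    ext v
    simp only [mem_ballSet_zero, Set.mem_image, exists_eq_left, eq_comm (a := f o₁)]
  | succ j ih =>
    have ih' := ih (by omega)
    ext v
    constructor
    · intro hv
      obtain ⟨x, rfl⟩ := hrange (hS hj (hsub (j + 1) hj hv))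
      refine ⟨x, ?_, rfl⟩
      rw [mem_ballSet_succ] at hv ⊢
      rw [ih'] at hv
      rcases hv with ⟨y, hy, hyx⟩ | ⟨u, ⟨y, hy, rfl⟩, huv⟩
      · exact Or.inl (hf hyx ▸ hy)
      · exact Or.inr ⟨y, hy, huv⟩
    · rintro ⟨x, hx, rfl⟩
      rw [mem_ballSet_succ] at hx ⊢
      rw [ih']
      rcases hx with hx | ⟨y, hy, hyx⟩
      · exact Or.inl ⟨x, hx, rfl⟩
      · exact Or.inr ⟨f y, ⟨y, hy, rfl⟩, hyx⟩

/-- An injective `f` identifies `G.comap f` with the subgraph induced on its range, so it is enough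
that the two balls correspond as vertex sets. -/
lemma ballIso_comap_iff_of_image (G : SimpleGraph V) (f : V₁ → V) (o₁ : V₁)
    (hf : Function.Injective f) (r : ℕ)
    (himage : ballSet G (f o₁) r = f '' ballSet (G.comap f) o₁ r)
    (H : SimpleGraph K) (a : K) :
    BallIso (G.comap f) o₁ r H a ↔ BallIso G (f o₁) r H a := by
  have hmem : ∀ x, x ∈ ballSet (G.comap f) o₁ r ↔ f x ∈ ballSet G (f o₁) r := by
    intro x
    rw [himage, hf.mem_set_image]
  let g : ballSet (G.comap f) o₁ r → ballSet G (f o₁) r := fun x => ⟨f x, (hmem x).1 x.2⟩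
  have hg : Function.Bijective g := by
    constructor
    · intro x y hxy
      exact Subtype.ext (hf (Subtype.ext_iff.1 hxy))
    · rintro ⟨v, hv⟩
      have hv' := hv
      rw [himage] at hv'
      obtain ⟨x, hx, rfl⟩ := hv'
      exact ⟨⟨x, hx⟩, rfl⟩
  let e : (G.comap f).induce (ballSet (G.comap f) o₁ r) ≃g G.induce (ballSet G (f o₁) r) :=
    { Equiv.ofBijective g hg with map_rel_iff' := by intro x y; rfl }
  have he : e (ballRoot (G.comap f) o₁ r) = ballRoot G (f o₁) r := rfl
  constructor
  · rintro ⟨φ, hφ⟩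
    refine ⟨e.symm.trans φ, ?_⟩
    rw [← he, ← hφ]
    exact congrArg φ (e.symm_apply_apply _)
  · rintro ⟨φ, hφ⟩
    refine ⟨e.trans φ, ?_⟩
    rw [← hφ, ← he]
    rfl

/-- The truncation principle: if `r` steps from the root cannot escape the range of `f`, the graph
seen through `f` already decides the ball. It is applied with `S j` the vertices within Euclidean
distance `R j` of the root. -/
lemma ballIso_comap_iff_of_nested (G : SimpleGraph V) (f : V₁ → V) (o₁ : V₁)
    (S : ℕ → Set V) (r : ℕ) (ho : f o₁ ∈ S 0) (hS : Monotone S)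
    (hedge : ∀ j < r, ∀ u ∈ S j, ∀ v, G.Adj u v → v ∈ S (j + 1)) (hf : Function.Injective f)
    (hrange : S r ⊆ Set.range f) (H : SimpleGraph K) (a : K) :
    BallIso (G.comap f) o₁ r H a ↔ BallIso G (f o₁) r H a :=
  ballIso_comap_iff_of_image G f o₁ hf r
    (ballSet_eq_image_comap G f o₁ S r ho hS hedge hf hrange r le_rfl) H a

lemma ballIso_comap_equiv_iff (G : SimpleGraph V) (e : V₁ ≃ V) (o₁ : V₁) (r : ℕ)
    (H : SimpleGraph K) (a : K) :
    BallIso (G.comap e) o₁ r H a ↔ BallIso G (e o₁) r H a :=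
  ballIso_comap_iff_of_nested G e o₁ (fun _ => Set.univ) r trivial monotone_const
    (fun _ _ _ _ _ _ => trivial) e.injective (by simp) H a

end Balls

/-! ### Joint law of present and absent edges given the marks. -/

section EdgeLaw

variable {Ω V E S : Type*} [NormedAddCommGroup E]

open Classical in
/-- The probability that two vertices with given locations and weights are adjacent (if `b` holds)
or not adjacent (otherwise). -/
noncomputable def edgeLaw (κ : ℝ≥0 → S → S → I) (b : Prop) (p q : E × S) : ℝ≥0∞ :=
  if b then ENNReal.ofReal (κ ‖p.1 - q.1‖₊ p.2 q.2) else
    ENNReal.ofReal (1 - κ ‖p.1 - q.1‖₊ p.2 q.2)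

lemma edgeLaw_true_add_false (κ : ℝ≥0 → S → S → I) (p q : E × S) :
    edgeLaw κ True p q + edgeLaw κ False p q = 1 := by
  simp only [edgeLaw, if_true, if_false]
  rw [← ENNReal.ofReal_add (κ _ _ _).2.1 (by linarith [(κ ‖p.1 - q.1‖₊ p.2 q.2).2.2])]
  simp

lemma edgeLaw_symm {κ : ℝ≥0 → S → S → I} (hsymm : ∀ t x y, κ t x y = κ t y x) (b : Prop)
    (p q : E × S) : edgeLaw κ b p q = edgeLaw κ b q p := by
  unfold edgeLaw
  rw [hsymm, ← nnnorm_neg, neg_sub]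

variable [MeasurableSpace Ω] {P : Measure Ω} [MeasurableSpace E] [MeasurableSpace S]

lemma IsSIRG.measurable_mark [LinearOrder V] {Y : V → Ω → E} {W : V → Ω → S}
    {κ : ℝ≥0 → S → S → I} {G : Ω → SimpleGraph V} (hG : IsSIRG P Y W κ G) :
    Measurable fun ω (i : V) => (Y i ω, W i ω) :=
  measurable_pi_lambda _ fun i => (hG.measurable_location i).prodMk (hG.measurable_weight i)

variable [BorelSpace E] [SecondCountableTopology E]

lemma measurable_edgeLaw {κ : ℝ≥0 → S → S → I}
    (hκ : Measurable fun q : ℝ≥0 × S × S => κ q.1 q.2.1 q.2.2) (b : Prop) :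
    Measurable fun p : (E × S) × (E × S) => edgeLaw κ b p.1 p.2 := by
  have h : Measurable fun p : (E × S) × (E × S) => κ ‖p.1.1 - p.2.1‖₊ p.1.2 p.2.2 :=
    hκ.comp (by fun_prop : Measurable fun p : (E × S) × (E × S) =>
      (‖p.1.1 - p.2.1‖₊, p.1.2, p.2.2))
  by_cases hb : b
  · simp only [edgeLaw, hb, if_true]
    exact (measurable_subtype_coe.comp h).ennreal_ofReal
  · simp only [edgeLaw, hb, if_false]
    exact ((measurable_subtype_coe.comp h).const_sub 1).ennreal_ofReal

variable [LinearOrder V] {Y : V → Ω → E} {W : V → Ω → S} {κ : ℝ≥0 → S → S → I}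
  {G : Ω → SimpleGraph V}

/-- This is the defining property of the conditional probability in `condProb_edges`, integrated
over an event of the mark σ-algebra and transferred to `ℝ≥0∞`. -/
lemma IsSIRG.measure_forall_adj [IsProbabilityMeasure P] (hG : IsSIRG P Y W κ G)
    (hκ : Measurable fun q : ℝ≥0 × S × S => κ q.1 q.2.1 q.2.2) {A : Set (V → E × S)}
    (hA : MeasurableSet A) (T : Finset (V × V)) (hT : ∀ p ∈ T, p.1 < p.2) :
    P ((fun ω i => (Y i ω, W i ω)) ⁻¹' A ∩ {ω | ∀ p ∈ T, (G ω).Adj p.1 p.2}) =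
      ∫⁻ ω in (fun ω i => (Y i ω, W i ω)) ⁻¹' A,
        ∏ p ∈ T, edgeLaw κ True (Y p.1 ω, W p.1 ω) (Y p.2 ω, W p.2 ω) ∂P := by
  set Z : Ω → V → E × S := fun ω i => (Y i ω, W i ω)
  have hZ : Measurable Z := hG.measurable_mark
  have hm : MeasurableSpace.comap Z inferInstance ≤ ‹MeasurableSpace Ω› := hZ.comap_le
  have hset : MeasurableSet {ω | ∀ p ∈ T, (G ω).Adj p.1 p.2} := by
    have : {ω | ∀ p ∈ T, (G ω).Adj p.1 p.2} = ⋂ p ∈ T, {ω | (G ω).Adj p.1 p.2} := by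
      ext; simp
    rw [this]
    exact Finset.measurableSet_biInter _ fun p _ => hG.measurable_adj _ _
  have hprod : ∀ ω, ∏ p ∈ T, edgeLaw κ True (Y p.1 ω, W p.1 ω) (Y p.2 ω, W p.2 ω) =
      ENNReal.ofReal (∏ p ∈ T, (κ ‖Y p.1 ω - Y p.2 ω‖₊ (W p.1 ω) (W p.2 ω) : ℝ)) := by
    intro ω
    rw [ENNReal.ofReal_prod_of_nonneg fun p _ => (κ _ _ _).2.1]
    simp [edgeLaw]
  have hint : Integrable ({ω | ∀ p ∈ T, (G ω).Adj p.1 p.2}.indicator fun _ => (1 : ℝ)) P :=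
    (integrable_const _).indicator hset
  have h1 := setIntegral_condExp hm hint (s := Z ⁻¹' A) ⟨A, hA, rfl⟩
  have h2 := hG.condProb_edges T hT
  have h3 : ∫ ω in Z ⁻¹' A, (∏ p ∈ T, (κ ‖Y p.1 ω - Y p.2 ω‖₊ (W p.1 ω) (W p.2 ω) : ℝ)) ∂P =
      P.real (Z ⁻¹' A ∩ {ω | ∀ p ∈ T, (G ω).Adj p.1 p.2}) := by
    rw [← setIntegral_congr_ae (hZ hA) (h2.mono fun ω h _ => h), h1,
      integral_indicator hset, setIntegral_const, Measure.real, Measure.restrict_apply hset,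
      Set.inter_comm, smul_eq_mul, mul_one, Measure.real]
  have hmeasκ : Measurable fun ω =>
      ∏ p ∈ T, (κ ‖Y p.1 ω - Y p.2 ω‖₊ (W p.1 ω) (W p.2 ω) : ℝ) := by
    have := hG.measurable_location
    have := hG.measurable_weight
    exact Finset.measurable_prod _ fun p _ => measurable_subtype_coe.comp (hκ.comp
      (by fun_prop : Measurable fun ω => (‖Y p.1 ω - Y p.2 ω‖₊, W p.1 ω, W p.2 ω)))
  simp only [hprod]
  rw [← ofReal_integral_eq_lintegral_ofReal, h3, Measure.real,
    ENNReal.ofReal_toReal (measure_ne_top _ _)]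
  · refine Integrable.of_bound hmeasκ.aestronglyMeasurable 1 (ae_of_all _ fun ω => ?_)
    rw [Real.norm_of_nonneg (Finset.prod_nonneg fun p _ => (κ _ _ _).2.1)]
    exact Finset.prod_le_one (fun p _ => (κ _ _ _).2.1) fun p _ => (κ _ _ _).2.2
  · exact ae_of_all _ fun ω => Finset.prod_nonneg fun p _ => (κ _ _ _).2.1

set_option maxHeartbeats 2000000 in
/-- Joint law of the presence and absence of finitely many edges. -/
lemma IsSIRG.measure_forall_adj_iff [IsProbabilityMeasure P] (hG : IsSIRG P Y W κ G)
    (hκ : Measurable fun q : ℝ≥0 × S × S => κ q.1 q.2.1 q.2.2) {A : Set (V → E × S)}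
    (hA : MeasurableSet A) {τ : Type*} (π : τ → V × V) (b : τ → Prop) (T : Finset τ)
    (hinj : Set.InjOn π T) (hT : ∀ t ∈ T, (π t).1 < (π t).2)
    (U : Finset (V × V)) (hU : ∀ p ∈ U, p.1 < p.2) (hUT : ∀ t ∈ T, π t ∉ U) :
    P ((fun ω i => (Y i ω, W i ω)) ⁻¹' A ∩ ({ω | ∀ p ∈ U, (G ω).Adj p.1 p.2} ∩
        {ω | ∀ t ∈ T, (G ω).Adj (π t).1 (π t).2 ↔ b t})) =
      ∫⁻ ω in (fun ω i => (Y i ω, W i ω)) ⁻¹' A,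
        (∏ p ∈ U, edgeLaw κ True (Y p.1 ω, W p.1 ω) (Y p.2 ω, W p.2 ω)) *
        ∏ t ∈ T, edgeLaw κ (b t) (Y (π t).1 ω, W (π t).1 ω) (Y (π t).2 ω, W (π t).2 ω) ∂P := by
  classical
  have hY := hG.measurable_location
  have hW := hG.measurable_weight
  have hmeasE : ∀ (c : Prop) (i j : V),
      Measurable fun ω => edgeLaw κ c (Y i ω, W i ω) (Y j ω, W j ω) := fun c i j =>
    (measurable_edgeLaw hκ c).comp (by fun_prop : Measurable fun ω =>
      ((Y i ω, W i ω), (Y j ω, W j ω)))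
  -- Inclusion-exclusion one pair at a time. A pair required to be present moves from `T` to `U`;
  -- for a pair required to be absent, the case with the pair present is subtracted from the case
  -- with no condition. Hence `U` has to vary in the induction.
  induction T using Finset.induction_on generalizing U with
  | empty => simpa using hG.measure_forall_adj hκ hA U hU
  | insert t T ht ih =>
    have hinj' : Set.InjOn π T := hinj.mono (by simp)
    have hT' : ∀ t ∈ T, (π t).1 < (π t).2 := fun s hs => hT s (by simp [hs])
    have hUT' : ∀ t ∈ T, π t ∉ U := fun s hs => hUT s (by simp [hs])
    have htU : π t ∉ U := hUT t (by simp)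
    have hU2 : ∀ p ∈ insert (π t) U, p.1 < p.2 := by
      intro p hp
      rcases Finset.mem_insert.1 hp with rfl | hp
      · exact hT t (by simp)
      · exact hU p hp
    have hUT2 : ∀ s ∈ T, π s ∉ insert (π t) U := by
      intro s hs hmem
      rcases Finset.mem_insert.1 hmem with h | h
      · exact ht (hinj (by simp [hs]) (by simp) h ▸ hs)
      · exact hUT' s hs h
    have hins := ih hinj' hT' (insert (π t) U) hU2 hUT2
    simp only [Finset.prod_insert htU] at hins
    simp only [Finset.prod_insert ht]
    by_cases hb : b t
    · have hset : ({ω | ∀ p ∈ U, (G ω).Adj p.1 p.2} ∩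
          {ω | ∀ s ∈ insert t T, (G ω).Adj (π s).1 (π s).2 ↔ b s}) =
          {ω | ∀ p ∈ insert (π t) U, (G ω).Adj p.1 p.2} ∩
          {ω | ∀ s ∈ T, (G ω).Adj (π s).1 (π s).2 ↔ b s} := by
        ext ω
        simp only [Set.mem_inter_iff, Set.mem_ofPred_eq, Finset.forall_mem_insert, hb, iff_true]
        tauto
      rw [hset, hins]
      refine lintegral_congr fun ω => ?_
      simp only [hb]
      ring
    · have hold := ih hinj' hT' U hU hUT'
      set B := {ω | ∀ p ∈ U, (G ω).Adj p.1 p.2} ∩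
        {ω | ∀ s ∈ T, (G ω).Adj (π s).1 (π s).2 ↔ b s}
      have hset1 : ({ω | ∀ p ∈ U, (G ω).Adj p.1 p.2} ∩
          {ω | ∀ s ∈ insert t T, (G ω).Adj (π s).1 (π s).2 ↔ b s}) =
          B \ {ω | (G ω).Adj (π t).1 (π t).2} := by
        ext ω
        simp only [B, Set.mem_inter_iff, Set.mem_ofPred_eq, Finset.forall_mem_insert, hb,
          iff_false, Set.mem_sdiff]
        tauto
      have hset2 : ({ω | ∀ p ∈ insert (π t) U, (G ω).Adj p.1 p.2} ∩
          {ω | ∀ s ∈ T, (G ω).Adj (π s).1 (π s).2 ↔ b s}) =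
          B ∩ {ω | (G ω).Adj (π t).1 (π t).2} := by
        ext ω
        simp only [B, Set.mem_inter_iff, Set.mem_ofPred_eq, Finset.forall_mem_insert]
        tauto
      rw [hset2] at hins
      rw [hset1]
      set A' := (fun ω i => (Y i ω, W i ω)) ⁻¹' A
      have hsplit : P (A' ∩ (B ∩ {ω | (G ω).Adj (π t).1 (π t).2})) +
          P (A' ∩ (B \ {ω | (G ω).Adj (π t).1 (π t).2})) = P (A' ∩ B) := by
        rw [← Set.inter_assoc, ← Set.inter_sdiff_assoc]
        exact measure_inter_add_sdiff _ (hG.measurable_adj _ _)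
      -- Adding the finite probability with the edge present avoids subtraction in `ℝ≥0∞`; the two
      -- factors of the new pair then add up to one.
      rw [← ENNReal.add_right_inj (measure_ne_top P
        (A' ∩ (B ∩ {ω | (G ω).Adj (π t).1 (π t).2}))), hsplit, hold, hins, ← lintegral_add_left]
      · refine lintegral_congr fun ω => ?_
        simp only [hb]
        have := edgeLaw_true_add_false κ (Y (π t).1 ω, W (π t).1 ω) (Y (π t).2 ω, W (π t).2 ω)
        calc _ = (edgeLaw κ True (Y (π t).1 ω, W (π t).1 ω) (Y (π t).2 ω, W (π t).2 ω) +
              edgeLaw κ False (Y (π t).1 ω, W (π t).1 ω) (Y (π t).2 ω, W (π t).2 ω)) * _ := by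
              rw [this, one_mul]
          _ = _ := by ring
      · exact ((hmeasE _ _ _).mul (Finset.measurable_prod _ fun p _ => hmeasE _ _ _)).mul
          (Finset.measurable_prod _ fun p _ => hmeasE _ _ _)

end EdgeLaw

/-! ### Probability of a prescribed finite graph, with weights averaged out. -/

section GraphProb

variable {Ω V E : Type*}

lemma min_max_pair_eq {V : Type*} [LinearOrder V] {a b c d : V}
    (h : (min a b, max a b) = (min c d, max c d)) : (a = c ∧ b = d) ∨ (a = d ∧ b = c) := by
  have h1 : min a b = min c d := congrArg Prod.fst h
  have h2 : max a b = max c d := congrArg Prod.snd h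
  rcases le_total a b with hab | hab <;> rcases le_total c d with hcd | hcd <;>
    simp_all

/-- The pairs of distinct elements, in increasing order. -/
def ltPairs (ι : Type*) [Fintype ι] [LinearOrder ι] : Finset (ι × ι) :=
  Finset.univ.filter fun p => p.1 < p.2

lemma mem_ltPairs {ι : Type*} [Fintype ι] [LinearOrder ι] {p : ι × ι} :
    p ∈ ltPairs ι ↔ p.1 < p.2 := by
  simp [ltPairs]

lemma eq_iff_forall_ltPairs {ι : Type*} [Fintype ι] [LinearOrder ι] (Γ Γ' : SimpleGraph ι) :
    Γ = Γ' ↔ ∀ p ∈ ltPairs ι, (Γ.Adj p.1 p.2 ↔ Γ'.Adj p.1 p.2) := by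
  constructor
  · rintro rfl
    simp
  · intro h
    ext a b
    rcases lt_trichotomy a b with hab | rfl | hab
    · exact h (a, b) (mem_ltPairs.2 hab)
    · simp
    · rw [Γ.adj_comm, Γ'.adj_comm]
      exact h (b, a) (mem_ltPairs.2 hab)

variable [NormedAddCommGroup E]

/-- The probability that the random graph on vertices with locations and weights `z` is `Γ`. -/
noncomputable def graphProb {S ι : Type*} [Fintype ι] [LinearOrder ι] (κ : ℝ≥0 → S → S → I)
    (Γ : SimpleGraph ι) (z : ι → E × S) : ℝ≥0∞ :=
  ∏ p ∈ ltPairs ι, edgeLaw κ (Γ.Adj p.1 p.2) (z p.1) (z p.2)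

/-- The probability that the random graph on vertices with locations `y` and independent uniform
weights is `Γ`. -/
noncomputable def meanGraphProb {ι : Type*} [Fintype ι] [LinearOrder ι] (κ : ℝ≥0 → I → I → I)
    (Γ : SimpleGraph ι) (y : ι → E) : ℝ≥0∞ :=
  ∫⁻ w : ι → I, graphProb κ Γ fun a => (y a, w a)

/-- Only differences of locations enter. This is what allows a root to be moved to the origin. -/
lemma meanGraphProb_sub_const {ι : Type*} [Fintype ι] [LinearOrder ι] (κ : ℝ≥0 → I → I → I)
    (Γ : SimpleGraph ι) (y : ι → E) (c : E) :
    meanGraphProb κ Γ (fun a => y a - c) = meanGraphProb κ Γ y := by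
  simp [meanGraphProb, graphProb, edgeLaw]

variable [MeasurableSpace Ω] {P : Measure Ω} [MeasurableSpace E] [BorelSpace E]
  [SecondCountableTopology E]

lemma measurable_graphProb {S ι : Type*} [MeasurableSpace S] [Fintype ι] [LinearOrder ι]
    {κ : ℝ≥0 → S → S → I} (hκ : Measurable fun q : ℝ≥0 × S × S => κ q.1 q.2.1 q.2.2)
    (Γ : SimpleGraph ι) : Measurable (graphProb (E := E) κ Γ) :=
  Finset.measurable_prod _ fun p _ => (measurable_edgeLaw hκ _).comp
    (by fun_prop : Measurable fun z : ι → E × S => (z p.1, z p.2))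

lemma measurable_meanGraphProb {ι : Type*} [Fintype ι] [LinearOrder ι]
    {κ : ℝ≥0 → I → I → I} (hκ : Measurable fun q : ℝ≥0 × I × I => κ q.1 q.2.1 q.2.2)
    (Γ : SimpleGraph ι) : Measurable (meanGraphProb (E := E) κ Γ) := by
  refine Measurable.lintegral_prod_right' (f := fun q : (ι → E) × (ι → I) =>
    graphProb κ Γ fun a => (q.1 a, q.2 a)) ?_
  exact (measurable_graphProb hκ Γ).comp (by fun_prop)

section

variable {S : Type*} [MeasurableSpace S] [LinearOrder V]
  {Y : V → Ω → E} {W : V → Ω → S} {κ : ℝ≥0 → S → S → I} {G : Ω → SimpleGraph V}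

/-- The blocks `f₁` and `f₂` have no vertex in common, so they prescribe the states of disjoint sets
of pairs, and the conditional probabilities multiply. Edges between the blocks remain unconstrained.
-/
lemma IsSIRG.measure_comap_eq_and_comap_eq [IsProbabilityMeasure P] (hG : IsSIRG P Y W κ G)
    (hκ : Measurable fun q : ℝ≥0 × S × S => κ q.1 q.2.1 q.2.2)
    (hsymm : ∀ t x y, κ t x y = κ t y x) {A : Set (V → E × S)}
    (hA : MeasurableSet A) {ι₁ ι₂ : Type*} [Fintype ι₁] [LinearOrder ι₁] [Fintype ι₂]
    [LinearOrder ι₂] (f₁ : ι₁ → V) (f₂ : ι₂ → V) (hf : Function.Injective (Sum.elim f₁ f₂))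
    (Γ₁ : SimpleGraph ι₁) (Γ₂ : SimpleGraph ι₂) :
    P ((fun ω i => (Y i ω, W i ω)) ⁻¹' A ∩
        {ω | (G ω).comap f₁ = Γ₁ ∧ (G ω).comap f₂ = Γ₂}) =
      ∫⁻ ω in (fun ω i => (Y i ω, W i ω)) ⁻¹' A,
        graphProb κ Γ₁ (fun a => (Y (f₁ a) ω, W (f₁ a) ω)) *
        graphProb κ Γ₂ (fun a => (Y (f₂ a) ω, W (f₂ a) ω)) ∂P := by
  have hf₁ : Function.Injective f₁ := fun a b h => Sum.inl_injective
    (hf (a₁ := .inl a) (a₂ := .inl b) h)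
  have hf₂ : Function.Injective f₂ := fun a b h => Sum.inr_injective
    (hf (a₁ := .inr a) (a₂ := .inr b) h)
  have hf₁₂ : ∀ a b, f₁ a ≠ f₂ b := fun a b h =>
    Sum.inl_ne_inr (hf (a₁ := .inl a) (a₂ := .inr b) h)
  -- Edge probabilities are given for increasing pairs in `V`, but `f₁` and `f₂` need not be
  -- monotone. Each pair is therefore sorted, which changes neither adjacency nor, by symmetry of
  -- `κ`, the edge probability.
  let o : V → V → V × V := fun a b => (min a b, max a b)
  let π : (ι₁ × ι₁) ⊕ (ι₂ × ι₂) → V × V :=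
    Sum.elim (fun p => o (f₁ p.1) (f₁ p.2)) (fun p => o (f₂ p.1) (f₂ p.2))
  let b : (ι₁ × ι₁) ⊕ (ι₂ × ι₂) → Prop :=
    Sum.elim (fun p => Γ₁.Adj p.1 p.2) (fun p => Γ₂.Adj p.1 p.2)
  let T : Finset ((ι₁ × ι₁) ⊕ (ι₂ × ι₂)) := (ltPairs ι₁).disjSum (ltPairs ι₂)
  have hinj : Set.InjOn π T := by
    rintro (⟨a, b⟩ | ⟨a, b⟩) hp (⟨c, d⟩ | ⟨c, d⟩) hq hpq
    all_goals
      simp only [T, Finset.mem_coe, Finset.inl_mem_disjSum, Finset.inr_mem_disjSum,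
        mem_ltPairs] at hp hq
      rcases min_max_pair_eq hpq with ⟨h1, h2⟩ | ⟨h1, h2⟩
    · obtain rfl : a = c := hf₁ h1
      obtain rfl : b = d := hf₁ h2
      rfl
    · obtain rfl : a = d := hf₁ h1
      obtain rfl : b = c := hf₁ h2
      exact absurd hp (not_lt_of_gt hq)
    · exact absurd h1 (hf₁₂ _ _)
    · exact absurd h1 (hf₁₂ _ _)
    · exact absurd h1.symm (hf₁₂ _ _)
    · exact absurd h1.symm (hf₁₂ _ _)
    · obtain rfl : a = c := hf₂ h1
      obtain rfl : b = d := hf₂ h2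
      rfl
    · obtain rfl : a = d := hf₂ h1
      obtain rfl : b = c := hf₂ h2
      exact absurd hp (not_lt_of_gt hq)
  have hT : ∀ t ∈ T, (π t).1 < (π t).2 := by
    rintro (⟨a, b⟩ | ⟨a, b⟩) hp
    all_goals
      simp only [T, Finset.inl_mem_disjSum, Finset.inr_mem_disjSum, mem_ltPairs] at hp
      refine min_lt_max.2 fun h => ?_
    · exact hp.ne (hf₁ h)
    · exact hp.ne (hf₂ h)
  have hadj : ∀ (Γ : SimpleGraph V) (u v : V), Γ.Adj (o u v).1 (o u v).2 ↔ Γ.Adj u v := by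
    intro Γ u v
    rcases le_total u v with h | h
    · simp [o, h]
    · simpa [o, h] using Γ.adj_comm v u
  have hlaw : ∀ (c : Prop) (u v : V) (ω : Ω),
      edgeLaw κ c (Y (o u v).1 ω, W (o u v).1 ω) (Y (o u v).2 ω, W (o u v).2 ω) =
      edgeLaw κ c (Y u ω, W u ω) (Y v ω, W v ω) := by
    intro c u v ω
    rcases le_total u v with h | h
    · simp [o, h]
    · simpa [o, h] using edgeLaw_symm hsymm c _ _
  have key := hG.measure_forall_adj_iff hκ hA π b T hinj hT ∅ (by simp) (by simp)
  simp only [Finset.notMem_empty, false_imp_iff, implies_true, Set.ofPred_true, Set.univ_inter,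
    Finset.prod_empty, one_mul, T, Finset.prod_disjSum, π, b, Sum.elim_inl, Sum.elim_inr,
    hlaw] at key
  simp only [graphProb]
  rw [← key]
  congr 2
  ext ω
  simp only [Set.mem_ofPred_eq, eq_iff_forall_ltPairs, SimpleGraph.comap_adj]
  constructor
  · rintro ⟨h1, h2⟩ (p | p) hp
    · simpa [hadj] using h1 p (by simpa using hp)
    · simpa [hadj] using h2 p (by simpa using hp)
  · intro h
    exact ⟨fun p hp => by simpa [hadj] using h (.inl p) (by simpa using hp),
      fun p hp => by simpa [hadj] using h (.inr p) (by simpa using hp)⟩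

end

/-- Fubini's theorem: the weights are independent of the locations, and finitely many distinct ones
have the product law. -/
lemma lintegral_uniformWeights {Ω V E : Type*} [MeasurableSpace Ω] {P : Measure Ω}
    [IsProbabilityMeasure P] [MeasurableSpace E] {Y : V → Ω → E} {W : V → Ω → I}
    (hY : ∀ i, Measurable (Y i)) (hW : IsUniformWeights P W Y) {ι : Type*} [Fintype ι]
    (g : ι → V) (hg : Function.Injective g)
    {Φ : (V → E) × (ι → I) → ℝ≥0∞} (hΦ : Measurable Φ) :
    ∫⁻ ω, Φ (fun i => Y i ω, fun a => W (g a) ω) ∂P =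
      ∫⁻ ω, (∫⁻ w : ι → I, Φ (fun i => Y i ω, w)) ∂P := by
  have hYm : Measurable fun ω i => Y i ω := measurable_pi_lambda _ hY
  have hWm : Measurable fun ω (a : ι) => W (g a) ω :=
    measurable_pi_lambda _ fun a => hW.measurable _
  have hind : IndepFun (fun ω i => Y i ω) (fun ω (a : ι) => W (g a) ω) P :=
    hW.indep_location.comp (φ := id) (ψ := fun (w : V → I) (a : ι) => w (g a)) measurable_id
      (by fun_prop)
  have hlaw : P.map (fun ω (a : ι) => W (g a) ω) = volume := by
    rw [(hW.indep.precomp hg).map_fun_eq_pi_map fun a => (hW.measurable _).aemeasurable]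
    simp only [hW.law]
    rfl
  have hjoint := (indepFun_iff_map_prod_eq_prod_map_map hYm.aemeasurable hWm.aemeasurable).1 hind
  rw [hlaw] at hjoint
  calc _ = ∫⁻ q, Φ q ∂(P.map fun ω => (fun i => Y i ω, fun a => W (g a) ω)) := by
        rw [lintegral_map hΦ (hYm.prodMk hWm)]
    _ = _ := by
        rw [hjoint, lintegral_prod _ hΦ.aemeasurable, lintegral_map _ hYm]
        exact hΦ.lintegral_prod_right'

variable [LinearOrder V] {Y : V → Ω → E} {W : V → Ω → I} {κ : ℝ≥0 → I → I → I}
  {G : Ω → SimpleGraph V}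

/-- The two blocks involve disjoint sets of independent weights, so after integrating these out the
product of graph probabilities is still a product. All remaining dependence between the blocks is
through the locations. -/
lemma IsSIRG.measure_comap_eq_and_comap_eq_of_uniformWeights [IsProbabilityMeasure P]
    (hG : IsSIRG P Y W κ G) (hκ : Measurable fun q : ℝ≥0 × I × I => κ q.1 q.2.1 q.2.2)
    (hsymm : ∀ t x y, κ t x y = κ t y x) (hW : IsUniformWeights P W Y) {A : Set (V → E)}
    (hA : MeasurableSet A) {ι₁ ι₂ : Type*} [Fintype ι₁] [LinearOrder ι₁] [Fintype ι₂]
    [LinearOrder ι₂] (f₁ : ι₁ → V) (f₂ : ι₂ → V) (hf : Function.Injective (Sum.elim f₁ f₂))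
    (Γ₁ : SimpleGraph ι₁) (Γ₂ : SimpleGraph ι₂) :
    P ((fun ω i => Y i ω) ⁻¹' A ∩ {ω | (G ω).comap f₁ = Γ₁ ∧ (G ω).comap f₂ = Γ₂}) =
      ∫⁻ ω in (fun ω i => Y i ω) ⁻¹' A,
        meanGraphProb κ Γ₁ (fun a => Y (f₁ a) ω) *
        meanGraphProb κ Γ₂ (fun a => Y (f₂ a) ω) ∂P := by
  have hYm : Measurable fun ω i => Y i ω := measurable_pi_lambda _ hG.measurable_location
  have hA' : MeasurableSet {z : V → E × I | (fun i => (z i).1) ∈ A} :=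
    (by fun_prop : Measurable fun (z : V → E × I) i => (z i).1) hA
  have h1 := hG.measure_comap_eq_and_comap_eq hκ hsymm hA' f₁ f₂ hf Γ₁ Γ₂
  have hpre : (fun ω i => (Y i ω, W i ω)) ⁻¹' {z : V → E × I | (fun i => (z i).1) ∈ A} =
      (fun ω i => Y i ω) ⁻¹' A := rfl
  rw [hpre] at h1
  rw [h1, ← lintegral_indicator (hYm hA), ← lintegral_indicator (hYm hA)]
  let Φ : (V → E) × (ι₁ ⊕ ι₂ → I) → ℝ≥0∞ := fun q => A.indicator 1 q.1 *
    (graphProb κ Γ₁ (fun a => (q.1 (f₁ a), q.2 (.inl a))) *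
      graphProb κ Γ₂ (fun a => (q.1 (f₂ a), q.2 (.inr a))))
  have hΦ : Measurable Φ := by
    refine Measurable.mul ((measurable_one.indicator hA).comp measurable_fst) (Measurable.mul ?_ ?_)
    · exact (measurable_graphProb hκ Γ₁).comp (by fun_prop)
    · exact (measurable_graphProb hκ Γ₂).comp (by fun_prop)
  have h2 := lintegral_uniformWeights hG.measurable_location hW (Sum.elim f₁ f₂) hf hΦ
  have hl : ∀ (F : Ω → ℝ≥0∞) ω, ((fun ω i => Y i ω) ⁻¹' A).indicator F ω =
      A.indicator 1 (fun i => Y i ω) * F ω := by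
    intro F ω
    by_cases h : (fun i => Y i ω) ∈ A
    · rw [Set.indicator_of_mem (show ω ∈ (fun ω i => Y i ω) ⁻¹' A from h),
        Set.indicator_of_mem h]
      simp
    · rw [Set.indicator_of_notMem (show ω ∉ (fun ω i => Y i ω) ⁻¹' A from h),
        Set.indicator_of_notMem h]
      simp
  simp only [hl]
  refine (show _ = _ from h2).trans (lintegral_congr fun ω => ?_)
  simp only [Φ]
  have hm1 : Measurable fun w : ι₁ → I => graphProb κ Γ₁ fun a => (Y (f₁ a) ω, w a) :=
    (measurable_graphProb hκ Γ₁).comp (by fun_prop)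
  have hm2 : Measurable fun w : ι₂ → I => graphProb κ Γ₂ fun a => (Y (f₂ a) ω, w a) :=
    (measurable_graphProb hκ Γ₂).comp (by fun_prop)
  rw [lintegral_const_mul]
  · congr 1
    rw [← (volume_measurePreserving_sumPiEquivProdPi_symm
      (fun _ : ι₁ ⊕ ι₂ => I)).lintegral_comp_emb (MeasurableEquiv.measurableEmbedding _)]
    exact lintegral_prod_mul hm1.aemeasurable hm2.aemeasurable
  · refine Measurable.mul ?_ ?_
    · exact (measurable_graphProb hκ Γ₁).comp (by fun_prop)
    · exact (measurable_graphProb hκ Γ₂).comp (by fun_prop)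

/-- Averaged probability that two vertices at a given displacement are adjacent. -/
noncomputable def meanConnection (κ : ℝ≥0 → I → I → I) (x : E) : ℝ≥0∞ :=
  ∫⁻ w : I × I, ENNReal.ofReal (κ ‖x‖₊ w.1 w.2)

lemma measurable_meanConnection {E : Type*} [NormedAddCommGroup E] [MeasurableSpace E]
    [BorelSpace E] {κ : ℝ≥0 → I → I → I}
    (hκ : Measurable fun q : ℝ≥0 × I × I => κ q.1 q.2.1 q.2.2) :
    Measurable (meanConnection (E := E) κ) := by
  refine Measurable.lintegral_prod_right' (f := fun q : E × (I × I) =>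
    ENNReal.ofReal (κ ‖q.1‖₊ q.2.1 q.2.2)) ?_
  exact (measurable_subtype_coe.comp (hκ.comp (by fun_prop :
    Measurable fun q : E × (I × I) => (‖q.1‖₊, q.2.1, q.2.2)))).ennreal_ofReal

lemma IsSIRG.measure_adj_of_uniformWeights [IsProbabilityMeasure P]
    (hG : IsSIRG P Y W κ G) (hκ : Measurable fun q : ℝ≥0 × I × I => κ q.1 q.2.1 q.2.2)
    (hW : IsUniformWeights P W Y) {A : Set (V → E)}
    (hA : MeasurableSet A) {u v : V} (huv : u ≠ v) :
    P ((fun ω i => Y i ω) ⁻¹' A ∩ {ω | (G ω).Adj u v}) =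
      ∫⁻ ω in (fun ω i => Y i ω) ⁻¹' A, meanConnection κ (Y u ω - Y v ω) ∂P := by
  -- `meanConnection` depends on the norm of the displacement and averages over both weights, so the
  -- order of the two vertices is immaterial.
  wlog hlt : u < v generalizing u v
  · have h := this huv.symm (lt_of_le_of_ne (not_lt.1 hlt) huv.symm)
    simp only [(G _).adj_comm u v]
    rw [h]
    refine lintegral_congr fun ω => ?_
    unfold meanConnection
    rw [← nnnorm_neg, neg_sub]
  have hYm : Measurable fun ω i => Y i ω := measurable_pi_lambda _ hG.measurable_location
  have hA' : MeasurableSet {z : V → E × I | (fun i => (z i).1) ∈ A} :=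
    (by fun_prop : Measurable fun (z : V → E × I) i => (z i).1) hA
  have h1 := hG.measure_forall_adj hκ hA' {(u, v)} (by simpa using hlt)
  have hpre : (fun ω i => (Y i ω, W i ω)) ⁻¹' {z : V → E × I | (fun i => (z i).1) ∈ A} =
      (fun ω i => Y i ω) ⁻¹' A := rfl
  simp only [Finset.mem_singleton, forall_eq, Finset.prod_singleton, hpre] at h1
  rw [h1, ← lintegral_indicator (hYm hA), ← lintegral_indicator (hYm hA)]
  let Φ : (V → E) × (Fin 2 → I) → ℝ≥0∞ := fun q => A.indicator
    (fun y => edgeLaw κ True (y u, q.2 0) (y v, q.2 1)) q.1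
  have hΦ : Measurable Φ := by
    have : Φ = fun q => A.indicator 1 q.1 * edgeLaw κ True (q.1 u, q.2 0) (q.1 v, q.2 1) := by
      ext q
      by_cases h : q.1 ∈ A <;> simp [Φ, h]
    rw [this]
    exact ((measurable_one.indicator hA).comp measurable_fst).mul
      ((measurable_edgeLaw hκ True).comp (by fun_prop : Measurable
        fun q : (V → E) × (Fin 2 → I) => ((q.1 u, q.2 0), (q.1 v, q.2 1))))
  have hg : Function.Injective ![u, v] := by
    intro a b
    fin_cases a <;> fin_cases b <;> simp [huv, huv.symm]
  have h2 := lintegral_uniformWeights hG.measurable_location hW ![u, v] hg hΦ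
  refine (show _ = _ from h2).trans (lintegral_congr fun ω => ?_)
  by_cases h : (fun i => Y i ω) ∈ A
  · rw [Set.indicator_of_mem (show ω ∈ (fun ω i => Y i ω) ⁻¹' A from h)]
    simp only [Φ, Set.indicator_of_mem h, meanConnection, edgeLaw, if_true]
    rw [← (volume_preserving_finTwoArrow I).lintegral_comp_emb
      (MeasurableEquiv.measurableEmbedding _)]
    rfl
  · rw [Set.indicator_of_notMem (show ω ∉ (fun ω i => Y i ω) ⁻¹' A from h)]
    simp [Φ, Set.indicator_of_notMem h]

end GraphProb

/-! ### Counting enumerations of a finite set. -/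

section Enumerations

/-- The number of enumerations of a set along which a colouring takes prescribed values. -/
lemma tsum_enumerations_eq {V K : Type*} [Fintype K] [DecidableEq K] {m : ℕ} (S : Set V)
    (t : V → K) (s : Fin m → K) :
    ∑' f : Fin m ↪ V, {f : Fin m ↪ V | Set.range f = S ∧ ∀ l, t (f l) = s l}.indicator
      (1 : (Fin m ↪ V) → ℝ≥0∞) f =
    {q : K → ℕ∞ | ∀ k, q k = (Fintype.card {l // s l = k} : ℕ∞)}.indicator
      (fun _ => ((∏ k, (Fintype.card {l // s l = k}).factorial : ℕ) : ℝ≥0∞))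
      fun k => {i | i ∈ S ∧ t i = k}.encard := by
  classical
  rw [← tsum_subtype]
  simp only [Pi.one_apply]
  by_cases h : ∀ k, {i | i ∈ S ∧ t i = k}.encard = (Fintype.card {l // s l = k} : ℕ∞)
  · rw [Set.indicator_of_mem (by exact h)]
    have hequiv : ∀ k, Nonempty ({l // s l = k} ≃ {i : S // t i = k}) := by
      intro k
      have e1 : {i : S // t i = k} ≃ {i | i ∈ S ∧ t i = k} :=
        Equiv.subtypeSubtypeEquivSubtypeInter (fun i => i ∈ S) fun i => t i = k
      have hfin : {i | i ∈ S ∧ t i = k}.Finite := Set.finite_of_encard_eq_coe (h k)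
      have := hfin.fintype
      refine ⟨(Fintype.equivOfCardEq ?_).trans e1.symm⟩
      have h2 := h k
      rw [Set.encard_eq_coe_toFinset_card, Set.toFinset_card] at h2
      exact_mod_cast h2.symm
    let e : Fin m ≃ S := Equiv.ofFiberEquiv (f := s) (g := fun i : S => t i)
      fun k => (hequiv k).some
    have he : ∀ l, t (e l) = s l := fun l =>
      Equiv.ofFiberEquiv_map (f := s) (g := fun i : S => t i) (fun k => (hequiv k).some) l
    -- Relative to the fixed enumeration `e`, the admissible enumerations are the permutations
    -- preserving `s`; their number is the product of the factorials of the fibre sizes.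
    let E : {g : Equiv.Perm (Fin m) // s ∘ g = s} ≃
        {f : Fin m ↪ V | Set.range f = S ∧ ∀ l, t (f l) = s l} :=
      { toFun := fun g => ⟨(g.1.trans e).toEmbedding.trans (Function.Embedding.subtype _), by
          constructor
          · ext i
            simp only [Set.mem_range, Function.Embedding.trans_apply, Equiv.coe_toEmbedding]
            constructor
            · rintro ⟨l, rfl⟩
              exact ((g.1.trans e) l).2
            · intro hi
              exact ⟨(g.1.trans e).symm ⟨i, hi⟩, by simp⟩
          · intro l
            simp only [Function.Embedding.trans_apply, Equiv.coe_toEmbedding]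
            exact (he (g.1 l)).trans (congrFun g.2 l)⟩
        invFun := fun f => ⟨((Equiv.ofInjective f.1 f.1.injective).trans
          (Equiv.setCongr f.2.1)).trans e.symm, by
            ext l
            rw [Function.comp_apply, ← he]
            simp [f.2.2 l]⟩
        left_inv := by
          intro g
          exact Subtype.ext (Equiv.ext fun l => e.symm_apply_apply (g.1 l))
        right_inv := by
          intro f
          ext l
          simp }
    rw [← E.tsum_eq, tsum_fintype, Finset.sum_const, Finset.card_univ, DomMulAct.stabilizer_card]
    simp
  · rw [Set.indicator_of_notMem (by exact h), ENNReal.tsum_eq_zero]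
    rintro ⟨f, hf, hfs⟩
    exfalso
    apply h
    intro k
    have : {i | i ∈ S ∧ t i = k} = f '' {l | s l = k} := by
      ext i
      simp only [Set.mem_ofPred_eq, Set.mem_image]
      constructor
      · rintro ⟨hi, hk⟩
        rw [← hf] at hi
        obtain ⟨l, rfl⟩ := hi
        exact ⟨l, (hfs l).symm.trans hk, rfl⟩
      · rintro ⟨l, hl, rfl⟩
        exact ⟨hf ▸ Set.mem_range_self l, (hfs l).trans hl⟩
    rw [this, f.injective.encard_image, Set.encard_eq_coe_toFinset_card, Set.toFinset_card]
    rfl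

instance {V : Type*} [Countable V] (m : ℕ) : Countable (Fin m ↪ V) :=
  DFunLike.coe_injective.countable

end Enumerations

/-! ### Moment measures and Janossy measures of a Poisson process. -/

section Poisson

lemma toENNReal_countIn {Ω E : Type*} (Z : ℕ → Ω → E) (B : Set E) (ω : Ω) :
    (countIn Z B ω : ℝ≥0∞) = ∑' i, B.indicator 1 (Z i ω) := by
  rw [countIn, ← ENNReal.tsum_set_one, tsum_subtype {i | Z i ω ∈ B} (fun _ => (1 : ℝ≥0∞))]
  rfl

lemma toENNReal_countIn_union {Ω E : Type*} (Z : ℕ → Ω → E) {A B : Set E} (hAB : Disjoint A B)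
    (ω : Ω) :
    (countIn Z (A ∪ B) ω : ℝ≥0∞) = countIn Z A ω + countIn Z B ω := by
  simp only [toENNReal_countIn, Set.indicator_union_of_disjoint hAB, ENNReal.tsum_add]

variable {Ω E : Type*} [MeasurableSpace Ω] {P : Measure Ω} [MeasurableSpace E]
  {Z : ℕ → Ω → E} {μ : Measure E}

namespace IsPoissonProcess

lemma measurable_toENNReal_countIn (hZ : IsPoissonProcess P Z μ) {B : Set E}
    (hB : MeasurableSet B) : Measurable fun ω => (countIn Z B ω : ℝ≥0∞) := by
  simp only [toENNReal_countIn]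
  exact Measurable.tsum fun i =>
    (measurable_one.indicator hB).comp (hZ.measurable_point i)

lemma measurable_countIn (hZ : IsPoissonProcess P Z μ) {B : Set E}
    (hB : MeasurableSet B) : Measurable (countIn Z B) := by
  refine measurable_to_countable' fun x => ?_
  have : countIn Z B ⁻¹' {x} = (fun ω => (countIn Z B ω : ℝ≥0∞)) ⁻¹' {(x : ℝ≥0∞)} := by
    ext ω
    simp
  rw [this]
  exact hZ.measurable_toENNReal_countIn hB (measurableSet_singleton _)

lemma tsum_poissonMeasure_singleton (r : ℝ≥0) : ∑' k : ℕ, poissonMeasure r {k} = 1 := by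
  simp only [poissonMeasure_singleton]
  rw [← ENNReal.ofReal_tsum_of_nonneg (fun _ => by positivity)
    (hasSum_one_poissonMeasure r).summable, (hasSum_one_poissonMeasure r).tsum_eq]
  simp

/-- The joint law of the counts of finitely many disjoint sets, indexed by a finite type. -/
lemma measure_forall_countIn_eq (hZ : IsPoissonProcess P Z μ) {K : Type*} [Fintype K]
    (C : K → Set E) (hC : ∀ k, MeasurableSet (C k))
    (hdisj : Pairwise fun i j => Disjoint (C i) (C j))
    (hfin : ∀ k, μ (C k) ≠ ∞) (a : K → ℕ) :
    P {ω | ∀ k, countIn Z (C k) ω = (a k : ℕ∞)} =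
      ∏ k, poissonMeasure (μ (C k)).toNNReal {a k} := by
  let e := Fintype.equivFin K
  have hind := hZ.count_indep _ (fun j => C (e.symm j)) (fun j => hC _)
    (fun i j hij => hdisj fun h => hij (e.symm.injective h))
  have h1 := hind.measure_inter_preimage_eq_mul Finset.univ
    (sets := fun j => {((a (e.symm j) : ℕ) : ℕ∞)}) (fun j _ => measurableSet_singleton _)
  have h2 : {ω | ∀ k, countIn Z (C k) ω = (a k : ℕ∞)} =
      ⋂ j ∈ (Finset.univ : Finset (Fin (Fintype.card K))),
        countIn Z (C (e.symm j)) ⁻¹' {((a (e.symm j) : ℕ) : ℕ∞)} := by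
    ext ω
    simp only [Set.mem_ofPred_eq, Finset.mem_univ, Set.iInter_true, Set.mem_iInter,
      Set.mem_preimage, Set.mem_singleton_iff]
    exact ⟨fun h j => h _, fun h k => by simpa using h (e k)⟩
  rw [h2, h1, ← e.symm.prod_comp]
  exact Finset.prod_congr rfl fun j _ => hZ.count_law _ (hC _) (hfin _) _

lemma measurableSet_range_eq (hZ : IsPoissonProcess P Z μ) {B : Set E} (hB : MeasurableSet B)
    {m : ℕ} (f : Fin m ↪ ℕ) : MeasurableSet {ω | Set.range f = {i | Z i ω ∈ B}} := by
  have : {ω | Set.range f = {i | Z i ω ∈ B}} =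
      ⋂ i, if i ∈ Set.range f then Z i ⁻¹' B else (Z i ⁻¹' B)ᶜ := by
    ext ω
    simp only [Set.mem_ofPred_eq, Set.ext_iff, Set.mem_iInter]
    refine forall_congr' fun i => ?_
    split_ifs with h <;> simp [h]
  rw [this]
  refine MeasurableSet.iInter fun i => ?_
  split_ifs
  · exact hZ.measurable_point i hB
  · exact (hZ.measurable_point i hB).compl

variable [IsProbabilityMeasure P]

/-- The Poisson probabilities of the finite counts already add up to one. -/
lemma measure_countIn_eq_top (hZ : IsPoissonProcess P Z μ) {B : Set E} (hB : MeasurableSet B)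
    (hμB : μ B ≠ ∞) : P {ω | countIn Z B ω = ⊤} = 0 := by
  have hm := hZ.measurable_countIn hB
  have h1 : P (⋃ k : ℕ, {ω | countIn Z B ω = (k : ℕ∞)}) = 1 := by
    rw [measure_iUnion]
    · simp only [hZ.count_law B hB hμB, tsum_poissonMeasure_singleton]
    · intro i j hij
      refine Set.disjoint_left.2 fun ω hi hj => hij ?_
      have : (i : ℕ∞) = j := (show countIn Z B ω = i from hi).symm.trans hj
      exact_mod_cast this
    · exact fun k => hm (measurableSet_singleton _)
  have h2 : {ω | countIn Z B ω = ⊤} ⊆ (⋃ k : ℕ, {ω | countIn Z B ω = (k : ℕ∞)})ᶜ := by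
    intro ω hω hω'
    obtain ⟨k, hk⟩ := Set.mem_iUnion.1 hω'
    have : (k : ℕ∞) = ⊤ := (show countIn Z B ω = k from hk).symm.trans hω
    simp at this
  refine measure_mono_null h2 ?_
  exact (prob_compl_eq_zero_iff (MeasurableSet.iUnion fun k =>
    hm (measurableSet_singleton _))).2 h1

lemma lintegral_countIn (hZ : IsPoissonProcess P Z μ) {B : Set E} (hB : MeasurableSet B)
    (hμB : μ B ≠ ∞) (F : ℕ∞ → ℝ≥0∞) :
    ∫⁻ ω, F (countIn Z B ω) ∂P = ∑' k : ℕ, F k * poissonMeasure (μ B).toNNReal {k} := by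
  have hm := hZ.measurable_countIn hB
  have hmap : ∀ x, P.map (countIn Z B) {x} = P {ω | countIn Z B ω = x} := fun x =>
    Measure.map_apply hm (measurableSet_singleton _)
  rw [← lintegral_map (measurable_from_top) hm, lintegral_countable']
  simp only [hmap]
  rw [← Function.Injective.tsum_eq (g := ((↑) : ℕ → ℕ∞)) Nat.cast_injective]
  · simp only [hZ.count_law B hB hμB]
  · intro x hx
    induction x using ENat.recTopCoe with
    | top => simp [hZ.measure_countIn_eq_top hB hμB] at hx
    | coe k => exact ⟨k, rfl⟩

/-- The size-bias identity of the Poisson law; shifting the index with it yields the first two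
moments. -/
lemma succ_mul_poissonMeasure_singleton (r : ℝ≥0) (k : ℕ) :
    ((k + 1 : ℕ) : ℝ≥0∞) * poissonMeasure r {k + 1} = r * poissonMeasure r {k} := by
  simp only [poissonMeasure_singleton]
  rw [← ENNReal.ofReal_natCast, ← ENNReal.ofReal_coe_nnreal, ← ENNReal.ofReal_mul (by positivity),
    ← ENNReal.ofReal_mul (by positivity)]
  congr 1
  rw [Nat.factorial_succ]
  push_cast
  field_simp
  ring

lemma tsum_mul_poissonMeasure (r : ℝ≥0) : ∑' k : ℕ, (k : ℝ≥0∞) * poissonMeasure r {k} = r := by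
  rw [tsum_eq_zero_add' ENNReal.summable]
  simp only [succ_mul_poissonMeasure_singleton, ENNReal.tsum_mul_left,
    tsum_poissonMeasure_singleton]
  simp

lemma tsum_mul_self_mul_poissonMeasure (r : ℝ≥0) :
    ∑' k : ℕ, (k : ℝ≥0∞) * k * poissonMeasure r {k} = r * r + r := by
  rw [tsum_eq_zero_add' ENNReal.summable]
  simp only [mul_assoc, succ_mul_poissonMeasure_singleton]
  have : ∀ k : ℕ, ((k + 1 : ℕ) : ℝ≥0∞) * (r * poissonMeasure r {k}) =
      r * ((k : ℝ≥0∞) * poissonMeasure r {k}) + r * poissonMeasure r {k} := by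
    intro k
    push_cast
    ring
  simp only [this, ENNReal.tsum_add, ENNReal.tsum_mul_left, tsum_mul_poissonMeasure,
    tsum_poissonMeasure_singleton]
  simp

lemma lintegral_toENNReal_countIn (hZ : IsPoissonProcess P Z μ) {B : Set E}
    (hB : MeasurableSet B) (hμB : μ B ≠ ∞) : ∫⁻ ω, countIn Z B ω ∂P = μ B := by
  rw [hZ.lintegral_countIn hB hμB fun x => x]
  simp only [ENat.toENNReal_coe, tsum_mul_poissonMeasure, ENNReal.coe_toNNReal hμB]

lemma lintegral_countIn_mul_self (hZ : IsPoissonProcess P Z μ) {B : Set E}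
    (hB : MeasurableSet B) (hμB : μ B ≠ ∞) :
    ∫⁻ ω, (countIn Z B ω : ℝ≥0∞) * countIn Z B ω ∂P = μ B * μ B + μ B := by
  rw [hZ.lintegral_countIn hB hμB fun x => (x : ℝ≥0∞) * x]
  simp only [ENat.toENNReal_coe, tsum_mul_self_mul_poissonMeasure, ENNReal.coe_toNNReal hμB]

lemma lintegral_countIn_mul_of_disjoint (hZ : IsPoissonProcess P Z μ) {A B : Set E}
    (hA : MeasurableSet A) (hB : MeasurableSet B) (hAB : Disjoint A B) (hμA : μ A ≠ ∞)
    (hμB : μ B ≠ ∞) :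
    ∫⁻ ω, (countIn Z A ω : ℝ≥0∞) * countIn Z B ω ∂P = μ A * μ B := by
  have hind := hZ.count_indep 2 ![A, B] (by simp [Fin.forall_fin_two, hA, hB]) (by
    intro i j hij
    fin_cases i <;> fin_cases j <;> simp_all [disjoint_comm])
  have h2 : IndepFun (countIn Z A) (countIn Z B) P := hind.indepFun (i := 0) (j := 1) (by simp)
  have h3 : IndepFun (fun ω => (countIn Z A ω : ℝ≥0∞)) (fun ω => (countIn Z B ω : ℝ≥0∞)) P :=
    h2.comp (φ := fun x : ℕ∞ => (x : ℝ≥0∞)) (ψ := fun x : ℕ∞ => (x : ℝ≥0∞))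
      measurable_from_top measurable_from_top
  rw [lintegral_mul_eq_lintegral_mul_lintegral_of_indepFun''
    (hZ.measurable_toENNReal_countIn hA).aemeasurable
    (hZ.measurable_toENNReal_countIn hB).aemeasurable h3,
    hZ.lintegral_toENNReal_countIn hA hμA, hZ.lintegral_toENNReal_countIn hB hμB]

/-- Splitting both sets along `A ∩ B` leaves independent counts, except for the square of the count
of `A ∩ B`. The variance of that count is the extra term. -/
lemma lintegral_countIn_mul (hZ : IsPoissonProcess P Z μ) {A B : Set E}
    (hA : MeasurableSet A) (hB : MeasurableSet B) (hμA : μ A ≠ ∞) (hμB : μ B ≠ ∞) :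
    ∫⁻ ω, (countIn Z A ω : ℝ≥0∞) * countIn Z B ω ∂P = μ A * μ B + μ (A ∩ B) := by
  have hdA : Disjoint (A \ B) (A ∩ B) := Set.disjoint_sdiff_inter
  have hdB : Disjoint (B \ A) (A ∩ B) := by rw [Set.inter_comm]; exact Set.disjoint_sdiff_inter
  have hdAB : Disjoint (A \ B) (B \ A) := disjoint_sdiff_sdiff
  have eA : A = A \ B ∪ A ∩ B := (Set.sdiff_union_inter A B).symm
  have eB : B = B \ A ∪ A ∩ B := by
    rw [Set.inter_comm]
    exact (Set.sdiff_union_inter B A).symm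
  have f1 : μ (A \ B) ≠ ∞ := measure_ne_top_of_subset Set.sdiff_subset hμA
  have f2 : μ (B \ A) ≠ ∞ := measure_ne_top_of_subset Set.sdiff_subset hμB
  have f3 : μ (A ∩ B) ≠ ∞ := measure_ne_top_of_subset Set.inter_subset_left hμA
  have mA : μ A = μ (A \ B) + μ (A ∩ B) := by
    conv_lhs => rw [eA]
    exact measure_union hdA (hA.inter hB)
  have mB : μ B = μ (B \ A) + μ (A ∩ B) := by
    conv_lhs => rw [eB]
    exact measure_union hdB (hA.inter hB)
  have cA : ∀ ω, (countIn Z A ω : ℝ≥0∞) = countIn Z (A \ B) ω + countIn Z (A ∩ B) ω := by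
    intro ω
    conv_lhs => rw [eA]
    exact toENNReal_countIn_union Z hdA ω
  have cB : ∀ ω, (countIn Z B ω : ℝ≥0∞) = countIn Z (B \ A) ω + countIn Z (A ∩ B) ω := by
    intro ω
    conv_lhs => rw [eB]
    exact toENNReal_countIn_union Z hdB ω
  have g1 := hZ.measurable_toENNReal_countIn (hA.diff hB)
  have g2 := hZ.measurable_toENNReal_countIn (hB.diff hA)
  have g3 := hZ.measurable_toENNReal_countIn (hA.inter hB)
  simp only [cA, cB, add_mul, mul_add]
  rw [lintegral_add_left (by fun_prop), lintegral_add_left (by fun_prop),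
    lintegral_add_left (by fun_prop),
    hZ.lintegral_countIn_mul_of_disjoint (hA.diff hB) (hB.diff hA) hdAB f1 f2,
    hZ.lintegral_countIn_mul_of_disjoint (hA.inter hB) (hB.diff hA) hdB.symm f3 f2,
    hZ.lintegral_countIn_mul_of_disjoint (hA.diff hB) (hA.inter hB) hdA f1 f3,
    hZ.lintegral_countIn_mul_self (hA.inter hB) f3, mA, mB]
  ring

/-- Counts are controlled only on sets of finite measure; these generate the σ-algebra and so
suffice to identify the moment measures. -/
lemma generateFrom_measurableSet_finite [SigmaFinite μ] :
    MeasurableSpace.generateFrom {s : Set E | MeasurableSet s ∧ μ s ≠ ∞} = ‹MeasurableSpace E› := by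
  refine le_antisymm (MeasurableSpace.generateFrom_le fun s hs => hs.1) fun s hs => ?_
  rw [← Set.inter_univ s, ← iUnion_spanningSets μ, Set.inter_iUnion]
  refine MeasurableSet.iUnion fun n => MeasurableSpace.measurableSet_generateFrom
    ⟨hs.inter (measurableSet_spanningSets μ n), ?_⟩
  exact measure_ne_top_of_subset Set.inter_subset_right (measure_spanningSets_lt_top μ n).ne

lemma isPiSystem_measurableSet_finite :
    IsPiSystem {s : Set E | MeasurableSet s ∧ μ s ≠ ∞} := fun _ hs _ ht _ =>
  ⟨hs.1.inter ht.1, measure_ne_top_of_subset Set.inter_subset_left hs.2⟩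

/-- The first moment measure of a Poisson process. -/
lemma sum_map [SigmaFinite μ] (hZ : IsPoissonProcess P Z μ) :
    Measure.sum (fun i => P.map (Z i)) = μ := by
  have key : ∀ s : Set E, MeasurableSet s ∧ μ s ≠ ∞ →
      Measure.sum (fun i => P.map (Z i)) s = μ s := by
    rintro s ⟨hs, hμs⟩
    rw [Measure.sum_apply _ hs, ← hZ.lintegral_toENNReal_countIn hs hμs]
    simp only [toENNReal_countIn]
    have hm : ∀ i, Measurable fun ω => s.indicator (1 : E → ℝ≥0∞) (Z i ω) := fun i =>
      (measurable_one.indicator hs).comp (hZ.measurable_point i)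
    rw [lintegral_tsum fun i => (hm i).aemeasurable]
    refine tsum_congr fun i => ?_
    rw [← lintegral_map (f := s.indicator 1) (measurable_one.indicator hs) (hZ.measurable_point i),
      lintegral_indicator_one hs]
  have h3 : μ.FiniteSpanningSetsIn {s : Set E | MeasurableSet s ∧ μ s ≠ ∞} :=
    μ.toFiniteSpanningSetsIn.mono' fun s hs => ⟨hs.1, (show μ s < ∞ from hs.2).ne⟩
  exact (h3.ext generateFrom_measurableSet_finite.symm isPiSystem_measurableSet_finite
    fun s hs => (key s hs).symm).symm

/-- The second factorial moment measure of a Poisson process. -/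
lemma sum_map_pair [SigmaFinite μ] (hZ : IsPoissonProcess P Z μ) :
    Measure.sum (fun p : {p : ℕ × ℕ // p.1 ≠ p.2} => P.map fun ω => (Z p.1.1 ω, Z p.1.2 ω)) =
      μ.prod μ := by
  have h3 : μ.FiniteSpanningSetsIn {s : Set E | MeasurableSet s ∧ μ s ≠ ∞} :=
    μ.toFiniteSpanningSetsIn.mono' fun s hs => ⟨hs.1, (show μ s < ∞ from hs.2).ne⟩
  refine (Measure.prod_eq_generateFrom generateFrom_measurableSet_finite
    generateFrom_measurableSet_finite isPiSystem_measurableSet_finite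
    isPiSystem_measurableSet_finite h3 h3 ?_).symm
  rintro A ⟨hA, hμA⟩ B ⟨hB, hμB⟩
  have hmz := hZ.measurable_point
  -- Over all pairs of indices the sum is the mixed second moment of the counts. The diagonal
  -- contributes the first moment of `A ∩ B`, which is exactly the excess over `μ A * μ B`.
  have hall : ∑' p : ℕ × ℕ, P (Z p.1 ⁻¹' A ∩ Z p.2 ⁻¹' B) = μ A * μ B + μ (A ∩ B) := by
    rw [← hZ.lintegral_countIn_mul hA hB hμA hμB]
    simp only [toENNReal_countIn, ← ENNReal.tsum_mul_right]
    simp only [← ENNReal.tsum_mul_left]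
    have hm : ∀ i j, Measurable fun ω =>
        A.indicator (1 : E → ℝ≥0∞) (Z i ω) * B.indicator (1 : E → ℝ≥0∞) (Z j ω) := fun i j =>
      ((measurable_one.indicator hA).comp (hmz i)).mul ((measurable_one.indicator hB).comp (hmz j))
    rw [lintegral_tsum fun i => (Measurable.tsum fun j => hm i j).aemeasurable,
      ENNReal.tsum_prod']
    refine tsum_congr fun i => ?_
    rw [lintegral_tsum fun j => (hm i j).aemeasurable]
    refine tsum_congr fun j => ?_
    rw [← lintegral_indicator_one ((hmz i hA).inter (hmz j hB))]
    refine lintegral_congr fun ω => ?_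
    rw [Set.inter_indicator_one]
    rfl
  have hdiag : ∑' p : {p : ℕ × ℕ // ¬ p.1 ≠ p.2}, P (Z p.1.1 ⁻¹' A ∩ Z p.1.2 ⁻¹' B) =
      μ (A ∩ B) := by
    let e : ℕ ≃ {p : ℕ × ℕ // ¬ p.1 ≠ p.2} :=
      { toFun := fun i => ⟨(i, i), by simp⟩
        invFun := fun p => p.1.1
        left_inv := fun i => rfl
        right_inv := by
          rintro ⟨⟨i, j⟩, h⟩
          simp only [ne_eq, not_not] at h
          subst h
          rfl }
    rw [← e.tsum_eq]
    conv_rhs => rw [← hZ.sum_map, Measure.sum_apply _ (hA.inter hB)]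
    refine tsum_congr fun i => ?_
    rw [Measure.map_apply (hmz i) (hA.inter hB)]
    rfl
  rw [Measure.sum_apply _ (hA.prod hB)]
  have hsplit := Summable.tsum_add_tsum_compl (s := {p : ℕ × ℕ | p.1 ≠ p.2})
    (f := fun p : ℕ × ℕ => P (Z p.1 ⁻¹' A ∩ Z p.2 ⁻¹' B)) ENNReal.summable ENNReal.summable
  rw [hall] at hsplit
  have hfin : μ (A ∩ B) ≠ ∞ := measure_ne_top_of_subset Set.inter_subset_left hμA
  rw [← ENNReal.add_left_inj hfin, ← hsplit]
  congr 1
  · refine tsum_congr fun p => ?_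
    rw [Measure.map_apply ((hmz _).prodMk (hmz _)) (hA.prod hB)]
    rfl
  · exact hdiag.symm

/-- The colouring cuts `B` into cells with independent Poisson counts. An enumeration with colours
`s` exists only if the counts equal the multiplicities `a k` of `s`, and there are then `∏ k, (a
k)!` of them. These factorials cancel those in the Poisson weights, and the exponentials multiply to
the one for `B`. -/
lemma tsum_measure_enumerations (hZ : IsPoissonProcess P Z μ) {B : Set E} (hB : MeasurableSet B)
    (hμB : μ B ≠ ∞) {K : Type*} [Fintype K] [DecidableEq K] [MeasurableSpace K]
    [DiscreteMeasurableSpace K] {c : E → K} (hc : Measurable c) {m : ℕ} (s : Fin m → K) :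
    ∑' f : Fin m ↪ ℕ, P {ω | Set.range f = {i | Z i ω ∈ B} ∧ ∀ l, c (Z (f l) ω) = s l} =
      ENNReal.ofReal (Real.exp (-(μ B).toReal)) * ∏ l, μ (B ∩ c ⁻¹' {s l}) := by
  classical
  set a : K → ℕ := fun k => Fintype.card {l // s l = k}
  set C : K → Set E := fun k => B ∩ c ⁻¹' {k}
  have hC : ∀ k, MeasurableSet (C k) := fun k => hB.inter (hc (MeasurableSet.of_discrete))
  have hfin : ∀ k, μ (C k) ≠ ∞ := fun k => measure_ne_top_of_subset Set.inter_subset_left hμB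
  have hdisj : Pairwise fun i j => Disjoint (C i) (C j) := fun i j hij =>
    Set.disjoint_left.2 fun x hi hj => hij (hi.2.symm.trans hj.2)
  have hmeas : ∀ f : Fin m ↪ ℕ,
      MeasurableSet {ω | Set.range f = {i | Z i ω ∈ B} ∧ ∀ l, c (Z (f l) ω) = s l} := by
    intro f
    refine (hZ.measurableSet_range_eq hB f).inter ?_
    have : {ω | ∀ l, c (Z (f l) ω) = s l} = ⋂ l, (c ∘ Z (f l)) ⁻¹' {s l} := by
      ext
      simp
    refine (congrArg MeasurableSet this).mpr (MeasurableSet.iInter fun l =>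
      (hc.comp (hZ.measurable_point _)) MeasurableSet.of_discrete)
  have hmeasC : MeasurableSet {ω | ∀ k, countIn Z (C k) ω = (a k : ℕ∞)} := by
    have : {ω | ∀ k, countIn Z (C k) ω = (a k : ℕ∞)} =
        ⋂ k, countIn Z (C k) ⁻¹' {(a k : ℕ∞)} := by
      ext
      simp
    exact this ▸ MeasurableSet.iInter fun k => hZ.measurable_countIn (hC k)
      (measurableSet_singleton _)
  calc _ = ∫⁻ ω, ∑' f : Fin m ↪ ℕ,
        {ω | Set.range f = {i | Z i ω ∈ B} ∧ ∀ l, c (Z (f l) ω) = s l}.indicator 1 ω ∂P := by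
        rw [lintegral_tsum fun f => (measurable_one.indicator (hmeas f)).aemeasurable]
        exact tsum_congr fun f => (lintegral_indicator_one (hmeas f)).symm
    _ = ∫⁻ ω, {ω | ∀ k, countIn Z (C k) ω = (a k : ℕ∞)}.indicator
          (fun _ => ((∏ k, (a k).factorial : ℕ) : ℝ≥0∞)) ω ∂P :=
        lintegral_congr fun ω => tsum_enumerations_eq {i | Z i ω ∈ B} (fun i => c (Z i ω)) s
    _ = ∏ k, ((a k).factorial : ℝ≥0∞) * poissonMeasure (μ (C k)).toNNReal {a k} := by
        rw [lintegral_indicator hmeasC, setLIntegral_const,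
          hZ.measure_forall_countIn_eq C hC hdisj hfin a, Nat.cast_prod, Finset.prod_mul_distrib]
    _ = ∏ k, ENNReal.ofReal (Real.exp (-(μ (C k)).toReal)) * μ (C k) ^ a k := by
        refine Finset.prod_congr rfl fun k _ => ?_
        rw [poissonMeasure_singleton, ← ENNReal.ofReal_natCast, ← ENNReal.ofReal_mul
          (by positivity)]
        conv_rhs => rw [← ENNReal.ofReal_toReal (hfin k), ← ENNReal.ofReal_pow (by positivity),
          ← ENNReal.ofReal_mul (by positivity)]
        rw [ENNReal.toReal_ofReal (by positivity)]
        congr 1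
        have : ((μ (C k)).toNNReal : ℝ) = (μ (C k)).toReal := rfl
        rw [this]
        field_simp
    _ = _ := by
        rw [Finset.prod_mul_distrib, ← ENNReal.ofReal_prod_of_nonneg fun _ _ => by positivity,
          ← Real.exp_sum, Finset.sum_neg_distrib, ← ENNReal.toReal_sum fun k _ => hfin k]
        congr 1
        · congr 4
          rw [← measure_biUnion_finset (fun i _ j _ hij => hdisj hij) fun k _ => hC k]
          congr 1
          ext x
          simp [C]
        · rw [← Finset.prod_fiberwise Finset.univ s]
          refine Finset.prod_congr rfl fun k _ => ?_
          rw [Finset.prod_congr rfl (g := fun _ => μ (C k))]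
          · rw [Finset.prod_const, ← Fintype.card_subtype]
          · intro l hl
            simp only [Finset.mem_filter, Finset.mem_univ, true_and] at hl
            rw [hl]

/-- The Janossy measures of a Poisson process: given their number, the points in a set `B` are
independent and uniformly distributed. -/
lemma sum_map_enumerations [SigmaFinite μ] (hZ : IsPoissonProcess P Z μ) {B : Set E}
    (hB : MeasurableSet B) (hμB : μ B ≠ ∞) (m : ℕ) :
    Measure.sum (fun f : Fin m ↪ ℕ => (P.restrict {ω | Set.range f = {i | Z i ω ∈ B}}).map
        fun ω l => Z (f l) ω) =
      ENNReal.ofReal (Real.exp (-(μ B).toReal)) • Measure.pi fun _ => μ.restrict B := by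
  classical
  set J := Measure.sum (fun f : Fin m ↪ ℕ =>
    (P.restrict {ω | Set.range f = {i | Z i ω ∈ B}}).map fun ω l => Z (f l) ω)
  set e := ENNReal.ofReal (Real.exp (-(μ B).toReal))
  have he0 : e ≠ 0 := by simp [e, Real.exp_pos]
  have he1 : e ≠ ∞ := ENNReal.ofReal_ne_top
  have hJ : ∀ S : Set (Fin m → E), MeasurableSet S →
      J S = ∑' f : Fin m ↪ ℕ, P {ω | Set.range f = {i | Z i ω ∈ B} ∧ (fun l => Z (f l) ω) ∈ S} := by
    intro S hS
    rw [Measure.sum_apply _ hS]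
    refine tsum_congr fun f => ?_
    have hm : Measurable fun ω l => Z (f l) ω :=
      measurable_pi_lambda _ fun l => hZ.measurable_point _
    rw [Measure.map_apply hm hS, Measure.restrict_apply (hm hS), Set.inter_comm]
    rfl
  have hpi : Measure.pi (fun _ : Fin m => μ.restrict B) = e⁻¹ • J := by
    refine Measure.pi_eq fun A hA => ?_
    -- Each point is coloured by the list of those sets `A l` that contain it. The product set is
    -- then a finite disjoint union of colour patterns, so the formula for coloured enumerations
    -- determines its mass.
    let c : E → Fin m → Bool := fun x l => decide (x ∈ A l)
    have hc : Measurable c := measurable_pi_lambda _ fun l => by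
      refine measurable_to_bool ?_
      have : (fun x => decide (x ∈ A l)) ⁻¹' {true} = A l := by
        ext
        simp
      rw [this]
      exact hA l
    let D : Fin m → Finset (Fin m → Bool) := fun l => Finset.univ.filter fun k => k l = true
    have hunion : Set.univ.pi A = ⋃ s ∈ Fintype.piFinset D, {x | ∀ l, c (x l) = s l} := by
      ext x
      simp only [Set.mem_pi, Set.mem_univ, true_imp_iff, Set.mem_iUnion, Fintype.mem_piFinset,
        Set.mem_ofPred_eq, D, Finset.mem_filter, Finset.mem_univ, true_and]
      constructor
      · exact fun h => ⟨fun l => c (x l), fun l => by simp [c, h l], fun l => rfl⟩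
      · rintro ⟨s, hs, hx⟩ l
        have := hs l
        rw [← hx l] at this
        simpa [c] using this
    have hmS : ∀ s : Fin m → Fin m → Bool, MeasurableSet {x : Fin m → E | ∀ l, c (x l) = s l} := by
      intro s
      have : {x : Fin m → E | ∀ l, c (x l) = s l} = ⋂ l, (fun x => c (x l)) ⁻¹' {s l} := by
        ext
        simp
      exact this ▸ MeasurableSet.iInter fun l =>
        (hc.comp (measurable_pi_apply l)) MeasurableSet.of_discrete
    have hJA : J (Set.univ.pi A) = e * ∏ l, μ.restrict B (A l) := by
      rw [hunion, measure_biUnion_finset _ fun s _ => hmS s]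
      · have : ∀ s : Fin m → Fin m → Bool, J {x | ∀ l, c (x l) = s l} =
            e * ∏ l, μ (B ∩ c ⁻¹' {s l}) := fun s => by
          rw [hJ _ (hmS s), ← hZ.tsum_measure_enumerations hB hμB hc s]
          rfl
        simp only [this]
        rw [← Finset.mul_sum, ← Finset.prod_univ_sum D fun l k => μ (B ∩ c ⁻¹' {k})]
        congr 1
        refine Finset.prod_congr rfl fun l _ => ?_
        rw [← measure_biUnion_finset, Measure.restrict_apply (hA l)]
        · congr 1
          ext x
          simp only [D, Set.mem_iUnion, Finset.mem_filter, Finset.mem_univ, true_and,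
            Set.mem_inter_iff, Set.mem_preimage, Set.mem_singleton_iff, c]
          constructor
          · rintro ⟨k, hk, hx, rfl⟩
            exact ⟨by simpa using hk, hx⟩
          · rintro ⟨h1, h2⟩
            exact ⟨_, by simpa using h1, h2, rfl⟩
        · exact fun i _ j _ hij => Set.disjoint_left.2 fun x hi hj => hij (hi.2.symm.trans hj.2)
        · exact fun k _ => hB.inter (hc MeasurableSet.of_discrete)
      · intro i _ j _ hij
        refine Set.disjoint_left.2 fun x hi hj => hij (funext fun l => ?_)
        exact ((show ∀ l, c (x l) = i l from hi) l).symm.trans ((show ∀ l, c (x l) = j l from hj) l)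
    rw [Measure.smul_apply, hJA, smul_eq_mul, ← mul_assoc, ENNReal.inv_mul_cancel he0 he1, one_mul]
  rw [hpi, smul_smul, ENNReal.mul_inv_cancel he0 he1, one_smul]

end IsPoissonProcess

end Poisson

/-! ### Events that depend on the vertices near a root. -/

section LocalEvents

variable {Ω V E : Type*}

lemma tsum_indicator_range_eq {m : ℕ} (S : Set V) (hS : S.encard = m) :
    ∑' f : Fin m ↪ V, {f : Fin m ↪ V | Set.range f = S}.indicator (1 : (Fin m ↪ V) → ℝ≥0∞) f =
      (m.factorial : ℝ≥0∞) := by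
  have h := tsum_enumerations_eq S (fun _ => ()) (fun _ : Fin m => ())
  simp only [implies_true, and_true, Finset.univ_unique, Finset.prod_singleton] at h
  rw [h, Set.indicator_of_mem]
  · simp
  · intro k
    simpa using hS

lemma indicator_one_le_indicator_one {α β : Type*} {s : Set α} {t : Set β} {x : α} {y : β}
    (h : x ∈ s → y ∈ t) : s.indicator (1 : α → ℝ≥0∞) x ≤ t.indicator (1 : β → ℝ≥0∞) y := by
  by_cases hx : x ∈ s
  · rw [Set.indicator_of_mem hx, Set.indicator_of_mem (h hx)]
    rfl
  · rw [Set.indicator_of_notMem hx]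
    exact zero_le

lemma encard_range_embedding {m : ℕ} (f : Fin m ↪ V) : (Set.range f).encard = m := by
  rw [← Set.image_univ, f.injective.encard_image]
  simp

variable [NormedAddCommGroup E]

/-- The vertices other than `i` whose location is at distance at most `R` from that of `i`. -/
def nearSet (Y : V → Ω → E) (R : ℝ) (i : V) (ω : Ω) : Set V :=
  {v | v ≠ i ∧ Y v ω ∈ Metric.closedBall (Y i ω) R}

/-- There are exactly `m` vertices near `i`, and the graph that they span together with `i`
belongs to `D`, whatever the enumeration. -/
def localEvent (Y : V → Ω → E) (G : Ω → SimpleGraph V) (R : ℝ) (i : V) {m : ℕ}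
    (D : Set (SimpleGraph (Fin (m + 1)))) : Set Ω :=
  {ω | ∃ f : Fin m ↪ V, Set.range f = nearSet Y R i ω ∧
    (G ω).comap (Fin.cons i f : Fin (m + 1) → V) ∈ D}

lemma encard_nearSet_of_mem_localEvent {Y : V → Ω → E} {G : Ω → SimpleGraph V} {R : ℝ} {i : V}
    {m : ℕ} {D : Set (SimpleGraph (Fin (m + 1)))} {ω : Ω} (h : ω ∈ localEvent Y G R i D) :
    (nearSet Y R i ω).encard = m := by
  obtain ⟨f, hf, -⟩ := h
  rw [← hf, encard_range_embedding]

/-- Invariance under relabelling of the non-root vertices. -/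
def RelabelInvariant {m : ℕ} (D : Set (SimpleGraph (Fin (m + 1)))) : Prop :=
  ∀ Γ ∈ D, ∀ τ : Equiv.Perm (Fin m), Γ.comap (Fin.cons 0 fun l => (τ l).succ :
    Fin (m + 1) → Fin (m + 1)) ∈ D

lemma comap_cons_mem_of_range_eq {G : SimpleGraph V} {m : ℕ}
    {D : Set (SimpleGraph (Fin (m + 1)))} (hD : RelabelInvariant D) {i : V} {f g : Fin m ↪ V}
    (hfg : Set.range f = Set.range g) (hf : G.comap (Fin.cons i f : Fin (m + 1) → V) ∈ D) :
    G.comap (Fin.cons i g : Fin (m + 1) → V) ∈ D := by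
  let τ : Equiv.Perm (Fin m) := (Equiv.ofInjective g g.injective).trans
    ((Equiv.setCongr hfg.symm).trans (Equiv.ofInjective f f.injective).symm)
  have hτ : ∀ l, f (τ l) = g l := by
    intro l
    have := Equiv.apply_ofInjective_symm f.injective
      ((Equiv.setCongr hfg.symm) (Equiv.ofInjective g g.injective l))
    simpa [τ] using this
  have h := hD _ hf τ
  rw [SimpleGraph.comap_comap] at h
  convert h using 2
  funext l
  refine Fin.cases ?_ (fun l => ?_) l
  · simp
  · simp [hτ]

/-- The `m` vertices near `i` have `m!` enumerations. Without invariance of `D` only some of them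
need qualify, so this is an inequality. -/
lemma tsum_indicator_localEvent_le (Y : V → Ω → E) (G : Ω → SimpleGraph V) (R : ℝ) (i : V) {m : ℕ}
    (D : Set (SimpleGraph (Fin (m + 1)))) (ω : Ω) :
    ∑' f : Fin m ↪ V, {ω | Set.range f = nearSet Y R i ω ∧
      (G ω).comap (Fin.cons i f : Fin (m + 1) → V) ∈ D}.indicator (1 : Ω → ℝ≥0∞) ω ≤
    (localEvent Y G R i D).indicator (fun _ => (m.factorial : ℝ≥0∞)) ω := by
  by_cases h : ω ∈ localEvent Y G R i D
  · rw [Set.indicator_of_mem h,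
      ← tsum_indicator_range_eq _ (encard_nearSet_of_mem_localEvent h)]
    exact ENNReal.tsum_le_tsum fun f => indicator_one_le_indicator_one fun hf => hf.1
  · rw [Set.indicator_of_notMem h, nonpos_iff_eq_zero, ENNReal.tsum_eq_zero]
    intro f
    exact Set.indicator_of_notMem (s := {ω | Set.range f = nearSet Y R i ω ∧
      (G ω).comap (Fin.cons i f : Fin (m + 1) → V) ∈ D}) (fun hf => h ⟨f, hf⟩) _

lemma nearSet_zero_eq_image_succ {Y : ℕ → Ω → E} (hY₀ : ∀ ω, Y 0 ω = 0) (R : ℝ) (ω : Ω) :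
    nearSet Y R 0 ω = Nat.succ '' {k | Y (k + 1) ω ∈ Metric.closedBall (0 : E) R} := by
  ext v
  cases v with
  | zero => simp [nearSet]
  | succ k => simp [nearSet, hY₀]

variable [MeasurableSpace Ω] {P : Measure Ω} [MeasurableSpace E] [BorelSpace E]
  [SecondCountableTopology E]

lemma measurableSet_range_eq_nearSet [Countable V] {Y : V → Ω → E} (hY : ∀ i, Measurable (Y i))
    (R : ℝ) (i : V) {m : ℕ} (f : Fin m ↪ V) :
    MeasurableSet {ω | Set.range f = nearSet Y R i ω} := by
  classical
  have hmem : ∀ v, MeasurableSet {ω | v ∈ nearSet Y R i ω} := by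
    intro v
    by_cases hv : v = i
    · simp [nearSet, hv]
    · simp only [nearSet, Set.mem_ofPred_eq, ne_eq, hv, not_false_eq_true, true_and,
        Metric.mem_closedBall, dist_eq_norm]
      have := hY v
      have := hY i
      exact measurableSet_le (by fun_prop) measurable_const
  have : {ω | Set.range f = nearSet Y R i ω} =
      ⋂ v, if v ∈ Set.range f then {ω | v ∈ nearSet Y R i ω} else {ω | v ∈ nearSet Y R i ω}ᶜ := by
    ext ω
    simp only [Set.mem_ofPred_eq, Set.ext_iff, Set.mem_iInter]
    refine forall_congr' fun v => ?_
    split_ifs with h <;> simp [h]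
  rw [this]
  refine MeasurableSet.iInter fun v => ?_
  split_ifs
  · exact hmem v
  · exact (hmem v).compl

lemma measurableSet_comap_eq {G : Ω → SimpleGraph V}
    (hadj : ∀ u v, MeasurableSet {ω | (G ω).Adj u v}) {ι : Type*}
    [Countable ι] (f : ι → V) (Γ : SimpleGraph ι) : MeasurableSet {ω | (G ω).comap f = Γ} := by
  classical
  have : {ω | (G ω).comap f = Γ} = ⋂ a, ⋂ b,
      if Γ.Adj a b then {ω | (G ω).Adj (f a) (f b)} else {ω | (G ω).Adj (f a) (f b)}ᶜ := by
    ext ω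
    simp only [Set.mem_ofPred_eq, SimpleGraph.ext_iff, funext_iff, Set.mem_iInter,
      SimpleGraph.comap_adj, eq_iff_iff]
    refine forall_congr' fun a => forall_congr' fun b => ?_
    split_ifs with h <;> simp [h]
  rw [this]
  refine MeasurableSet.iInter fun a => MeasurableSet.iInter fun b => ?_
  split_ifs
  · exact hadj _ _
  · exact (hadj _ _).compl

lemma measurableSet_comap_mem {G : Ω → SimpleGraph V}
    (hadj : ∀ u v, MeasurableSet {ω | (G ω).Adj u v}) {ι : Type*}
    [Finite ι] (f : ι → V) (D : Set (SimpleGraph ι)) : MeasurableSet {ω | (G ω).comap f ∈ D} := by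
  have : {ω | (G ω).comap f ∈ D} = ⋃ Γ ∈ D, {ω | (G ω).comap f = Γ} := by
    ext
    simp
  rw [this]
  exact MeasurableSet.biUnion D.toFinite.countable fun Γ _ => measurableSet_comap_eq hadj f Γ

section SIRG

variable [LinearOrder V] {Y : V → Ω → E} {W : V → Ω → I} {κ : ℝ≥0 → I → I → I}
  {G : Ω → SimpleGraph V}

lemma IsSIRG.measurableSet_localEvent [Countable V] (hG : IsSIRG P Y W κ G) (R : ℝ) (i : V) {m : ℕ}
    (D : Set (SimpleGraph (Fin (m + 1)))) : MeasurableSet (localEvent Y G R i D) := by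
  have : localEvent Y G R i D = ⋃ f : Fin m ↪ V, {ω | Set.range f = nearSet Y R i ω} ∩
      {ω | (G ω).comap (Fin.cons i f : Fin (m + 1) → V) ∈ D} := by
    ext
    simp [localEvent]
  rw [this]
  exact MeasurableSet.iUnion fun f =>
    (measurableSet_range_eq_nearSet hG.measurable_location R i f).inter
      (measurableSet_comap_mem hG.measurable_adj _ D)

/-- The two-block formula with an empty second block. -/
lemma IsSIRG.measure_comap_eq [IsProbabilityMeasure P]
    (hG : IsSIRG P Y W κ G) (hκ : Measurable fun q : ℝ≥0 × I × I => κ q.1 q.2.1 q.2.2)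
    (hsymm : ∀ t x y, κ t x y = κ t y x) (hW : IsUniformWeights P W Y) {A : Set (V → E)}
    (hA : MeasurableSet A) {ι : Type*} [Fintype ι] [LinearOrder ι] (f : ι → V)
    (hf : Function.Injective f) (Γ : SimpleGraph ι) :
    P ((fun ω i => Y i ω) ⁻¹' A ∩ {ω | (G ω).comap f = Γ}) =
      ∫⁻ ω in (fun ω i => Y i ω) ⁻¹' A, meanGraphProb κ Γ (fun a => Y (f a) ω) ∂P := by
  have h := hG.measure_comap_eq_and_comap_eq_of_uniformWeights hκ hsymm hW hA f
    (Fin.elim0 : Fin 0 → V) (by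
      rintro (a | a) (b | b) hab
      · exact congrArg _ (hf hab)
      · exact b.elim0
      · exact a.elim0
      · exact a.elim0) Γ ⊥
  have h1 : ∀ Γ' : SimpleGraph (Fin 0), Γ' = ⊥ := fun Γ' => by
    ext a
    exact a.elim0
  have h2 : ∀ y : Fin 0 → E, meanGraphProb κ ⊥ y = 1 := by
    intro y
    simp [meanGraphProb, graphProb, ltPairs]
  simpa only [h1, and_true, h2, mul_one] using h

end SIRG

end LocalEvents

/-! ### Neighbourhood of the origin in the Poisson model. -/

section PoissonLocal

/-- The integral of the probability that the root at the origin and `m` points of the ball of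
radius `R` span the graph `Γ`. -/
noncomputable def ballGraphIntegral {E : Type*} [NormedAddCommGroup E] [MeasureSpace E]
    (κ : ℝ≥0 → I → I → I) (R : ℝ) {m : ℕ} (Γ : SimpleGraph (Fin (m + 1))) : ℝ≥0∞ :=
  ∫⁻ y : Fin m → E, meanGraphProb κ Γ (Fin.cons 0 y : Fin (m + 1) → E)
    ∂Measure.pi fun _ => (volume : Measure E).restrict (Metric.closedBall 0 R)

/-- The integral of the probability that the root at the origin and `m` points of the ball of
radius `R` span a graph in `D`. -/
noncomputable def ballIntegral {E : Type*} [NormedAddCommGroup E] [MeasureSpace E]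
    (κ : ℝ≥0 → I → I → I) (R : ℝ) {m : ℕ} (D : Set (SimpleGraph (Fin (m + 1)))) : ℝ≥0∞ :=
  ∑' Γ : D, ballGraphIntegral (E := E) κ R (Γ : SimpleGraph (Fin (m + 1)))

variable {Ω E : Type*} [MeasurableSpace Ω] {Q : Measure Ω} [NormedAddCommGroup E]
  [MeasureSpace E] [BorelSpace E] [SecondCountableTopology E] [SigmaFinite (volume : Measure E)]
  {Y : ℕ → Ω → E} {W : ℕ → Ω → I} {κ : ℝ≥0 → I → I → I} {G : Ω → SimpleGraph ℕ}

/-- The law of the neighbourhood of the origin in the random graph over a Poisson process. -/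
lemma IsSIRG.factorial_mul_measure_localEvent_le [IsProbabilityMeasure Q] (hG : IsSIRG Q Y W κ G)
    (hκ : Measurable fun q : ℝ≥0 × I × I => κ q.1 q.2.1 q.2.2)
    (hsymm : ∀ t x y, κ t x y = κ t y x) (hW : IsUniformWeights Q W Y) (hY₀ : ∀ ω, Y 0 ω = 0)
    (hY : IsPoissonProcess Q (fun i => Y (i + 1)) volume) (R : ℝ)
    (hR : volume (Metric.closedBall (0 : E) R) ≠ ∞) {m : ℕ}
    {D : Set (SimpleGraph (Fin (m + 1)))} (hD : RelabelInvariant D) :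
    (m.factorial : ℝ≥0∞) * Q (localEvent Y G R 0 D) ≤
      ENNReal.ofReal (Real.exp (-(volume (Metric.closedBall (0 : E) R)).toReal)) *
        ballIntegral (E := E) κ R D := by
  set B := Metric.closedBall (0 : E) R
  have hB : MeasurableSet B := Metric.isClosed_closedBall.measurableSet
  let s : (Fin m ↪ ℕ) → Fin (m + 1) → ℕ := fun h => Fin.cons 0 fun l => h l + 1
  have hs : ∀ h, Function.Injective (s h) := by
    intro h
    refine Fin.cons_injective_iff.2 ⟨?_, fun a b hab => ?_⟩
    · rintro ⟨l, hl⟩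
      exact absurd hl (Nat.succ_ne_zero _)
    · exact h.injective (Nat.succ_injective hab)
  let A : (Fin m ↪ ℕ) → Set (ℕ → E) := fun h => {y | Set.range h = {k | y (k + 1) ∈ B}}
  have hA : ∀ h, MeasurableSet (A h) := by
    intro h
    have : A h = ⋂ k, if k ∈ Set.range h then {y | y (k + 1) ∈ B} else {y | y (k + 1) ∈ B}ᶜ := by
      ext ω
      simp only [A, Set.mem_ofPred_eq, Set.ext_iff, Set.mem_iInter]
      refine forall_congr' fun k => ?_
      split_ifs with h <;> simp [h]
    rw [this]
    refine MeasurableSet.iInter fun k => ?_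
    have hk : MeasurableSet {y : ℕ → E | y (k + 1) ∈ B} := measurable_pi_apply (k + 1) hB
    split_ifs
    · exact hk
    · exact hk.compl
  have hYm : Measurable fun ω i => Y i ω := measurable_pi_lambda _ hG.measurable_location
  let T : (Fin m ↪ ℕ) → Set Ω := fun h =>
    (fun ω i => Y i ω) ⁻¹' A h ∩ {ω | (G ω).comap (s h) ∈ D}
  have hT : ∀ h, MeasurableSet (T h) := fun h =>
    (hYm (hA h)).inter (measurableSet_comap_mem hG.measurable_adj _ _)
  have hF : Measurable fun ω => ∑' h, (T h).indicator (1 : Ω → ℝ≥0∞) ω :=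
    Measurable.tsum fun h => measurable_one.indicator (hT h)
  -- By invariance of `D` under relabelling, on the local event all `m!` enumerations of the Poisson
  -- points in the ball qualify.
  have hsub : localEvent Y G R 0 D ⊆
      {ω | (m.factorial : ℝ≥0∞) ≤ ∑' h, (T h).indicator (1 : Ω → ℝ≥0∞) ω} := by
    intro ω hω
    have hcard := encard_nearSet_of_mem_localEvent hω
    rw [nearSet_zero_eq_image_succ hY₀, Nat.succ_injective.encard_image] at hcard
    obtain ⟨f, hf, hfD⟩ := hω
    rw [Set.mem_ofPred_eq, ← tsum_indicator_range_eq _ hcard]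
    refine ENNReal.tsum_le_tsum fun h => indicator_one_le_indicator_one fun hh => ⟨hh, ?_⟩
    · refine comap_cons_mem_of_range_eq (g := h.trans ⟨Nat.succ, Nat.succ_injective⟩) hD ?_ hfD
      rw [hf, nearSet_zero_eq_image_succ hY₀,
        ← (show Set.range h = {k | Y (k + 1) ω ∈ B} from hh), ← Set.range_comp]
      rfl
  have hterm : ∀ h, Q (T h) = ∑' Γ : D, ∫⁻ ω in (fun ω i => Y i ω) ⁻¹' A h,
      meanGraphProb κ (Γ : SimpleGraph (Fin (m + 1)))
        (Fin.cons 0 fun l => Y (h l + 1) ω : Fin (m + 1) → E) ∂Q := by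
    intro h
    have : T h = ⋃ Γ : D, (fun ω i => Y i ω) ⁻¹' A h ∩
        {ω | (G ω).comap (s h) = (Γ : SimpleGraph (Fin (m + 1)))} := by
      ext ω
      simp [T]
    rw [this, measure_iUnion]
    · refine tsum_congr fun Γ => ?_
      rw [hG.measure_comap_eq hκ hsymm hW (hA h) (s h) (hs h)]
      refine lintegral_congr fun ω => ?_
      congr 1
      funext a
      refine Fin.cases ?_ (fun l => ?_) a
      · simp [s, hY₀]
      · simp [s]
    · intro Γ Γ' hne
      exact Set.disjoint_left.2 fun ω h1 h2 => hne (Subtype.ext (h1.2.symm.trans h2.2))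
    · exact fun Γ => (hYm (hA h)).inter (measurableSet_comap_eq hG.measurable_adj _ _)
  calc _ ≤ (m.factorial : ℝ≥0∞) *
        Q {ω | (m.factorial : ℝ≥0∞) ≤ ∑' h, (T h).indicator (1 : Ω → ℝ≥0∞) ω} := by
        gcongr
    -- Markov's inequality loses nothing that matters: the probability in the infinite model is only
    -- needed from above.
    _ ≤ ∫⁻ ω, ∑' h, (T h).indicator (1 : Ω → ℝ≥0∞) ω ∂Q := mul_meas_ge_le_lintegral hF _
    _ = ∑' h, Q (T h) := by
        rw [lintegral_tsum fun h => (measurable_one.indicator (hT h)).aemeasurable]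
        exact tsum_congr fun h => lintegral_indicator_one (hT h)
    _ = ∑' Γ : D, ∫⁻ y : Fin m → E, meanGraphProb κ (Γ : SimpleGraph (Fin (m + 1)))
          (Fin.cons 0 y : Fin (m + 1) → E) ∂(Measure.sum fun h : Fin m ↪ ℕ =>
            (Q.restrict {ω | Set.range h = {i | Y (i + 1) ω ∈ B}}).map
              fun ω l => Y (h l + 1) ω) := by
        simp only [hterm]
        rw [ENNReal.tsum_comm]
        refine tsum_congr fun Γ => ?_
        rw [lintegral_sum_measure]
        refine tsum_congr fun h => ?_
        have hcons : Measurable fun y : Fin m → E => (Fin.cons 0 y : Fin (m + 1) → E) := by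
          refine measurable_pi_lambda _ fun a => Fin.cases ?_ (fun l => ?_) a
          · simp
          · simpa using measurable_pi_apply l
        exact (lintegral_map ((measurable_meanGraphProb hκ _).comp hcons)
          (measurable_pi_lambda _ fun l => hG.measurable_location _)).symm
    _ = _ := by
        rw [hY.sum_map_enumerations hB hR m]
        simp only [lintegral_smul_measure, smul_eq_mul, ballIntegral, ballGraphIntegral,
          ENNReal.tsum_mul_left]
        rfl

end PoissonLocal

/-! ### Finite powers of a measure. -/

section ProductMeasures

variable {E : Type*} [MeasurableSpace E]

lemma Measure.pi_const_smul {ι : Type*} [Fintype ι] (μ : Measure E) [SigmaFinite μ] (c : ℝ≥0∞)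
    [SigmaFinite (c • μ)] :
    Measure.pi (fun _ : ι => c • μ) = c ^ Fintype.card ι • Measure.pi fun _ => μ := by
  refine Measure.pi_eq fun s hs => ?_
  simp [Measure.pi_pi, Finset.prod_mul_distrib]

lemma lintegral_pi_fin_succ (ν : Measure E) [SigmaFinite ν] {m : ℕ} {F : (Fin (m + 1) → E) → ℝ≥0∞}
    (hF : Measurable F) :
    ∫⁻ y, F y ∂Measure.pi (fun _ => ν) =
      ∫⁻ x, ∫⁻ y, F (Fin.cons x y) ∂Measure.pi (fun _ : Fin m => ν) ∂ν := by
  have h := (measurePreserving_piFinSuccAbove (fun _ : Fin (m + 1) => ν) 0).symm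
  rw [← h.lintegral_comp_emb (MeasurableEquiv.measurableEmbedding _), lintegral_prod]
  · refine lintegral_congr fun x => lintegral_congr fun y => ?_
    simp [MeasurableEquiv.piFinSuccAbove]
    rfl
  · exact (hF.comp (MeasurableEquiv.measurable _)).aemeasurable

lemma measurable_fin_cons {m : ℕ} :
    Measurable fun q : E × (Fin m → E) => (Fin.cons q.1 q.2 : Fin (m + 1) → E) := by
  refine measurable_pi_lambda _ fun a => Fin.cases ?_ (fun l => ?_) a
  · simpa only [Fin.cons_zero] using measurable_fst
  · simp only [Fin.cons_succ]
    fun_prop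

end ProductMeasures

/-! ### Integrals over the points near one or two roots in a domain. -/

section FiniteModel

variable {E : Type*} [NormedAddCommGroup E] [MeasureSpace E] [BorelSpace E]
  [SecondCountableTopology E] [SigmaFinite (volume : Measure E)]
  [(volume : Measure E).IsAddRightInvariant] {κ : ℝ≥0 → I → I → I}

/-- The density of configurations whose points are all near the root. -/
noncomputable def nearGraphProb {E : Type*} [NormedAddCommGroup E] (κ : ℝ≥0 → I → I → I) (R : ℝ)
    {m : ℕ} (Γ : SimpleGraph (Fin (m + 1))) : (Fin (m + 1) → E) → ℝ≥0∞ :=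
  {y | ∀ l : Fin m, y l.succ ∈ Metric.closedBall (y 0) R}.indicator (meanGraphProb κ Γ)

lemma measurable_nearGraphProb {E : Type*} [NormedAddCommGroup E] [MeasurableSpace E] [BorelSpace E]
    [SecondCountableTopology E] {κ : ℝ≥0 → I → I → I}
    (hκ : Measurable fun q : ℝ≥0 × I × I => κ q.1 q.2.1 q.2.2) (R : ℝ)
    {m : ℕ} (Γ : SimpleGraph (Fin (m + 1))) : Measurable (nearGraphProb (E := E) κ R Γ) := by
  refine (measurable_meanGraphProb hκ Γ).indicator ?_
  rw [Set.ofPred_forall]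
  refine MeasurableSet.iInter fun l => ?_
  simp only [Metric.mem_closedBall, dist_eq_norm]
  exact measurableSet_le (by fun_prop) measurable_const

/-- Only points of the ball around `x` contribute, and there the density is the constant `c`.
Translating `x` to the origin shows that the value does not depend on the root, provided that its
ball stays inside the domain. -/
lemma lintegral_nearGraphProb_cons (hκ : Measurable fun q : ℝ≥0 × I × I => κ q.1 q.2.1 q.2.2)
    {R : ℝ} {c : ℝ≥0∞} {S : Set E} [SigmaFinite (c • (volume : Measure E).restrict S)] {x : E}
    (hx : Metric.closedBall x R ⊆ S) {m : ℕ} (Γ : SimpleGraph (Fin (m + 1))) :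
    ∫⁻ y : Fin m → E, nearGraphProb κ R Γ (Fin.cons x y : Fin (m + 1) → E)
      ∂Measure.pi (fun _ => c • (volume : Measure E).restrict S) =
    c ^ m * ballGraphIntegral (E := E) κ R Γ := by
  have hB : ∀ x : E, MeasurableSet (Metric.closedBall x R) := fun x =>
    Metric.isClosed_closedBall.measurableSet
  have h1 : ∀ y : Fin m → E, nearGraphProb κ R Γ (Fin.cons x y : Fin (m + 1) → E) =
      (Set.univ.pi fun _ : Fin m => Metric.closedBall x R).indicator
        (fun y => meanGraphProb κ Γ (Fin.cons x y : Fin (m + 1) → E)) y := by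
    intro y
    have hiff : (Fin.cons x y : Fin (m + 1) → E) ∈
        {y : Fin (m + 1) → E | ∀ l : Fin m, y l.succ ∈ Metric.closedBall (y 0) R} ↔
        y ∈ Set.univ.pi fun _ : Fin m => Metric.closedBall x R := by
      simp
    by_cases h : y ∈ Set.univ.pi fun _ : Fin m => Metric.closedBall x R
    · rw [Set.indicator_of_mem h, nearGraphProb, Set.indicator_of_mem (hiff.2 h)]
    · rw [Set.indicator_of_notMem h, nearGraphProb, Set.indicator_of_notMem (mt hiff.1 h)]
  simp only [h1]
  rw [lintegral_indicator (MeasurableSet.univ_pi fun _ => hB x), Measure.restrict_pi_pi]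
  have h2 : (c • (volume : Measure E).restrict S).restrict (Metric.closedBall x R) =
      c • (volume : Measure E).restrict (Metric.closedBall x R) := by
    rw [Measure.restrict_smul, Measure.restrict_restrict (hB x), Set.inter_eq_left.2 hx]
  have : SigmaFinite (c • (volume : Measure E).restrict (Metric.closedBall x R)) :=
    h2 ▸ inferInstance
  simp only [h2]
  rw [Measure.pi_const_smul, lintegral_smul_measure, Fintype.card_fin, smul_eq_mul]
  congr 1
  have hshift : MeasurePreserving (fun z : E => z + x)
      ((volume : Measure E).restrict (Metric.closedBall 0 R))
      ((volume : Measure E).restrict (Metric.closedBall x R)) := by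
    have h := (measurePreserving_add_right (volume : Measure E) x).restrict_preimage (hB x)
    have hpre : (fun z : E => z + x) ⁻¹' Metric.closedBall x R = Metric.closedBall 0 R := by
      ext z
      simp [dist_eq_norm]
    rwa [hpre] at h
  have hpi := measurePreserving_pi (fun _ : Fin m =>
    (volume : Measure E).restrict (Metric.closedBall 0 R)) (fun _ : Fin m =>
    (volume : Measure E).restrict (Metric.closedBall x R)) fun _ => hshift
  have hm : Measurable fun y : Fin m → E => meanGraphProb κ Γ (Fin.cons x y : Fin (m + 1) → E) :=
    (measurable_meanGraphProb hκ Γ).comp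
      (measurable_fin_cons.comp (measurable_const.prodMk measurable_id))
  rw [← hpi.lintegral_comp hm]
  refine lintegral_congr fun y => ?_
  rw [← meanGraphProb_sub_const κ Γ _ x]
  congr 1
  funext a
  refine Fin.cases ?_ (fun l => ?_) a <;> simp

/-- The root positions for which the two balls of radius `R` do not meet and do not leave the
domain `S`, of which `S'` is an inner part. -/
def goodPairs {E : Type*} [NormedAddCommGroup E] (R : ℝ) (S' : Set E) : Set (E × E) :=
  {p | p.1 ∈ S' ∧ p.2 ∈ S' ∧ 2 * R < dist p.1 p.2}

lemma measurableSet_goodPairs {E : Type*} [NormedAddCommGroup E] [MeasurableSpace E] [BorelSpace E]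
    [SecondCountableTopology E] (R : ℝ) {S' : Set E} (hS' : MeasurableSet S') :
    MeasurableSet (goodPairs R S') :=
  (measurable_fst hS').inter ((measurable_snd hS').inter
    (measurableSet_lt measurable_const (measurable_fst.dist measurable_snd)))

/-- Once the roots are fixed, the two clusters are integrated separately, and for roots in `S'` each
gives a constant. What remains of the root positions is the mass of the good pairs. -/
lemma lintegral_lintegral_nearGraphProb
    (hκ : Measurable fun q : ℝ≥0 × I × I => κ q.1 q.2.1 q.2.2)
    {R : ℝ} {c : ℝ≥0∞} {S S' : Set E} [SigmaFinite (c • (volume : Measure E).restrict S)]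
    (hS' : MeasurableSet S') (hS : ∀ x ∈ S', Metric.closedBall x R ⊆ S)
    {m₁ m₂ : ℕ} (Γ₁ : SimpleGraph (Fin (m₁ + 1))) (Γ₂ : SimpleGraph (Fin (m₂ + 1))) :
    ∫⁻ y : (Fin (m₁ + 1) → E) × (Fin (m₂ + 1) → E),
      (goodPairs R S').indicator 1 (y.1 0, y.2 0) *
        (nearGraphProb κ R Γ₁ y.1 * nearGraphProb κ R Γ₂ y.2)
      ∂(Measure.pi fun _ => c • (volume : Measure E).restrict S).prod
        (Measure.pi fun _ => c • (volume : Measure E).restrict S) =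
    ((c • (volume : Measure E).restrict S).prod (c • (volume : Measure E).restrict S))
      (goodPairs R S') * ((c ^ m₁ * ballGraphIntegral (E := E) κ R Γ₁) *
        (c ^ m₂ * ballGraphIntegral (E := E) κ R Γ₂)) := by
  set ν := c • (volume : Measure E).restrict S
  have hg := measurableSet_goodPairs R hS'
  have hgi : Measurable ((goodPairs R S').indicator (1 : E × E → ℝ≥0∞)) :=
    measurable_one.indicator hg
  have hn₁ := measurable_nearGraphProb (E := E) hκ R Γ₁
  have hn₂ := measurable_nearGraphProb (E := E) hκ R Γ₂
  have hm : Measurable fun y : (Fin (m₁ + 1) → E) × (Fin (m₂ + 1) → E) =>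
      (goodPairs R S').indicator (1 : E × E → ℝ≥0∞) (y.1 0, y.2 0) *
        (nearGraphProb κ R Γ₁ y.1 * nearGraphProb κ R Γ₂ y.2) :=
    (hgi.comp (by fun_prop)).mul ((hn₁.comp measurable_fst).mul (hn₂.comp measurable_snd))
  rw [lintegral_prod _ hm.aemeasurable, lintegral_pi_fin_succ ν hm.lintegral_prod_right']
  have h1 : ∀ x₁ : E, ∀ y₁ : Fin m₁ → E,
      ∫⁻ y₂, (goodPairs R S').indicator (1 : E × E → ℝ≥0∞)
          ((Fin.cons x₁ y₁ : Fin (m₁ + 1) → E) 0, y₂ 0) *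
        (nearGraphProb κ R Γ₁ (Fin.cons x₁ y₁ : Fin (m₁ + 1) → E) * nearGraphProb κ R Γ₂ y₂)
          ∂(Measure.pi fun _ : Fin (m₂ + 1) => ν) =
      nearGraphProb κ R Γ₁ (Fin.cons x₁ y₁ : Fin (m₁ + 1) → E) *
        ∫⁻ x₂, (goodPairs R S').indicator 1 (x₁, x₂) *
          (c ^ m₂ * ballGraphIntegral (E := E) κ R Γ₂) ∂ν := by
    intro x₁ y₁
    have hm2 : Measurable fun y₂ : Fin (m₂ + 1) → E =>
        (goodPairs R S').indicator (1 : E × E → ℝ≥0∞)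
          ((Fin.cons x₁ y₁ : Fin (m₁ + 1) → E) 0, y₂ 0) *
        (nearGraphProb κ R Γ₁ (Fin.cons x₁ y₁ : Fin (m₁ + 1) → E) * nearGraphProb κ R Γ₂ y₂) :=
      hm.comp (by fun_prop : Measurable fun y₂ : Fin (m₂ + 1) → E =>
        ((Fin.cons x₁ y₁ : Fin (m₁ + 1) → E), y₂))
    rw [lintegral_pi_fin_succ ν hm2, ← lintegral_const_mul]
    · refine lintegral_congr fun x₂ => ?_
      simp only [Fin.cons_zero]
      by_cases hx : (x₁, x₂) ∈ goodPairs R S'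
      · simp only [Set.indicator_of_mem hx, Pi.one_apply, one_mul]
        rw [lintegral_const_mul, lintegral_nearGraphProb_cons hκ (hS _ hx.2.1)]
        exact hn₂.comp (measurable_fin_cons.comp (measurable_const.prodMk measurable_id))
      · simp [Set.indicator_of_notMem hx]
    · exact (hgi.comp (by fun_prop)).mul_const _
  simp only [h1]
  have h2 : ∀ x₁ : E, ∫⁻ y₁ : Fin m₁ → E,
      nearGraphProb κ R Γ₁ (Fin.cons x₁ y₁ : Fin (m₁ + 1) → E) *
        ∫⁻ x₂, (goodPairs R S').indicator 1 (x₁, x₂) *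
          (c ^ m₂ * ballGraphIntegral (E := E) κ R Γ₂) ∂ν ∂(Measure.pi fun _ => ν) =
      (∫⁻ x₂, (goodPairs R S').indicator 1 (x₁, x₂) ∂ν) *
        ((c ^ m₁ * ballGraphIntegral (E := E) κ R Γ₁) *
          (c ^ m₂ * ballGraphIntegral (E := E) κ R Γ₂)) := by
    intro x₁
    have hm1 : Measurable fun y₁ : Fin m₁ → E =>
        nearGraphProb κ R Γ₁ (Fin.cons x₁ y₁ : Fin (m₁ + 1) → E) :=
      hn₁.comp (measurable_fin_cons.comp (measurable_const.prodMk measurable_id))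
    have hm2 : Measurable fun x₂ : E => (goodPairs R S').indicator (1 : E × E → ℝ≥0∞) (x₁, x₂) :=
      hgi.comp (by fun_prop)
    rw [lintegral_mul_const _ hm1, lintegral_mul_const _ hm2]
    by_cases hx : x₁ ∈ S'
    · rw [lintegral_nearGraphProb_cons hκ (hS _ hx)]
      ring
    · have : ∀ x₂, (goodPairs R S').indicator (1 : E × E → ℝ≥0∞) (x₁, x₂) = 0 := fun x₂ =>
        Set.indicator_of_notMem (fun h => hx h.1) _
      simp [this]
  simp only [h2]
  rw [lintegral_mul_const _ hgi.lintegral_prod_right', ← lintegral_prod _ hgi.aemeasurable,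
    lintegral_indicator_one hg]

end FiniteModel

/-! ### Configurations with prescribed neighbours of two roots. -/

section FiniteModelPairs

/-- The location configurations in which the vertices near the roots `f₁ 0` and `f₂ 0` are exactly
the remaining values of `f₁` and `f₂`, the roots being in good position. -/
def exactConfigurations {V E : Type*} [NormedAddCommGroup E] (R : ℝ) (S' : Set E) {m₁ m₂ : ℕ}
    (f₁ : Fin (m₁ + 1) → V) (f₂ : Fin (m₂ + 1) → V) : Set (V → E) :=
  {y | (y (f₁ 0), y (f₂ 0)) ∈ goodPairs R S' ∧
    (∀ l : Fin m₁, y (f₁ l.succ) ∈ Metric.closedBall (y (f₁ 0)) R) ∧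
    (∀ l : Fin m₂, y (f₂ l.succ) ∈ Metric.closedBall (y (f₂ 0)) R) ∧
    ∀ v, v ∉ Set.range (Sum.elim f₁ f₂) →
      y v ∉ Metric.closedBall (y (f₁ 0)) R ∪ Metric.closedBall (y (f₂ 0)) R}

lemma measurableSet_ofPred_forall {α : Type*} [MeasurableSpace α] {ι : Sort*} [Countable ι]
    {p : ι → α → Prop} (h : ∀ i, MeasurableSet {a | p i a}) : MeasurableSet {a | ∀ i, p i a} := by
  rw [Set.ofPred_forall]
  exact MeasurableSet.iInter h

lemma measurableSet_mem_closedBall {α E : Type*} [MeasurableSpace α] [NormedAddCommGroup E]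
    [MeasurableSpace E] [BorelSpace E] [SecondCountableTopology E] {f g : α → E}
    (hf : Measurable f) (hg : Measurable g) (R : ℝ) :
    MeasurableSet {a | f a ∈ Metric.closedBall (g a) R} := by
  simp only [Metric.mem_closedBall, dist_eq_norm]
  exact measurableSet_le (by fun_prop) measurable_const

lemma measurableSet_exactConfigurations {V E : Type*} [Countable V] [NormedAddCommGroup E]
    [MeasurableSpace E] [BorelSpace E] [SecondCountableTopology E] (R : ℝ) {S' : Set E}
    (hS' : MeasurableSet S') {m₁ m₂ : ℕ} (f₁ : Fin (m₁ + 1) → V) (f₂ : Fin (m₂ + 1) → V) :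
    MeasurableSet (exactConfigurations R S' f₁ f₂) := by
  have hp : ∀ v, Measurable fun y : V → E => y v := fun v => measurable_pi_apply v
  have h1 : MeasurableSet {y : V → E | (y (f₁ 0), y (f₂ 0)) ∈ goodPairs R S'} :=
    ((hp _).prodMk (hp _)) (measurableSet_goodPairs R hS')
  have h2 : ∀ {m : ℕ} (f : Fin (m + 1) → V), MeasurableSet
      {y : V → E | ∀ l : Fin m, y (f l.succ) ∈ Metric.closedBall (y (f 0)) R} := fun f =>
    measurableSet_ofPred_forall fun l => measurableSet_mem_closedBall (hp _) (hp _) R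
  have h3 : MeasurableSet {y : V → E | ∀ v, v ∉ Set.range (Sum.elim f₁ f₂) →
      y v ∉ Metric.closedBall (y (f₁ 0)) R ∪ Metric.closedBall (y (f₂ 0)) R} :=
    measurableSet_ofPred_forall fun v => measurableSet_ofPred_forall fun _ =>
      ((measurableSet_mem_closedBall (hp _) (hp _) R).union
        (measurableSet_mem_closedBall (hp _) (hp _) R)).compl
  exact h1.inter ((h2 f₁).inter ((h2 f₂).inter h3))

/-- The joint law of independent, identically distributed locations, split into three blocks. -/
lemma map_three_blocks {Ω V E : Type*} [Fintype V] [MeasurableSpace Ω] {P : Measure Ω}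
    [MeasurableSpace E]
    {Y : V → Ω → E} {ν : Measure E} [IsProbabilityMeasure ν]
    (hY : ∀ v, Measurable (Y v)) (hind : iIndepFun Y P) (hlaw : ∀ v, P.map (Y v) = ν)
    {ι₁ ι₂ : Type*} [Fintype ι₁] [Fintype ι₂] {f₁ : ι₁ → V} {f₂ : ι₂ → V}
    (hf : Function.Injective (Sum.elim f₁ f₂)) [Fintype {v // v ∉ Set.range (Sum.elim f₁ f₂)}] :
    P.map (fun ω => (((fun a => Y (f₁ a) ω), (fun a => Y (f₂ a) ω)),
      fun v : {v // v ∉ Set.range (Sum.elim f₁ f₂)} => Y v ω)) =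
    ((Measure.pi fun _ => ν).prod (Measure.pi fun _ => ν)).prod (Measure.pi fun _ => ν) := by
  let e : (ι₁ ⊕ ι₂) ⊕ {v // v ∉ Set.range (Sum.elim f₁ f₂)} → V :=
    Sum.elim (Sum.elim f₁ f₂) Subtype.val
  have he : Function.Injective e := by
    rintro (a | a) (b | b) hab
    · exact congrArg _ (hf hab)
    · exact absurd ⟨a, hab⟩ b.2
    · exact absurd ⟨b, hab.symm⟩ a.2
    · exact congrArg _ (Subtype.ext hab)
  have h1 : P.map (fun ω a => Y (e a) ω) = Measure.pi fun _ => ν := by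
    rw [(hind.precomp he).map_fun_eq_pi_map fun a => (hY _).aemeasurable]
    simp only [hlaw]
  have h2 := measurePreserving_sumPiEquivProdPi
    (fun _ : (ι₁ ⊕ ι₂) ⊕ {v // v ∉ Set.range (Sum.elim f₁ f₂)} => ν)
  have h3 := (measurePreserving_sumPiEquivProdPi (fun _ : ι₁ ⊕ ι₂ => ν)).prod
    (MeasurePreserving.id (Measure.pi fun _ : {v // v ∉ Set.range (Sum.elim f₁ f₂)} => ν))
  have h4 := h3.comp h2
  rw [← h4.map_eq, ← h1, Measure.map_map h4.measurable (measurable_pi_lambda _ fun a => hY _)]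
  rfl

variable {Ω V E : Type*} [MeasurableSpace Ω] {P : Measure Ω} [IsProbabilityMeasure P]
  [NormedAddCommGroup E] [MeasureSpace E] [BorelSpace E]
  [SecondCountableTopology E] [SigmaFinite (volume : Measure E)]
  [(volume : Measure E).IsAddRightInvariant] {κ : ℝ≥0 → I → I → I} [Fintype V] [LinearOrder V]
  {Y : V → Ω → E} {W : V → Ω → I} {G : Ω → SimpleGraph V}

/-- Given the two blocks, the other vertices are independent of them and of each other, and each one
misses both balls with probability at least `1 - 2 * (c * volume (Metric.closedBall 0 R))`. -/
lemma IsSIRG.le_measure_exactConfigurations (hG : IsSIRG P Y W κ G)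
    (hκ : Measurable fun q : ℝ≥0 × I × I => κ q.1 q.2.1 q.2.2)
    (hsymm : ∀ t x y, κ t x y = κ t y x) (hW : IsUniformWeights P W Y) (hind : iIndepFun Y P)
    {c : ℝ≥0∞} {S S' : Set E}
    [IsProbabilityMeasure (c • (volume : Measure E).restrict S)]
    (hlaw : ∀ v, P.map (Y v) = c • (volume : Measure E).restrict S)
    {R : ℝ} (hS' : MeasurableSet S') (hS : ∀ x ∈ S', Metric.closedBall x R ⊆ S)
    {m₁ m₂ : ℕ} {f₁ : Fin (m₁ + 1) → V} {f₂ : Fin (m₂ + 1) → V}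
    (hf : Function.Injective (Sum.elim f₁ f₂))
    (Γ₁ : SimpleGraph (Fin (m₁ + 1))) (Γ₂ : SimpleGraph (Fin (m₂ + 1))) :
    ((c • (volume : Measure E).restrict S).prod (c • (volume : Measure E).restrict S))
      (goodPairs R S') * ((c ^ m₁ * ballGraphIntegral (E := E) κ R Γ₁) *
        (c ^ m₂ * ballGraphIntegral (E := E) κ R Γ₂)) *
      (1 - 2 * (c * volume (Metric.closedBall (0 : E) R))) ^ Fintype.card V ≤
    P ((fun ω i => Y i ω) ⁻¹' exactConfigurations R S' f₁ f₂ ∩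
      {ω | (G ω).comap f₁ = Γ₁ ∧ (G ω).comap f₂ = Γ₂}) := by
  classical
  set ν := c • (volume : Measure E).restrict S with hν
  have hA := measurableSet_exactConfigurations R hS' f₁ f₂
  have hYm : Measurable fun ω i => Y i ω := measurable_pi_lambda _ hG.measurable_location
  rw [hG.measure_comap_eq_and_comap_eq_of_uniformWeights hκ hsymm hW hA f₁ f₂ hf Γ₁ Γ₂,
    ← lintegral_indicator (hYm hA)]
  let rest := {v // v ∉ Set.range (Sum.elim f₁ f₂)}
  let far : Set (((Fin (m₁ + 1) → E) × (Fin (m₂ + 1) → E)) × (rest → E)) :=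
    {t | ∀ v, t.2 v ∉ Metric.closedBall (t.1.1 0) R ∪ Metric.closedBall (t.1.2 0) R}
  have hfar : MeasurableSet far := by
    refine measurableSet_ofPred_forall fun v => ?_
    exact ((measurableSet_mem_closedBall (by fun_prop) (by fun_prop) R).union
      (measurableSet_mem_closedBall (by fun_prop) (by fun_prop) R)).compl
  let Φ₀ : ((Fin (m₁ + 1) → E) × (Fin (m₂ + 1) → E)) → ℝ≥0∞ := fun y =>
    (goodPairs R S').indicator 1 (y.1 0, y.2 0) *
      (nearGraphProb κ R Γ₁ y.1 * nearGraphProb κ R Γ₂ y.2)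
  have hgi : Measurable ((goodPairs R S').indicator (1 : E × E → ℝ≥0∞)) :=
    measurable_one.indicator (measurableSet_goodPairs R hS')
  have hΦ₀ : Measurable Φ₀ :=
    (hgi.comp (by fun_prop)).mul (((measurable_nearGraphProb hκ R Γ₁).comp measurable_fst).mul
      ((measurable_nearGraphProb hκ R Γ₂).comp measurable_snd))
  have hfi : Measurable (far.indicator (fun _ => (1 : ℝ≥0∞))) := measurable_const.indicator hfar
  have hΦ : Measurable fun t : ((Fin (m₁ + 1) → E) × (Fin (m₂ + 1) → E)) × (rest → E) =>
      Φ₀ t.1 * far.indicator (fun _ => (1 : ℝ≥0∞)) t := (hΦ₀.comp measurable_fst).mul hfi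
  have hT : Measurable fun ω => (((fun a => Y (f₁ a) ω), (fun a => Y (f₂ a) ω)),
      fun v : rest => Y v ω) := by
    have := hG.measurable_location
    fun_prop
  have hpt : ∀ ω, ((fun ω i => Y i ω) ⁻¹' exactConfigurations R S' f₁ f₂).indicator (fun ω =>
      meanGraphProb κ Γ₁ (fun a => Y (f₁ a) ω) * meanGraphProb κ Γ₂ (fun a => Y (f₂ a) ω)) ω =
      Φ₀ ((fun a => Y (f₁ a) ω), (fun a => Y (f₂ a) ω)) *
        far.indicator (fun _ => (1 : ℝ≥0∞)) (((fun a => Y (f₁ a) ω), (fun a => Y (f₂ a) ω)),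
          fun v : rest => Y v ω) := by
    intro ω
    set t := (((fun a => Y (f₁ a) ω), (fun a => Y (f₂ a) ω)), fun v : rest => Y v ω)
    have hiff : ω ∈ (fun ω i => Y i ω) ⁻¹' exactConfigurations R S' f₁ f₂ ↔
        (t.1.1 0, t.1.2 0) ∈ goodPairs R S' ∧
        t.1.1 ∈ {y : Fin (m₁ + 1) → E | ∀ l : Fin m₁, y l.succ ∈ Metric.closedBall (y 0) R} ∧
        t.1.2 ∈ {y : Fin (m₂ + 1) → E | ∀ l : Fin m₂, y l.succ ∈ Metric.closedBall (y 0) R} ∧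
        t ∈ far := by
      refine and_congr Iff.rfl (and_congr Iff.rfl (and_congr Iff.rfl ?_))
      exact ⟨fun h v => h v.1 v.2, fun h v hv => h ⟨v, hv⟩⟩
    change _ = (goodPairs R S').indicator 1 (t.1.1 0, t.1.2 0) *
      (nearGraphProb κ R Γ₁ t.1.1 * nearGraphProb κ R Γ₂ t.1.2) * far.indicator
        (fun _ => (1 : ℝ≥0∞)) t
    by_cases h : ω ∈ (fun ω i => Y i ω) ⁻¹' exactConfigurations R S' f₁ f₂
    · rw [Set.indicator_of_mem h]
      obtain ⟨h1, h2, h3, h4⟩ := hiff.1 h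
      rw [Set.indicator_of_mem h1, Set.indicator_of_mem h4, nearGraphProb, nearGraphProb,
        Set.indicator_of_mem h2, Set.indicator_of_mem h3]
      simp [t]
    · rw [Set.indicator_of_notMem h]
      by_cases h1 : (t.1.1 0, t.1.2 0) ∈ goodPairs R S'
      · by_cases h2 : t.1.1 ∈
            {y : Fin (m₁ + 1) → E | ∀ l : Fin m₁, y l.succ ∈ Metric.closedBall (y 0) R}
        · by_cases h3 : t.1.2 ∈
              {y : Fin (m₂ + 1) → E | ∀ l : Fin m₂, y l.succ ∈ Metric.closedBall (y 0) R}
          · have h4 : t ∉ far := fun h4 => h (hiff.2 ⟨h1, h2, h3, h4⟩)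
            rw [Set.indicator_of_notMem h4, mul_zero]
          · rw [nearGraphProb, nearGraphProb, Set.indicator_of_notMem h3]
            simp
        · rw [nearGraphProb, Set.indicator_of_notMem h2]
          simp
      · rw [Set.indicator_of_notMem h1]
        simp
  have hball : ∀ x : E, ν (Metric.closedBall x R) ≤
      c * volume (Metric.closedBall (0 : E) R) := by
    intro x
    rw [hν, Measure.smul_apply, smul_eq_mul]
    refine mul_le_mul_right ?_ c
    refine (Measure.restrict_apply_le _ _).trans (le_of_eq ?_)
    have := measure_preimage_add_right (volume : Measure E) x (Metric.closedBall x R)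
    rw [← this]
    congr 1
    ext z
    simp [dist_eq_norm]
  have hrest : ∀ y : (Fin (m₁ + 1) → E) × (Fin (m₂ + 1) → E),
      (1 - 2 * (c * volume (Metric.closedBall (0 : E) R))) ^ Fintype.card V ≤
      ∫⁻ z : rest → E, far.indicator (fun _ => (1 : ℝ≥0∞)) (y, z) ∂Measure.pi fun _ => ν := by
    intro y
    set U := Metric.closedBall (y.1 0) R ∪ Metric.closedBall (y.2 0) R
    have hU : MeasurableSet U :=
      Metric.isClosed_closedBall.measurableSet.union Metric.isClosed_closedBall.measurableSet
    have h1 : ∀ z : rest → E, far.indicator (fun _ => (1 : ℝ≥0∞)) (y, z) =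
        (Set.univ.pi fun _ : rest => Uᶜ).indicator 1 z := by
      intro z
      have : (y, z) ∈ far ↔ z ∈ Set.univ.pi fun _ : rest => Uᶜ := by
        simp [far, U]
      by_cases hz : (y, z) ∈ far
      · rw [Set.indicator_of_mem hz, Set.indicator_of_mem (this.1 hz)]
        rfl
      · rw [Set.indicator_of_notMem hz, Set.indicator_of_notMem (mt this.2 hz)]
    simp only [h1]
    rw [lintegral_indicator_one (MeasurableSet.univ_pi fun _ => hU.compl), Measure.pi_pi,
      Finset.prod_const, Finset.card_univ]
    have hle : 1 - 2 * (c * volume (Metric.closedBall (0 : E) R)) ≤ ν Uᶜ := by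
      rw [prob_compl_eq_one_sub hU]
      refine tsub_le_tsub_left ((measure_union_le _ _).trans ?_) _
      rw [two_mul]
      exact add_le_add (hball _) (hball _)
    -- The base is at most one, so taking all vertices in the exponent, instead of those outside the
    -- blocks, weakens the bound but gives a simpler limit.
    calc _ ≤ (1 - 2 * (c * volume (Metric.closedBall (0 : E) R))) ^ Fintype.card rest :=
          pow_le_pow_right_of_le_one' tsub_le_self (Fintype.card_subtype_le _)
      _ ≤ _ := by gcongr
  calc _ = ∫⁻ y, Φ₀ y * (1 - 2 * (c * volume (Metric.closedBall (0 : E) R))) ^ Fintype.card V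
        ∂(Measure.pi fun _ => ν).prod (Measure.pi fun _ => ν) := by
        rw [lintegral_mul_const _ hΦ₀, lintegral_lintegral_nearGraphProb hκ hS' hS Γ₁ Γ₂]
    _ ≤ ∫⁻ y, ∫⁻ z, Φ₀ y * far.indicator (fun _ => (1 : ℝ≥0∞)) (y, z) ∂(Measure.pi fun _ => ν)
        ∂(Measure.pi fun _ => ν).prod (Measure.pi fun _ => ν) := by
        refine lintegral_mono fun y => ?_
        have hfy : Measurable fun z : rest → E => far.indicator (fun _ => (1 : ℝ≥0∞)) (y, z) :=
          hfi.comp (by fun_prop)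
        rw [lintegral_const_mul _ hfy]
        exact mul_le_mul_right (hrest y) _
    _ = ∫⁻ t, Φ₀ t.1 * far.indicator (fun _ => (1 : ℝ≥0∞)) t
        ∂(((Measure.pi fun _ => ν).prod (Measure.pi fun _ => ν)).prod (Measure.pi fun _ => ν)) :=
        (lintegral_prod _ hΦ.aemeasurable).symm
    _ = _ := by
        rw [← map_three_blocks hG.measurable_location hind hlaw hf, lintegral_map hΦ hT]
        exact lintegral_congr fun ω => (hpt ω).symm

end FiniteModelPairs

/-! ### Joint lower bound for two local events in a finite model. -/

section FiniteModelLocal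

variable {Ω V E : Type*}

/-- The roots are more than `2 * R` apart, so neither the other root nor any of its near points can
lie in the ball of a root. The remaining vertices are excluded by definition. -/
lemma range_eq_nearSet_of_mem_exactConfigurations [NormedAddCommGroup E] {Y : V → Ω → E} {R : ℝ}
    {S' : Set E} {m₁ m₂ : ℕ} {f₁ : Fin m₁ → V} {f₂ : Fin m₂ → V} {i j : V}
    (hf : Function.Injective (Sum.elim (Fin.cons i f₁ : Fin (m₁ + 1) → V)
      (Fin.cons j f₂ : Fin (m₂ + 1) → V))) {ω : Ω}
    (h : (fun v => Y v ω) ∈ exactConfigurations R S' (Fin.cons i f₁ : Fin (m₁ + 1) → V)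
      (Fin.cons j f₂ : Fin (m₂ + 1) → V)) :
    Set.range f₁ = nearSet Y R i ω ∧ Set.range f₂ = nearSet Y R j ω := by
  obtain ⟨⟨-, -, hd⟩, h1, h2, h3⟩ := h
  simp only [Fin.cons_zero, Fin.cons_succ, Metric.mem_closedBall] at hd h1 h2 h3
  have hne : ∀ a b, a ≠ b → Sum.elim (Fin.cons i f₁ : Fin (m₁ + 1) → V)
      (Fin.cons j f₂ : Fin (m₂ + 1) → V) a ≠ Sum.elim (Fin.cons i f₁ : Fin (m₁ + 1) → V)
      (Fin.cons j f₂ : Fin (m₂ + 1) → V) b := fun a b hab h => hab (hf h)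
  have hd0 : 0 ≤ dist (Y i ω) (Y j ω) := dist_nonneg
  have hcomm := dist_comm (Y i ω) (Y j ω)
  have hcover : ∀ v, dist (Y v ω) (Y i ω) ≤ R ∨ dist (Y v ω) (Y j ω) ≤ R →
      v = i ∨ v ∈ Set.range f₁ ∨ v = j ∨ v ∈ Set.range f₂ := by
    intro v hv
    by_contra hcon
    push Not at hcon
    refine h3 v ?_ (by simpa using hv)
    rintro ⟨a | a, rfl⟩
    · refine Fin.cases (fun h => ?_) (fun l h => ?_) a hcon
      · exact h.1 (by simp)
      · exact h.2.1 ⟨l, by simp⟩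
    · refine Fin.cases (fun h => ?_) (fun l h => ?_) a hcon
      · exact h.2.2.1 (by simp)
      · exact h.2.2.2 ⟨l, by simp⟩
  constructor
  · ext v
    simp only [nearSet, Set.mem_ofPred_eq, Metric.mem_closedBall]
    constructor
    · rintro ⟨l, rfl⟩
      exact ⟨by simpa using hne (.inl l.succ) (.inl 0) (by simp), h1 l⟩
    · rintro ⟨hvi, hv⟩
      rcases hcover v (Or.inl hv) with h | h | rfl | ⟨l, rfl⟩
      · exact absurd h hvi
      · exact h
      · linarith
      · have := dist_triangle_left (Y i ω) (Y j ω) (Y (f₂ l) ω)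
        linarith [h2 l]
  · ext v
    simp only [nearSet, Set.mem_ofPred_eq, Metric.mem_closedBall]
    constructor
    · rintro ⟨l, rfl⟩
      exact ⟨by simpa using hne (.inr l.succ) (.inr 0) (by simp), h2 l⟩
    · rintro ⟨hvj, hv⟩
      rcases hcover v (Or.inr hv) with rfl | ⟨l, rfl⟩ | h | h
      · linarith
      · have := dist_triangle_left (Y i ω) (Y j ω) (Y (f₁ l) ω)
        linarith [h1 l]
      · exact absurd h hvj
      · exact h

variable [MeasurableSpace Ω] {P : Measure Ω} [IsProbabilityMeasure P]
  [NormedAddCommGroup E] [MeasureSpace E] [BorelSpace E]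
  [SecondCountableTopology E] [SigmaFinite (volume : Measure E)]
  [(volume : Measure E).IsAddRightInvariant] {κ : ℝ≥0 → I → I → I} [Fintype V] [LinearOrder V]
  {Y : V → Ω → E} {W : V → Ω → I} {G : Ω → SimpleGraph V}

/-- Lower bound for the probability that two vertices of a finite model have prescribed
neighbourhoods. -/
lemma IsSIRG.le_measure_localEvent_inter (hG : IsSIRG P Y W κ G)
    (hκ : Measurable fun q : ℝ≥0 × I × I => κ q.1 q.2.1 q.2.2)
    (hsymm : ∀ t x y, κ t x y = κ t y x) (hW : IsUniformWeights P W Y) (hind : iIndepFun Y P)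
    {c : ℝ≥0∞} {S S' : Set E}
    [IsProbabilityMeasure (c • (volume : Measure E).restrict S)]
    (hlaw : ∀ v, P.map (Y v) = c • (volume : Measure E).restrict S)
    {R : ℝ} (hS' : MeasurableSet S') (hS : ∀ x ∈ S', Metric.closedBall x R ⊆ S)
    {m₁ m₂ : ℕ} {i j : V} (hij : i ≠ j) (D₁ : Set (SimpleGraph (Fin (m₁ + 1))))
    (D₂ : Set (SimpleGraph (Fin (m₂ + 1)))) :
    ((Fintype.card V - 2).descFactorial (m₁ + m₂) : ℝ≥0∞) *
      (((c • (volume : Measure E).restrict S).prod (c • (volume : Measure E).restrict S))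
        (goodPairs R S') * ((c ^ m₁ * ballIntegral (E := E) κ R D₁) *
          (c ^ m₂ * ballIntegral (E := E) κ R D₂)) *
        (1 - 2 * (c * volume (Metric.closedBall (0 : E) R))) ^ Fintype.card V) ≤
    ((m₁.factorial : ℝ≥0∞) * m₂.factorial) *
      P (localEvent Y G R i D₁ ∩ localEvent Y G R j D₂) := by
  classical
  let U : ∀ {m : ℕ} (_ : V) (_ : Set (SimpleGraph (Fin (m + 1)))) (_ : Fin m ↪ V), Set Ω :=
    fun {m} i D f => {ω | Set.range f = nearSet Y R i ω ∧
      (G ω).comap (Fin.cons i f : Fin (m + 1) → V) ∈ D}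
  have hU : ∀ {m : ℕ} (i : V) (D : Set (SimpleGraph (Fin (m + 1)))) (f : Fin m ↪ V),
      MeasurableSet (U i D f) := fun i D f =>
    (measurableSet_range_eq_nearSet hG.measurable_location R i f).inter
      (measurableSet_comap_mem hG.measurable_adj _ D)
  -- Each outcome in the intersection is counted at most `m₁! * m₂!` times.
  have hupper : ∑' p : (Fin m₁ ↪ V) × (Fin m₂ ↪ V), P (U i D₁ p.1 ∩ U j D₂ p.2) ≤
      ((m₁.factorial : ℝ≥0∞) * m₂.factorial) *
        P (localEvent Y G R i D₁ ∩ localEvent Y G R j D₂) := by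
    calc _ = ∫⁻ ω, ∑' p : (Fin m₁ ↪ V) × (Fin m₂ ↪ V),
          (U i D₁ p.1).indicator (1 : Ω → ℝ≥0∞) ω * (U j D₂ p.2).indicator 1 ω ∂P := by
          have hm : ∀ p : (Fin m₁ ↪ V) × (Fin m₂ ↪ V), Measurable fun ω =>
              (U i D₁ p.1).indicator (1 : Ω → ℝ≥0∞) ω * (U j D₂ p.2).indicator 1 ω := fun p =>
            (measurable_one.indicator (hU _ _ _)).mul (measurable_one.indicator (hU _ _ _))
          rw [lintegral_tsum fun p => (hm p).aemeasurable]
          refine tsum_congr fun p => ?_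
          rw [← lintegral_indicator_one ((hU _ _ _).inter (hU _ _ _)), Set.inter_indicator_one]
          rfl
      _ ≤ ∫⁻ ω, (localEvent Y G R i D₁ ∩ localEvent Y G R j D₂).indicator
          (fun _ => (m₁.factorial : ℝ≥0∞) * m₂.factorial) ω ∂P := by
          refine lintegral_mono fun ω => ?_
          rw [ENNReal.tsum_prod']
          simp only [ENNReal.tsum_mul_left, ENNReal.tsum_mul_right]
          refine (mul_le_mul' (tsum_indicator_localEvent_le Y G R i D₁ ω)
            (tsum_indicator_localEvent_le Y G R j D₂ ω)).trans (le_of_eq ?_)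
          by_cases h1 : ω ∈ localEvent Y G R i D₁ <;> by_cases h2 : ω ∈ localEvent Y G R j D₂ <;>
            simp [h1, h2]
      _ ≤ _ := lintegral_indicator_const_le _ _
  refine le_trans ?_ hupper
  -- For the lower bound only pairs of enumerations with disjoint ranges avoiding both roots are
  -- kept. They are the injections of `Fin m₁ ⊕ Fin m₂` into the other vertices, which explains the
  -- falling factorial, and all satisfy the same bound.
  let X := {v : V // v ≠ i ∧ v ≠ j}
  let ψ : ((Fin m₁ ⊕ Fin m₂) ↪ X) → (Fin m₁ ↪ V) × (Fin m₂ ↪ V) := fun g =>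
    ((Function.Embedding.inl.trans g).trans (Function.Embedding.subtype _),
      (Function.Embedding.inr.trans g).trans (Function.Embedding.subtype _))
  have hψ : Function.Injective ψ := by
    intro g g' hgg
    ext a
    rcases a with a | a
    · exact DFunLike.congr_fun (congrArg Prod.fst hgg) a
    · exact DFunLike.congr_fun (congrArg Prod.snd hgg) a
  refine le_trans ?_ (ENNReal.tsum_comp_le_tsum_of_injective hψ _)
  have hcard : Fintype.card ((Fin m₁ ⊕ Fin m₂) ↪ X) =
      (Fintype.card V - 2).descFactorial (m₁ + m₂) := by
    rw [Fintype.card_embedding_eq, Fintype.card_sum, Fintype.card_fin, Fintype.card_fin]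
    congr 1
    rw [Fintype.card_subtype]
    have : (Finset.univ.filter fun v : V => v ≠ i ∧ v ≠ j) = ({i, j} : Finset V)ᶜ := by
      ext
      simp
    rw [this, Finset.card_compl, Finset.card_pair hij]
  rw [← hcard, tsum_fintype, ← nsmul_eq_mul, ← Finset.card_univ]
  refine Finset.card_nsmul_le_sum _ _ _ fun g _ => ?_
  set f₁ := (ψ g).1
  set f₂ := (ψ g).2
  have hf : Function.Injective (Sum.elim (Fin.cons i f₁ : Fin (m₁ + 1) → V)
      (Fin.cons j f₂ : Fin (m₂ + 1) → V)) := by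
    have e₁ : ∀ l, f₁ l ≠ i ∧ f₁ l ≠ j := fun l => (g (.inl l)).2
    have e₂ : ∀ l, f₂ l ≠ i ∧ f₂ l ≠ j := fun l => (g (.inr l)).2
    refine Function.Injective.sumElim ?_ ?_ ?_
    · exact Fin.cons_injective_iff.2 ⟨fun ⟨l, hl⟩ => (e₁ l).1 hl, f₁.injective⟩
    · exact Fin.cons_injective_iff.2 ⟨fun ⟨l, hl⟩ => (e₂ l).2 hl, f₂.injective⟩
    · intro a b
      refine Fin.cases ?_ (fun l => ?_) a <;> refine Fin.cases ?_ (fun l' => ?_) b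
      · simpa using hij
      · simpa using (e₂ l').1.symm
      · simpa using (e₁ l).2
      · intro h
        have h' : f₁ l = f₂ l' := by simpa using h
        have := g.injective (Subtype.ext h' : g (.inl l) = g (.inr l'))
        simp at this
  set A := exactConfigurations (E := E) R S' (Fin.cons i f₁ : Fin (m₁ + 1) → V)
    (Fin.cons j f₂ : Fin (m₂ + 1) → V)
  have hA : MeasurableSet A := measurableSet_exactConfigurations R hS' _ _
  have hYm : Measurable fun ω i => Y i ω := measurable_pi_lambda _ hG.measurable_location
  calc _ = ∑' q : D₁ × D₂,
        (((c • (volume : Measure E).restrict S).prod (c • (volume : Measure E).restrict S))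
          (goodPairs R S') *
          ((c ^ m₁ * ballGraphIntegral (E := E) κ R (q.1 : SimpleGraph (Fin (m₁ + 1)))) *
          (c ^ m₂ * ballGraphIntegral (E := E) κ R (q.2 : SimpleGraph (Fin (m₂ + 1))))) *
        (1 - 2 * (c * volume (Metric.closedBall (0 : E) R))) ^ Fintype.card V) := by
        rw [ENNReal.tsum_prod']
        simp only [ballIntegral, ENNReal.tsum_mul_left, ENNReal.tsum_mul_right]
    _ ≤ ∑' q : D₁ × D₂, P ((fun ω i => Y i ω) ⁻¹' A ∩
        {ω | (G ω).comap (Fin.cons i f₁ : Fin (m₁ + 1) → V) = q.1 ∧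
          (G ω).comap (Fin.cons j f₂ : Fin (m₂ + 1) → V) = q.2}) :=
        ENNReal.tsum_le_tsum fun q =>
          hG.le_measure_exactConfigurations hκ hsymm hW hind hlaw hS' hS hf _ _
    _ = P (⋃ q : D₁ × D₂, (fun ω i => Y i ω) ⁻¹' A ∩
        {ω | (G ω).comap (Fin.cons i f₁ : Fin (m₁ + 1) → V) = q.1 ∧
          (G ω).comap (Fin.cons j f₂ : Fin (m₂ + 1) → V) = q.2}) := by
        rw [measure_iUnion]
        · intro q q' hne
          refine Set.disjoint_left.2 fun ω h1 h2 => hne ?_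
          exact Prod.ext (Subtype.ext (h1.2.1.symm.trans h2.2.1))
            (Subtype.ext (h1.2.2.symm.trans h2.2.2))
        · exact fun q => (hYm hA).inter ((measurableSet_comap_eq hG.measurable_adj _ _).inter
            (measurableSet_comap_eq hG.measurable_adj _ _))
    _ ≤ _ := by
        refine measure_mono (Set.iUnion_subset fun q ω hω => ?_)
        obtain ⟨hr₁, hr₂⟩ := range_eq_nearSet_of_mem_exactConfigurations hf hω.1
        exact ⟨⟨hr₁, by rw [hω.2.1]; exact q.1.2⟩, ⟨hr₂, by rw [hω.2.2]; exact q.2.2⟩⟩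

end FiniteModelLocal

/-! ### First-moment bounds for long edges, and local finiteness. -/

section LongEdges

/-- Some path of length at most `r` from `i` leaves, in its `j`-th step, the ball of radius
`R (j + 1)` coming from the ball of radius `R j`. -/
def longEdgeEvent {Ω V E : Type*} [NormedAddCommGroup E] (Y : V → Ω → E) (G : Ω → SimpleGraph V)
    (R : ℕ → ℝ) (r : ℕ) (i : V) : Set Ω :=
  {ω | ∃ j < r, ∃ u ∈ insert i (nearSet Y (R j) i ω), ∃ v ∉ insert i (nearSet Y (R (j + 1)) i ω),
    (G ω).Adj u v}

variable {Ω V E : Type*} [MeasurableSpace Ω] {P : Measure Ω}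
  [NormedAddCommGroup E] [MeasureSpace E]

/-- Bounds for the first two moment measures of the locations, as seen from the vertex `i`. -/
structure HasMomentBounds (P : Measure Ω) (Y : V → Ω → E) (i : V) : Prop where
  first : ∀ h : E → ℝ≥0∞, Measurable h →
    ∑' v : {v // v ≠ i}, ∫⁻ ω, h (Y v ω - Y i ω) ∂P ≤ ∫⁻ x, h x
  second : ∀ (ρ : ℝ) (h : E → ℝ≥0∞), Measurable h →
    ∑' p : {p : V × V // p.1 ≠ i ∧ p.2 ≠ i ∧ p.1 ≠ p.2},
      ∫⁻ ω, (Metric.closedBall (0 : E) ρ).indicator 1 (Y p.1.1 ω - Y i ω) *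
        h (Y p.1.2 ω - Y p.1.1 ω) ∂P ≤ volume (Metric.closedBall (0 : E) ρ) * ∫⁻ x, h x

/-- The expected number of edges of a vertex that are longer than `L`. -/
noncomputable def longConnection (E : Type*) [NormedAddCommGroup E] [MeasureSpace E]
    (κ : ℝ≥0 → I → I → I) (L : ℝ) : ℝ≥0∞ :=
  ∫⁻ x : E in {x | L < ‖x‖}, meanConnection κ x

variable [BorelSpace E] [SecondCountableTopology E]
  {κ : ℝ≥0 → I → I → I} [LinearOrder V]
  {Y : V → Ω → E} {W : V → Ω → I} {G : Ω → SimpleGraph V} [IsProbabilityMeasure P]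

/-- An expected number of neighbours of `i`, with displacement restricted to `A`. Long displacements
control the escape of paths; `A = Set.univ` controls the degree. -/
lemma IsSIRG.tsum_measure_adj_root_le (hG : IsSIRG P Y W κ G)
    (hκ : Measurable fun q : ℝ≥0 × I × I => κ q.1 q.2.1 q.2.2) (hW : IsUniformWeights P W Y) {i : V}
    (hM : HasMomentBounds P Y i) {A : Set E} (hA : MeasurableSet A) :
    ∑' v : {v // v ≠ i}, P ({ω | Y v ω - Y i ω ∈ A} ∩ {ω | (G ω).Adj v i}) ≤
      ∫⁻ x in A, meanConnection κ x := by
  have hm : Measurable (A.indicator (meanConnection (E := E) κ)) :=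
    (measurable_meanConnection hκ).indicator hA
  rw [← lintegral_indicator hA]
  refine le_trans (le_of_eq (tsum_congr fun v => ?_)) (hM.first _ hm)
  have hset : MeasurableSet {y : V → E | y v - y i ∈ A} :=
    (by fun_prop : Measurable fun y : V → E => y v - y i) hA
  have hYm : Measurable fun ω => Y v ω - Y i ω :=
    (hG.measurable_location v).sub (hG.measurable_location i)
  have h := hG.measure_adj_of_uniformWeights hκ hW hset v.2
  refine Eq.trans h ?_
  have hset' : MeasurableSet {ω | Y v ω - Y i ω ∈ A} := hYm hA
  change ∫⁻ ω in {ω | Y v ω - Y i ω ∈ A}, _ ∂P = _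
  rw [← lintegral_indicator hset']
  rfl

/-- The same count for edges that start at a vertex other than `i` within distance `ρ` of it. The
volume of the ball bounds the expected number of starting points. -/
lemma IsSIRG.tsum_measure_adj_pair_le (hG : IsSIRG P Y W κ G)
    (hκ : Measurable fun q : ℝ≥0 × I × I => κ q.1 q.2.1 q.2.2) (hW : IsUniformWeights P W Y) {i : V}
    (hM : HasMomentBounds P Y i) (ρ : ℝ) {A : Set E} (hA : MeasurableSet A) :
    ∑' p : {p : V × V // p.1 ≠ i ∧ p.2 ≠ i ∧ p.1 ≠ p.2},
      P ({ω | Y p.1.1 ω - Y i ω ∈ Metric.closedBall 0 ρ ∧ Y p.1.2 ω - Y p.1.1 ω ∈ A} ∩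
        {ω | (G ω).Adj p.1.2 p.1.1}) ≤
      volume (Metric.closedBall (0 : E) ρ) * ∫⁻ x in A, meanConnection κ x := by
  have hm : Measurable (A.indicator (meanConnection (E := E) κ)) :=
    (measurable_meanConnection hκ).indicator hA
  have hB : MeasurableSet (Metric.closedBall (0 : E) ρ) :=
    Metric.isClosed_closedBall.measurableSet
  rw [← lintegral_indicator hA]
  refine le_trans (le_of_eq (tsum_congr fun p => ?_)) (hM.second ρ _ hm)
  obtain ⟨⟨u, v⟩, hu, hv, huv⟩ := p
  have hset : MeasurableSet {y : V → E | y u - y i ∈ Metric.closedBall 0 ρ ∧ y v - y u ∈ A} :=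
    ((by fun_prop : Measurable fun y : V → E => y u - y i) hB).inter
      ((by fun_prop : Measurable fun y : V → E => y v - y u) hA)
  have hset' : MeasurableSet {ω | Y u ω - Y i ω ∈ Metric.closedBall 0 ρ ∧ Y v ω - Y u ω ∈ A} :=
    (((hG.measurable_location u).sub (hG.measurable_location i)) hB).inter
      (((hG.measurable_location v).sub (hG.measurable_location u)) hA)
  have h := hG.measure_adj_of_uniformWeights hκ hW hset huv.symm
  refine Eq.trans h ?_
  change ∫⁻ ω in {ω | Y u ω - Y i ω ∈ Metric.closedBall 0 ρ ∧ Y v ω - Y u ω ∈ A}, _ ∂P = _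
  rw [← lintegral_indicator hset']
  refine lintegral_congr fun ω => ?_
  classical
  simp only [Set.indicator_apply, Set.mem_ofPred_eq, Pi.one_apply]
  split_ifs <;> simp_all

/-- By the triangle inequality, an edge from within `R j` of the root to beyond `R (j + 1)` is
longer than `R (j + 1) - R j`. The union bound counts such edges: the summand `1` stands for those
at the root, the volume for those at other vertices. -/
lemma IsSIRG.measure_longEdgeEvent_le [Countable V] (hG : IsSIRG P Y W κ G)
    (hκ : Measurable fun q : ℝ≥0 × I × I => κ q.1 q.2.1 q.2.2) (hW : IsUniformWeights P W Y) {i : V}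
    (hM : HasMomentBounds P Y i) {R : ℕ → ℝ} (hR : ∀ j, 0 ≤ R j) (r : ℕ) :
    P (longEdgeEvent Y G R r i) ≤ ∑ j ∈ Finset.range r,
      (1 + volume (Metric.closedBall (0 : E) (R j))) * longConnection E κ (R (j + 1) - R j) := by
  have hA : ∀ L : ℝ, MeasurableSet {x : E | L < ‖x‖} := fun L =>
    measurableSet_lt measurable_const measurable_norm
  let F : ℕ → Set Ω := fun j =>
    (⋃ v : {v // v ≠ i}, {ω | Y v ω - Y i ω ∈ {x : E | R (j + 1) - R j < ‖x‖}} ∩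
      {ω | (G ω).Adj v i}) ∪
    ⋃ p : {p : V × V // p.1 ≠ i ∧ p.2 ≠ i ∧ p.1 ≠ p.2},
      {ω | Y p.1.1 ω - Y i ω ∈ Metric.closedBall 0 (R j) ∧
        Y p.1.2 ω - Y p.1.1 ω ∈ {x : E | R (j + 1) - R j < ‖x‖}} ∩ {ω | (G ω).Adj p.1.2 p.1.1}
  have hsub : longEdgeEvent Y G R r i ⊆ ⋃ j ∈ Finset.range r, F j := by
    rintro ω ⟨j, hj, u, hu, v, hv, huv⟩
    refine Set.mem_biUnion (Finset.mem_coe.2 (Finset.mem_range.2 hj)) ?_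
    have hvi : v ≠ i := fun h => hv (Set.mem_insert_iff.2 (Or.inl h))
    have hvR : R (j + 1) < ‖Y v ω - Y i ω‖ := by
      by_contra hcon
      refine hv (Set.mem_insert_iff.2 (Or.inr ⟨hvi, ?_⟩))
      rw [Metric.mem_closedBall, dist_eq_norm]
      exact not_lt.1 hcon
    rcases Set.mem_insert_iff.1 hu with rfl | ⟨hui, hu⟩
    · left
      refine Set.mem_iUnion.2 ⟨⟨v, hvi⟩, ?_, huv.symm⟩
      change R (j + 1) - R j < ‖Y v ω - Y u ω‖
      linarith [hR j]
    · right
      refine Set.mem_iUnion.2 ⟨⟨(u, v), hui, hvi, huv.ne⟩, ⟨?_, ?_⟩, huv.symm⟩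
      · simpa [dist_eq_norm] using hu
      · change R (j + 1) - R j < ‖Y v ω - Y u ω‖
        rw [Metric.mem_closedBall, dist_eq_norm] at hu
        have := norm_sub_le_norm_sub_add_norm_sub (Y v ω) (Y u ω) (Y i ω)
        linarith
  refine (measure_mono hsub).trans ((measure_biUnion_finset_le _ _).trans ?_)
  refine Finset.sum_le_sum fun j _ => (measure_union_le _ _).trans ?_
  rw [add_mul, one_mul]
  refine add_le_add ((measure_iUnion_le _).trans ?_) ((measure_iUnion_le _).trans ?_)
  · exact hG.tsum_measure_adj_root_le hκ hW hM (hA _)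
  · exact hG.tsum_measure_adj_pair_le hκ hW hM (R j) (hA _)

/-- If the expected total degree is finite, almost all realisations are locally finite. -/
lemma IsSIRG.ae_isLocFinite [Countable V] (hG : IsSIRG P Y W κ G)
    (hκ : Measurable fun q : ℝ≥0 × I × I => κ q.1 q.2.1 q.2.2) (hW : IsUniformWeights P W Y) {i : V}
    (hM : HasMomentBounds P Y i) (hfin : ∫⁻ x : E, meanConnection κ x ≠ ∞)
    (hball : ∀ ρ : ℝ, volume (Metric.closedBall (0 : E) ρ) ≠ ∞) :
    ∀ᵐ ω ∂P, IsLocFinite (G ω) := by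
  have h1 : ∀ᵐ ω ∂P, {v : {v // v ≠ i} | ω ∈ {ω | Y v ω - Y i ω ∈ Set.univ} ∩
      {ω | (G ω).Adj v i}}.Finite := by
    refine ae_finite_setOfPred_mem (ne_top_of_le_ne_top hfin ?_)
    exact (hG.tsum_measure_adj_root_le hκ hW hM MeasurableSet.univ).trans (by simp)
  -- The number of edges starting in a ball has finite mean. Balls of integer radius exhaust the
  -- space, so countably many almost sure statements cover all vertices.
  have h2 : ∀ᵐ ω ∂P, ∀ N : ℕ, {p : {p : V × V // p.1 ≠ i ∧ p.2 ≠ i ∧ p.1 ≠ p.2} |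
      ω ∈ {ω | Y p.1.1 ω - Y i ω ∈ Metric.closedBall 0 (N : ℝ) ∧
        Y p.1.2 ω - Y p.1.1 ω ∈ Set.univ} ∩ {ω | (G ω).Adj p.1.2 p.1.1}}.Finite := by
    rw [ae_all_iff]
    intro N
    refine ae_finite_setOfPred_mem (ne_top_of_le_ne_top (ENNReal.mul_ne_top (hball N) hfin) ?_)
    exact (hG.tsum_measure_adj_pair_le hκ hW hM N MeasurableSet.univ).trans (by simp)
  filter_upwards [h1, h2] with ω h1 h2 u
  by_cases hu : u = i
  · subst hu
    refine (h1.image Subtype.val).subset fun v hv => ?_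
    exact ⟨⟨v, hv.ne'⟩, ⟨trivial, hv.symm⟩, rfl⟩
  · obtain ⟨N, hN⟩ := exists_nat_ge ‖Y u ω - Y i ω‖
    refine (((h2 N).image fun p => p.1.2).insert i).subset fun v hv => ?_
    by_cases hvi : v = i
    · exact Set.mem_insert_iff.2 (Or.inl hvi)
    · refine Set.mem_insert_iff.2 (Or.inr ⟨⟨(u, v), hu, hvi, hv.ne⟩, ⟨⟨?_, trivial⟩, hv.symm⟩, rfl⟩)
      simpa using hN

end LongEdges

/-! ### Choice of the truncation radii. -/

section RadiiChoice

variable {E : Type*} [NormedAddCommGroup E] [MeasureSpace E]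

/-- Continuity from above of the finite measure with density `meanConnection`. -/
lemma tendsto_longConnection [BorelSpace E] {κ : ℝ≥0 → I → I → I}
    (hfin : ∫⁻ x : E, meanConnection κ x ≠ ∞) :
    Tendsto (fun n : ℕ => longConnection E κ n) atTop (𝓝 0) := by
  have hA : ∀ L : ℝ, MeasurableSet {x : E | L < ‖x‖} := fun L =>
    measurableSet_lt measurable_const measurable_norm
  have hanti : Antitone fun n : ℕ => {x : E | (n : ℝ) < ‖x‖} := by
    intro m n hmn x hx
    have hx' : (n : ℝ) < ‖x‖ := hx
    exact lt_of_le_of_lt (Nat.cast_le.2 hmn : (m : ℝ) ≤ n) hx'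
  have h := tendsto_measure_iInter_atTop (μ := volume.withDensity (meanConnection (E := E) κ))
    (fun n : ℕ => (hA n).nullMeasurableSet) hanti ⟨0, ne_top_of_le_ne_top (b := ∫⁻ x : E,
      meanConnection κ x) hfin (by
        rw [withDensity_apply _ (hA _)]
        exact setLIntegral_le_lintegral _ _)⟩
  have hempty : ⋂ n : ℕ, {x : E | (n : ℝ) < ‖x‖} = ∅ := by
    refine Set.eq_empty_iff_forall_notMem.2 fun x hx => ?_
    obtain ⟨n, hn⟩ := exists_nat_ge ‖x‖
    exact absurd (Set.mem_iInter.1 hx n) (not_lt.2 hn)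
  rw [hempty, measure_empty] at h
  refine h.congr fun n => ?_
  rw [Function.comp_apply, withDensity_apply _ (hA _), longConnection]

lemma exists_radii [BorelSpace E] {κ : ℝ≥0 → I → I → I}
    (hfin : ∫⁻ x : E, meanConnection κ x ≠ ∞)
    (hball : ∀ ρ : ℝ, volume (Metric.closedBall (0 : E) ρ) ≠ ∞) (r : ℕ) {δ : ℝ≥0∞} (hδ : δ ≠ 0) :
    ∃ R : ℕ → ℝ, Monotone R ∧ (∀ j, 0 ≤ R j) ∧ ∑ j ∈ Finset.range r,
      (1 + volume (Metric.closedBall (0 : E) (R j))) *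
        longConnection E κ (R (j + 1) - R j) ≤ δ := by
  -- There are `r` summands; dividing by `r + 1` also covers `r = 0`.
  have hδ' : 0 < δ / (r + 1) := ENNReal.div_pos hδ (by finiteness)
  have hL : ∀ ρ : ℝ, ∃ n : ℕ, (1 + volume (Metric.closedBall (0 : E) ρ)) *
      longConnection E κ n ≤ δ / (r + 1) := by
    intro ρ
    have h := ENNReal.Tendsto.const_mul (a := 1 + volume (Metric.closedBall (0 : E) ρ))
      (tendsto_longConnection hfin) (Or.inr (ENNReal.add_ne_top.2 ⟨ENNReal.one_ne_top, hball ρ⟩))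
    rw [mul_zero] at h
    exact ((h.eventually_lt_const hδ').exists).imp fun n hn => hn.le
  choose L hL using hL
  -- The increment `L (R j)` is chosen after `R j`, so that the tail of the connection function
  -- beats the volume of the ball of radius `R j`.
  let R : ℕ → ℝ := fun j => Nat.rec 0 (fun _ ρ => ρ + L ρ) j
  have hsucc : ∀ j, R (j + 1) = R j + L (R j) := fun j => rfl
  have hmono : Monotone R := monotone_nat_of_le_succ fun j => by
    rw [hsucc]
    linarith [(Nat.cast_nonneg (L (R j)) : (0 : ℝ) ≤ _)]
  refine ⟨R, hmono, fun j => hmono (Nat.zero_le j), ?_⟩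
  calc _ ≤ ∑ j ∈ Finset.range r, δ / (r + 1) := by
        refine Finset.sum_le_sum fun j _ => ?_
        rw [hsucc, add_sub_cancel_left]
        exact hL (R j)
    _ = r * (δ / (r + 1)) := by simp
    _ ≤ (r + 1) * (δ / (r + 1)) := by gcongr; exact le_self_add
    _ = δ := ENNReal.mul_div_cancel (by simp) (by finiteness)

end RadiiChoice

/-! ### Integrability of the connection function. -/

section TailIntegral

lemma lintegral_meanConnection_ne_top {E : Type*} [NormedAddCommGroup E] [NormedSpace ℝ E]
    [FiniteDimensional ℝ E] [MeasureSpace E] [BorelSpace E]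
    [(volume : Measure E).IsAddHaarMeasure] {κ : ℝ≥0 → I → I → I}
    (hκ : Measurable fun q : ℝ≥0 × I × I => κ q.1 q.2.1 q.2.2) {α : ℝ}
    (hα : (Module.finrank ℝ E : ℝ) < α) {t₀ : ℝ≥0}
    (htail : ∀ t : ℝ≥0, t₀ < t → ∫ w : I × I, (κ t w.1 w.2 : ℝ) ≤ (t : ℝ) ^ (-α)) :
    ∫⁻ x : E, meanConnection κ x ≠ ∞ := by
  have hα0 : 0 < α := lt_of_le_of_lt (Nat.cast_nonneg _) hα
  -- With `T ≥ 1`, the function `(1 + T) ^ α * (1 + ‖x‖) ^ (-α)` dominates both the trivial bound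
  -- `1` for `‖x‖ ≤ T` and the power tail beyond, since `1 + ‖x‖ ≤ (1 + T) * ‖x‖` there. It is
  -- integrable because `α` exceeds the dimension.
  set T : ℝ := max t₀ 1
  have hT1 : 1 ≤ T := le_max_right _ _
  have hbound : ∀ x : E, meanConnection κ x ≤
      ENNReal.ofReal ((1 + T) ^ α * (1 + ‖x‖) ^ (-α)) := by
    intro x
    have hx : 0 < 1 + ‖x‖ := by positivity
    rcases le_or_gt ‖x‖ T with h | h
    · have h1 : meanConnection κ x ≤ 1 := by
        calc meanConnection κ x ≤ ∫⁻ w : I × I, 1 :=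
              lintegral_mono fun w => ENNReal.ofReal_le_one.2 (κ _ _ _).2.2
          _ = 1 := by simp
      refine h1.trans (ENNReal.one_le_ofReal.2 ?_)
      rw [Real.rpow_neg hx.le, ← div_eq_mul_inv, one_le_div (Real.rpow_pos_of_pos hx _)]
      exact Real.rpow_le_rpow hx.le (by linarith) hα0.le
    · have hxpos : 0 < ‖x‖ := by linarith
      have ht : t₀ < ‖x‖₊ := by
        have : (t₀ : ℝ) < ‖x‖ := lt_of_le_of_lt (le_max_left _ _) h
        exact_mod_cast this
      have hmeas : Measurable fun w : I × I => (κ ‖x‖₊ w.1 w.2 : ℝ) :=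
        measurable_subtype_coe.comp (hκ.comp (by fun_prop : Measurable fun w : I × I =>
          (‖x‖₊, w.1, w.2)))
      have h1 : meanConnection κ x = ENNReal.ofReal (∫ w : I × I, (κ ‖x‖₊ w.1 w.2 : ℝ)) := by
        rw [ofReal_integral_eq_lintegral_ofReal]
        · rfl
        · refine Integrable.of_bound hmeas.aestronglyMeasurable 1 (ae_of_all _ fun w => ?_)
          rw [Real.norm_of_nonneg (κ _ _ _).2.1]
          exact (κ _ _ _).2.2
        · exact ae_of_all _ fun w => (κ _ _ _).2.1
      rw [h1]
      refine ENNReal.ofReal_le_ofReal ((htail _ ht).trans ?_)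
      rw [coe_nnnorm, Real.rpow_neg hx.le, Real.rpow_neg hxpos.le, ← div_eq_mul_inv,
        ← Real.div_rpow (by positivity) hx.le, ← Real.inv_rpow hxpos.le]
      refine Real.rpow_le_rpow (by positivity) ?_ hα0.le
      rw [inv_eq_one_div, div_le_div_iff₀ hxpos hx]
      nlinarith
  have hint : Integrable (fun x : E => (1 + T) ^ α * (1 + ‖x‖) ^ (-α)) :=
    (integrable_one_add_norm hα).const_mul _
  exact ne_top_of_le_ne_top hint.lintegral_lt_top.ne (lintegral_mono hbound)

end TailIntegral

/-! ### Moment bounds for Poisson and for independent locations. -/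

section MomentBounds

variable {Ω V E : Type*} [MeasurableSpace Ω] {P : Measure Ω}
  [NormedAddCommGroup E] [MeasureSpace E] [BorelSpace E] [SecondCountableTopology E]
  [(volume : Measure E).IsAddRightInvariant]

/-- The root sits at the origin, so both bounds hold with equality, by the first and second
factorial moment measures and translation invariance. -/
lemma IsPoissonProcess.hasMomentBounds [SigmaFinite (volume : Measure E)] [IsProbabilityMeasure P]
    {Y : ℕ → Ω → E} (hY₀ : ∀ ω, Y 0 ω = 0)
    (hY : IsPoissonProcess P (fun i => Y (i + 1)) volume) : HasMomentBounds P Y 0 := by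
  let e : ℕ ≃ {v : ℕ // v ≠ 0} :=
    { toFun := fun k => ⟨k + 1, k.succ_ne_zero⟩
      invFun := fun v => v.1 - 1
      left_inv := fun k => by simp
      right_inv := fun v => Subtype.ext (Nat.succ_pred_eq_of_ne_zero v.2) }
  let e₂ : {p : ℕ × ℕ // p.1 ≠ p.2} ≃ {p : ℕ × ℕ // p.1 ≠ 0 ∧ p.2 ≠ 0 ∧ p.1 ≠ p.2} :=
    { toFun := fun p => ⟨(p.1.1 + 1, p.1.2 + 1), by simp, by simp, by simpa using p.2⟩
      invFun := fun p => ⟨(p.1.1 - 1, p.1.2 - 1), by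
        obtain ⟨⟨a, b⟩, h1, h2, h3⟩ := p
        simp only at h1 h2 h3 ⊢
        omega⟩
      left_inv := fun p => by simp
      right_inv := fun p => by
        obtain ⟨⟨a, b⟩, h1, h2, h3⟩ := p
        simp only at h1 h2 h3
        simp only [Subtype.mk.injEq, Prod.mk.injEq]
        omega }
  constructor
  · intro h hh
    rw [← e.tsum_eq, ← hY.sum_map, lintegral_sum_measure]
    refine le_of_eq (tsum_congr fun k => ?_)
    rw [lintegral_map hh (hY.measurable_point k)]
    simp [e, hY₀]
  · intro ρ h hh
    have hB : MeasurableSet (Metric.closedBall (0 : E) ρ) :=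
      Metric.isClosed_closedBall.measurableSet
    have hF : Measurable fun p : E × E =>
        (Metric.closedBall (0 : E) ρ).indicator (1 : E → ℝ≥0∞) p.1 * h (p.2 - p.1) :=
      ((measurable_one.indicator hB).comp measurable_fst).mul
        (hh.comp (measurable_snd.sub measurable_fst))
    rw [← e₂.tsum_eq]
    calc _ = ∑' p : {p : ℕ × ℕ // p.1 ≠ p.2}, ∫⁻ q : E × E,
          (Metric.closedBall (0 : E) ρ).indicator (1 : E → ℝ≥0∞) q.1 * h (q.2 - q.1)
            ∂(P.map fun ω => (Y (p.1.1 + 1) ω, Y (p.1.2 + 1) ω)) := by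
          refine tsum_congr fun p => ?_
          rw [lintegral_map hF ((hY.measurable_point _).prodMk (hY.measurable_point _))]
          simp [e₂, hY₀]
      _ = ∫⁻ x : E, ∫⁻ y : E,
          (Metric.closedBall (0 : E) ρ).indicator (1 : E → ℝ≥0∞) x * h (y - x) := by
          rw [← lintegral_sum_measure, hY.sum_map_pair, lintegral_prod _ hF.aemeasurable]
      _ ≤ _ := by
          refine le_of_eq ?_
          have hin : ∀ x : E, ∫⁻ y : E,
              (Metric.closedBall (0 : E) ρ).indicator (1 : E → ℝ≥0∞) x * h (y - x) =
              (Metric.closedBall (0 : E) ρ).indicator (1 : E → ℝ≥0∞) x * ∫⁻ y, h y := by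
            intro x
            have hm : Measurable fun y => h (y - x) := hh.comp (measurable_id.sub_const x)
            rw [lintegral_const_mul _ hm,
              lintegral_sub_right_eq_self h x]
          simp_rw [hin]
          rw [lintegral_mul_const _ (measurable_one.indicator hB), lintegral_indicator_one hB]

/-- Given `Z`, the variable `T` still has density at most `c`, and the shift by `p Z` does not
change the integral of `h`. -/
lemma lintegral_mul_sub_le_of_indepFun [IsProbabilityMeasure P] {A : Type*} [MeasurableSpace A]
    {Z : Ω → A} {T : Ω → E} (hZ : Measurable Z) (hT : Measurable T) (hind : IndepFun Z T P)
    {c : ℝ≥0∞} (hlaw : P.map T ≤ c • volume) {g : A → ℝ≥0∞} (hg : Measurable g) {h : E → ℝ≥0∞}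
    (hh : Measurable h) {p : A → E} (hp : Measurable p) :
    ∫⁻ ω, g (Z ω) * h (T ω - p (Z ω)) ∂P ≤ (∫⁻ ω, g (Z ω) ∂P) * (c * ∫⁻ x, h x) := by
  have hF : Measurable fun q : A × E => g q.1 * h (q.2 - p q.1) := by fun_prop
  have : IsProbabilityMeasure (P.map T) := Measure.isProbabilityMeasure_map hT.aemeasurable
  have hmap := (indepFun_iff_map_prod_eq_prod_map_map hZ.aemeasurable hT.aemeasurable).1 hind
  calc _ = ∫⁻ q, g q.1 * h (q.2 - p q.1) ∂(P.map fun ω => (Z ω, T ω)) :=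
        (lintegral_map hF (hZ.prodMk hT)).symm
    _ = ∫⁻ z, ∫⁻ x, g z * h (x - p z) ∂(P.map T) ∂(P.map Z) := by
        rw [hmap, lintegral_prod _ hF.aemeasurable]
    _ ≤ ∫⁻ z, g z * (c * ∫⁻ x, h x) ∂(P.map Z) := by
        refine lintegral_mono fun z => ?_
        have hm : Measurable fun x => h (x - p z) := hh.comp (measurable_id.sub_const _)
        rw [lintegral_const_mul _ hm]
        refine mul_le_mul_right ((lintegral_mono' hlaw le_rfl).trans ?_) _
        rw [lintegral_smul_measure, lintegral_sub_right_eq_self h (p z), smul_eq_mul]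
    _ = _ := by
        rw [lintegral_mul_const _ hg, lintegral_map hg hZ]

/-- At most `|V|` vertices, respectively `|V| ^ 2` pairs, each contribute one, respectively two,
factors `c`. The assumption on `|V| * c` absorbs these uniformly in the size of the model. -/
lemma hasMomentBounds_of_iIndepFun [Fintype V] [IsProbabilityMeasure P] {Y : V → Ω → E}
    (hY : ∀ v, Measurable (Y v)) (hind : iIndepFun Y P) {c : ℝ≥0∞}
    (hlaw : ∀ v, P.map (Y v) ≤ c • volume) (hc : Fintype.card V * c ≤ 1) (i : V) :
    HasMomentBounds P Y i := by
  classical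
  have hone : ∀ v, v ≠ i → ∀ h : E → ℝ≥0∞, Measurable h →
      ∫⁻ ω, h (Y v ω - Y i ω) ∂P ≤ c * ∫⁻ x, h x := by
    intro v hv h hh
    have := lintegral_mul_sub_le_of_indepFun (hY i) (hY v) (hind.indepFun hv.symm) (hlaw v)
      (measurable_one (α := ℝ≥0∞)) hh measurable_id
    simpa using this
  constructor
  · intro h hh
    rw [tsum_fintype]
    calc _ ≤ ∑ _v : {v : V // v ≠ i}, c * ∫⁻ x, h x :=
          Finset.sum_le_sum fun v _ => hone v v.2 h hh
      _ = (Fintype.card {v : V // v ≠ i} : ℝ≥0∞) * c * ∫⁻ x, h x := by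
          simp [mul_assoc]
      _ ≤ 1 * ∫⁻ x, h x := by
          gcongr
          refine le_trans ?_ hc
          gcongr
          exact Fintype.card_subtype_le _
      _ = _ := one_mul _
  · intro ρ h hh
    have hB : MeasurableSet (Metric.closedBall (0 : E) ρ) :=
      Metric.isClosed_closedBall.measurableSet
    have hpair : ∀ p : {p : V × V // p.1 ≠ i ∧ p.2 ≠ i ∧ p.1 ≠ p.2},
        ∫⁻ ω, (Metric.closedBall (0 : E) ρ).indicator 1 (Y p.1.1 ω - Y i ω) *
          h (Y p.1.2 ω - Y p.1.1 ω) ∂P ≤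
        (c * volume (Metric.closedBall (0 : E) ρ)) * (c * ∫⁻ x, h x) := by
      rintro ⟨⟨u, v⟩, hu, hv, huv⟩
      have h1 := lintegral_mul_sub_le_of_indepFun ((hY i).prodMk (hY u)) (hY v)
        (hind.indepFun_prodMk hY i u v hv.symm huv) (hlaw v)
        (g := fun q => (Metric.closedBall (0 : E) ρ).indicator 1 (q.2 - q.1))
        ((measurable_one.indicator hB).comp (measurable_snd.sub measurable_fst)) hh
        measurable_snd
      refine h1.trans (mul_le_mul_left ?_ _)
      refine (hone u hu _ (measurable_one.indicator hB)).trans ?_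
      rw [lintegral_indicator_one hB]
    rw [tsum_fintype]
    calc _ ≤ ∑ _p : {p : V × V // p.1 ≠ i ∧ p.2 ≠ i ∧ p.1 ≠ p.2},
          (c * volume (Metric.closedBall (0 : E) ρ)) * (c * ∫⁻ x, h x) :=
          Finset.sum_le_sum fun p _ => hpair p
      _ = (Fintype.card {p : V × V // p.1 ≠ i ∧ p.2 ≠ i ∧ p.1 ≠ p.2} : ℝ≥0∞) *
          ((c * volume (Metric.closedBall (0 : E) ρ)) * (c * ∫⁻ x, h x)) := by simp
      _ ≤ (Fintype.card V * Fintype.card V : ℝ≥0∞) *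
          ((c * volume (Metric.closedBall (0 : E) ρ)) * (c * ∫⁻ x, h x)) := by
          gcongr
          have := Fintype.card_subtype_le fun p : V × V => p.1 ≠ i ∧ p.2 ≠ i ∧ p.1 ≠ p.2
          rw [Fintype.card_prod] at this
          exact_mod_cast this
      _ = (Fintype.card V * c) * (Fintype.card V * c) *
          (volume (Metric.closedBall (0 : E) ρ) * ∫⁻ x, h x) := by ring
      _ ≤ 1 * 1 * (volume (Metric.closedBall (0 : E) ρ) * ∫⁻ x, h x) := by gcongr
      _ = _ := by rw [one_mul, one_mul]

end MomentBounds

/-! ### The blown-up box, its boundary layer, and good root pairs. -/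

section ScaledBox

open scoped Pointwise

lemma measurableSet_forall_abs_le (d : ℕ) (a : ℝ) :
    MeasurableSet {x : EuclideanSpace ℝ (Fin d) | ∀ k, |x k| ≤ a} := by
  refine measurableSet_ofPred_forall fun k => ?_
  have : Measurable fun x : EuclideanSpace ℝ (Fin d) => |x k| := by fun_prop
  exact measurableSet_le this measurable_const

lemma smul_unitBox (d : ℕ) {s : ℝ} (hs : 0 < s) :
    s • unitBox d = {x : EuclideanSpace ℝ (Fin d) | ∀ k, |x k| ≤ s / 2} := by
  ext x
  rw [Set.mem_smul_set_iff_inv_smul_mem₀ hs.ne']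
  simp only [unitBox, Set.mem_ofPred_eq, ← abs_le, PiLp.smul_apply, smul_eq_mul, Set.mem_Icc,
    abs_mul, abs_inv, abs_of_pos hs]
  refine forall_congr' fun k => ?_
  rw [inv_mul_le_iff₀ hs]
  ring_nf

lemma volume_unitBox (d : ℕ) : volume (unitBox d) = 1 := by
  have h : unitBox d = (WithLp.ofLp : EuclideanSpace ℝ (Fin d) → Fin d → ℝ) ⁻¹'
      Set.Icc (fun _ => -(1 / 2)) (fun _ => 1 / 2) := by
    ext x
    simp [unitBox, Pi.le_def, forall_and]
  rw [h, (PiLp.volume_preserving_ofLp (Fin d)).measure_preimage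
    measurableSet_Icc.nullMeasurableSet, Real.volume_Icc_pi]
  norm_num

lemma map_smul_restrict {E : Type*} [NormedAddCommGroup E] [NormedSpace ℝ E]
    [FiniteDimensional ℝ E] [MeasurableSpace E] [BorelSpace E] (μ : Measure E)
    [μ.IsAddHaarMeasure] {s : ℝ} (hs : s ≠ 0) {S : Set E} (hS : MeasurableSet (s • S)) :
    (μ.restrict S).map (fun x => s • x) =
      ENNReal.ofReal |(s ^ Module.finrank ℝ E)⁻¹| • μ.restrict (s • S) := by
  have hpre : (fun x : E => s • x) ⁻¹' (s • S) = S := by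
    ext x
    simp [Set.smul_mem_smul_set_iff₀ hs]
  have h := Measure.restrict_map (μ := μ) (measurable_const_smul s) hS
  rw [hpre] at h
  rw [← h, ← Measure.restrict_smul]
  exact congrArg (fun ν : Measure E => ν.restrict (s • S)) (Measure.map_addHaar_smul μ hs)

lemma map_smul_uniformLocation {Ω : Type*} [MeasurableSpace Ω] {P : Measure Ω} {d : ℕ} (hd : 0 < d)
    {X : Ω → EuclideanSpace ℝ (Fin d)} (hX : Measurable X)
    (hlaw : P.map X = volume.restrict (unitBox d)) {n : ℕ} (hn : n ≠ 0) :
    P.map (fun ω => ((n : ℝ) ^ (1 / (d : ℝ))) • X ω) =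
      (n : ℝ≥0∞)⁻¹ • volume.restrict (((n : ℝ) ^ (1 / (d : ℝ))) • unitBox d) := by
  have hn0 : (0 : ℝ) < n := Nat.cast_pos.2 (Nat.pos_of_ne_zero hn)
  have hs : (0 : ℝ) < (n : ℝ) ^ (1 / (d : ℝ)) := Real.rpow_pos_of_pos hn0 _
  have hpow : ((n : ℝ) ^ (1 / (d : ℝ))) ^ d = n := by
    rw [one_div, Real.rpow_inv_natCast_pow hn0.le hd.ne']
  have h := Measure.map_map (μ := P) (measurable_const_smul ((n : ℝ) ^ (1 / (d : ℝ)))) hX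
  change P.map ((fun x => ((n : ℝ) ^ (1 / (d : ℝ))) • x) ∘ X) = _
  rw [← h, hlaw, map_smul_restrict volume hs.ne'
    (by rw [smul_unitBox d hs]; exact measurableSet_forall_abs_le d _), finrank_euclideanSpace_fin,
    hpow, abs_of_pos (inv_pos.2 hn0), ENNReal.ofReal_inv_of_pos hn0, ENNReal.ofReal_natCast]

lemma closedBall_subset_forall_abs_le {d : ℕ} {a R : ℝ} {x : EuclideanSpace ℝ (Fin d)}
    (hx : ∀ k, |x k| ≤ a - R) : Metric.closedBall x R ⊆ {y | ∀ k, |y k| ≤ a} := by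
  intro y hy k
  rw [Metric.mem_closedBall, dist_eq_norm] at hy
  have h1 := PiLp.norm_apply_le (y - x) k
  rw [Real.norm_eq_abs, PiLp.sub_apply] at h1
  have h2 := abs_sub_abs_le_abs_sub (y k) (x k)
  linarith [hx k]

/-- Given the first root, the second lies within `2 * R` of it with probability at most `c` times
the volume of a ball. -/
lemma sub_le_measure_goodPairs {E : Type*} [NormedAddCommGroup E] [MeasureSpace E] [BorelSpace E]
    [SecondCountableTopology E] [(volume : Measure E).IsAddLeftInvariant] (ν : Measure E)
    [IsProbabilityMeasure ν] {c : ℝ≥0∞} (hν : ν ≤ c • volume) (R : ℝ) (S' : Set E) :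
    ν S' * ν S' - c * volume (Metric.closedBall (0 : E) (2 * R)) ≤
      (ν.prod ν) (goodPairs R S') := by
  rw [tsub_le_iff_right]
  have hclose : MeasurableSet {p : E × E | dist p.2 p.1 ≤ 2 * R} :=
    measurableSet_le (measurable_snd.dist measurable_fst) measurable_const
  calc ν S' * ν S' = (ν.prod ν) (S' ×ˢ S') := (Measure.prod_prod _ _).symm
    _ ≤ (ν.prod ν) (goodPairs R S' ∪ {p : E × E | dist p.2 p.1 ≤ 2 * R}) := by
        refine measure_mono fun p hp => ?_
        by_cases h : dist p.2 p.1 ≤ 2 * R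
        · exact Or.inr h
        · exact Or.inl ⟨hp.1, hp.2, by rw [dist_comm]; exact not_le.1 h⟩
    _ ≤ _ := measure_union_le _ _
    _ ≤ _ := by
        gcongr
        rw [Measure.prod_apply hclose]
        calc _ ≤ ∫⁻ _x, c * volume (Metric.closedBall (0 : E) (2 * R)) ∂ν := by
              refine lintegral_mono fun x => ?_
              refine (hν _).trans ?_
              rw [Measure.smul_apply, smul_eq_mul]
              refine mul_le_mul_right ?_ _
              have := measure_preimage_add volume (-x) (Metric.closedBall (0 : E) (2 * R))
              rw [← this]
              refine measure_mono fun y hy => ?_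
              have hy' : dist y x ≤ 2 * R := hy
              simpa [dist_eq_norm, neg_add_eq_sub] using hy'
          _ = _ := by simp

/-- The layer of width `R` along the boundary is negligible: `((s - 2 * R) / s) ^ d` tends to one as
the side length `s` grows. -/
lemma tendsto_innerBox {d : ℕ} (hd : 0 < d) (R : ℝ) :
    Tendsto (fun n : ℕ => (n : ℝ≥0∞)⁻¹ * volume {x : EuclideanSpace ℝ (Fin d) |
      ∀ k, |x k| ≤ (n : ℝ) ^ (1 / (d : ℝ)) / 2 - R}) atTop (𝓝 1) := by
  have hs : Tendsto (fun n : ℕ => (n : ℝ) ^ (1 / (d : ℝ))) atTop atTop :=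
    (tendsto_rpow_atTop (by positivity)).comp tendsto_natCast_atTop_atTop
  have h1 : Tendsto (fun n : ℕ => ENNReal.ofReal
      ((1 - 2 * R * ((n : ℝ) ^ (1 / (d : ℝ)))⁻¹) ^ d)) atTop (𝓝 1) := by
    have h : Tendsto (fun n : ℕ => (1 - 2 * R * ((n : ℝ) ^ (1 / (d : ℝ)))⁻¹) ^ d) atTop
        (𝓝 ((1 - 2 * R * 0) ^ d)) :=
      (tendsto_const_nhds.sub (hs.inv_tendsto_atTop.const_mul (2 * R))).pow d
    have := ENNReal.tendsto_ofReal h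
    simpa using this
  refine h1.congr' ?_
  filter_upwards [hs.eventually_gt_atTop (2 * R), eventually_gt_atTop 0] with n hn hn0
  have hn0' : (0 : ℝ) < n := Nat.cast_pos.2 hn0
  have hspos : (0 : ℝ) < (n : ℝ) ^ (1 / (d : ℝ)) := Real.rpow_pos_of_pos hn0' _
  have hpow : ((n : ℝ) ^ (1 / (d : ℝ))) ^ d = n := by
    rw [one_div, Real.rpow_inv_natCast_pow hn0'.le hd.ne']
  set s := (n : ℝ) ^ (1 / (d : ℝ))
  have hbox : {x : EuclideanSpace ℝ (Fin d) | ∀ k, |x k| ≤ s / 2 - R} =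
    (s - 2 * R) • unitBox d := by
    rw [smul_unitBox d (sub_pos.2 hn)]
    have h2 : (s - 2 * R) / 2 = s / 2 - R := by ring
    ext x
    exact forall_congr' fun k => by rw [← h2]
  have hnonneg : 0 ≤ (s - 2 * R) ^ d := pow_nonneg (sub_pos.2 hn).le d
  rw [hbox, Measure.addHaar_smul, volume_unitBox, mul_one, finrank_euclideanSpace_fin,
    abs_of_nonneg hnonneg, ← ENNReal.ofReal_natCast n, ← ENNReal.ofReal_inv_of_pos hn0',
    ← ENNReal.ofReal_mul (by positivity), ← hpow, ← inv_pow, ← mul_pow]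
  congr 2
  field_simp

end ScaledBox

/-! ### Two numerical limits. -/

section ScalarLimits

lemma tendsto_descFactorial_sub_two (k : ℕ) :
    Tendsto (fun n : ℕ => ((n - 2).descFactorial k : ℝ≥0∞) * (n : ℝ≥0∞)⁻¹ ^ k) atTop (𝓝 1) := by
  have h1 : Tendsto (fun n : ℕ => (((n - 2 : ℕ) : ℝ) / n)) atTop (𝓝 1) := by
    have h : Tendsto (fun n : ℕ => 1 - 2 * (n : ℝ)⁻¹) atTop (𝓝 (1 - 2 * 0)) :=
      tendsto_const_nhds.sub
        ((tendsto_inv_atTop_zero.comp tendsto_natCast_atTop_atTop).const_mul 2)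
    rw [mul_zero, sub_zero] at h
    refine h.congr' ?_
    filter_upwards [eventually_ge_atTop 2] with n hn
    have : (n : ℝ) ≠ 0 := by positivity
    rw [Nat.cast_sub hn]
    field_simp
    simp
  have h2 : Tendsto (fun n : ℕ => (n.descFactorial k : ℝ) / (n : ℝ) ^ k) atTop (𝓝 1) :=
    (Asymptotics.isEquivalent_iff_tendsto_one (by
      filter_upwards [eventually_gt_atTop 0] with n hn
      positivity)).1 (isEquivalent_descFactorial k)
  have h3 := (h2.comp (tendsto_sub_atTop_nat 2)).mul (h1.pow k)
  have h4 := ENNReal.tendsto_ofReal h3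
  rw [one_pow, mul_one, ENNReal.ofReal_one] at h4
  refine h4.congr' ?_
  filter_upwards [eventually_gt_atTop 2] with n hn
  have hn0 : (0 : ℝ) < n := by positivity
  have hn2 : (0 : ℝ) < ((n - 2 : ℕ) : ℝ) := Nat.cast_pos.2 (by omega)
  rw [← ENNReal.ofReal_natCast n, ← ENNReal.ofReal_natCast ((n - 2).descFactorial k),
    ← ENNReal.ofReal_inv_of_pos hn0, ← ENNReal.ofReal_pow (by positivity),
    ← ENNReal.ofReal_mul (by positivity)]
  congr 1
  simp only [Function.comp_apply]
  field_simp
  rw [div_pow, div_pow, one_pow]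
  ring

/-- The limit is written as a square so as to match the two void probabilities of independent
Poisson neighbourhoods. -/
lemma tendsto_one_sub_mul_inv_pow {b : ℝ≥0∞} (hb : b ≠ ∞) :
    Tendsto (fun n : ℕ => (1 - 2 * ((n : ℝ≥0∞)⁻¹ * b)) ^ n) atTop
      (𝓝 (ENNReal.ofReal (Real.exp (-b.toReal)) * ENNReal.ofReal (Real.exp (-b.toReal)))) := by
  have h := ENNReal.tendsto_ofReal (Real.tendsto_one_add_div_pow_exp (-(2 * b.toReal)))
  rw [← ENNReal.ofReal_mul (by positivity), ← Real.exp_add]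
  rw [show -b.toReal + -b.toReal = -(2 * b.toReal) by ring]
  refine h.congr' ?_
  -- For these `n` the truncated difference agrees with the real one.
  filter_upwards [eventually_gt_atTop 0, eventually_ge_atTop ⌈2 * b.toReal⌉₊] with n hn hn'
  have hn0 : (0 : ℝ) < n := Nat.cast_pos.2 hn
  have hle : 2 * b.toReal / n ≤ 1 := by
    rw [div_le_one hn0]
    exact Nat.ceil_le.1 hn'
  rw [ENNReal.ofReal_pow (by rw [neg_div]; linarith)]
  congr 1
  rw [neg_div, ← sub_eq_add_neg, ENNReal.ofReal_sub _ (by positivity), ENNReal.ofReal_one,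
    ENNReal.ofReal_div_of_pos hn0, ENNReal.ofReal_mul (by norm_num), ENNReal.ofReal_toReal hb,
    ENNReal.ofReal_natCast, ENNReal.div_eq_inv_mul]
  congr 1
  rw [ENNReal.ofReal_ofNat]
  ring

end ScalarLimits

/-! ### The rescaled finite model satisfies the abstract assumptions. -/

section FiniteModel

lemma smul_restrict_le_smul {α : Type*} [MeasurableSpace α] (μ : Measure α) (c : ℝ≥0∞) (S : Set α) :
    c • μ.restrict S ≤ c • μ := fun A => by
  rw [Measure.smul_apply, Measure.smul_apply]
  exact mul_le_mul_right (Measure.restrict_le_self A) c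

/-- Locations in the unit box, blown up to the box of volume `n`. -/
noncomputable abbrev scaledLocations {Ω V : Type*} {d : ℕ} (n : ℕ)
    (X : V → Ω → EuclideanSpace ℝ (Fin d)) : V → Ω → EuclideanSpace ℝ (Fin d) :=
  fun i ω => ((n : ℝ) ^ (1 / (d : ℝ))) • X i ω

variable {Ω V : Type*} [MeasurableSpace Ω] {P : Measure Ω} {d : ℕ}
  {X : V → Ω → EuclideanSpace ℝ (Fin d)} {W : V → Ω → I}

lemma IsUniformWeights.scaledLocations (hW : IsUniformWeights P W X) (n : ℕ) :
    IsUniformWeights P W (scaledLocations n X) where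
  measurable := hW.measurable
  law := hW.law
  indep := hW.indep
  indep_location := by
    have hm : Measurable fun (x : V → EuclideanSpace ℝ (Fin d)) i =>
        ((n : ℝ) ^ (1 / (d : ℝ))) • x i := by fun_prop
    exact hW.indep_location.comp hm measurable_id

lemma IsUniformLocations.iIndepFun_scaledLocations (hX : IsUniformLocations P X) (n : ℕ) :
    iIndepFun (scaledLocations n X) P :=
  hX.indep.comp (fun _ x => ((n : ℝ) ^ (1 / (d : ℝ))) • x) fun _ => measurable_const_smul _

lemma IsUniformLocations.map_scaledLocations_le (hX : IsUniformLocations P X) (hd : 0 < d) {n : ℕ}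
    (hn : n ≠ 0) (v : V) : P.map (scaledLocations n X v) ≤ (n : ℝ≥0∞)⁻¹ • volume := by
  rw [map_smul_uniformLocation hd (hX.measurable v) (hX.law v) hn]
  exact smul_restrict_le_smul _ _ _

lemma IsUniformLocations.hasMomentBounds [IsProbabilityMeasure P] {n : ℕ}
    {X : Fin n → Ω → EuclideanSpace ℝ (Fin d)} (hX : IsUniformLocations P X) (hd : 0 < d)
    (i : Fin n) : HasMomentBounds P (scaledLocations n X) i := by
  have hn : n ≠ 0 := (Fin.pos i).ne'
  refine hasMomentBounds_of_iIndepFun (Y := scaledLocations n X)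
    (fun v => (hX.measurable v).const_smul ((n : ℝ) ^ (1 / (d : ℝ))))
    (hX.iIndepFun_scaledLocations n) (fun v => hX.map_scaledLocations_le hd hn v) ?_ i
  rw [Fintype.card_fin, ENNReal.mul_inv_cancel (by simpa using hn) (by simp)]

end FiniteModel

/-! ### Asymptotic lower bound for two local events. -/

section LocalLimit

variable {d : ℕ} {κ : ℝ≥0 → I → I → I} {Ω : ℕ → Type*} [∀ n, MeasurableSpace (Ω n)]
  {P : ∀ n, Measure (Ω n)} [∀ n, IsProbabilityMeasure (P n)]
  {X : ∀ n, Fin n → Ω n → EuclideanSpace ℝ (Fin d)} {W : ∀ n, Fin n → Ω n → I}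
  {G : ∀ n, Ω n → SimpleGraph (Fin n)}
  {Ω' : Type*} [MeasurableSpace Ω'] {Q : Measure Ω'} [IsProbabilityMeasure Q]
  {Y : ℕ → Ω' → EuclideanSpace ℝ (Fin d)} {W' : ℕ → Ω' → I} {G' : Ω' → SimpleGraph ℕ}

/-- Two distinct vertices of a large finite model see, asymptotically, at least independent copies
of the neighbourhood of the origin in the infinite model. -/
lemma eventually_le_measure_localEvent_inter (hd : 0 < d)
    (hκ : Measurable fun q : ℝ≥0 × I × I => κ q.1 q.2.1 q.2.2)
    (hsymm : ∀ t x y, κ t x y = κ t y x)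
    (hX : ∀ n, IsUniformLocations (P n) (X n)) (hW : ∀ n, IsUniformWeights (P n) (W n) (X n))
    (hG : ∀ n, IsSIRG (P n) (scaledLocations n (X n)) (W n) κ (G n))
    (hY₀ : ∀ ω, Y 0 ω = 0) (hY : IsPoissonProcess Q (fun i => Y (i + 1)) volume)
    (hW' : IsUniformWeights Q W' Y) (hG' : IsSIRG Q Y W' κ G') {R : ℝ} (hR : 0 ≤ R) {m₁ m₂ : ℕ}
    {D₁ : Set (SimpleGraph (Fin (m₁ + 1)))} (hD₁ : RelabelInvariant D₁)
    {D₂ : Set (SimpleGraph (Fin (m₂ + 1)))} (hD₂ : RelabelInvariant D₂) {q : ℝ≥0∞}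
    (hq : q < Q (localEvent Y G' R 0 D₁) * Q (localEvent Y G' R 0 D₂)) :
    ∀ᶠ n in atTop, ∀ i j : Fin n, i ≠ j →
      q ≤ P n (localEvent (scaledLocations n (X n)) (G n) R i D₁ ∩
        localEvent (scaledLocations n (X n)) (G n) R j D₂) := by
  set b := volume (Metric.closedBall (0 : EuclideanSpace ℝ (Fin d)) R) with hbdef
  set b₂ := volume (Metric.closedBall (0 : EuclideanSpace ℝ (Fin d)) (2 * R))
  have hb : b ≠ ∞ := measure_closedBall_lt_top.ne
  have hb₂ : b₂ ≠ ∞ := measure_closedBall_lt_top.ne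
  set I₁ := ballIntegral (E := EuclideanSpace ℝ (Fin d)) κ R D₁
  set I₂ := ballIntegral (E := EuclideanSpace ℝ (Fin d)) κ R D₂
  set e := ENNReal.ofReal (Real.exp (-b.toReal)) with hedef
  have hfac : ∀ m : ℕ, (m.factorial : ℝ≥0∞) ≠ 0 := fun m => by
    exact_mod_cast m.factorial_ne_zero
  have hfac' : (m₁.factorial : ℝ≥0∞) * m₂.factorial ≠ 0 := mul_ne_zero (hfac _) (hfac _)
  have hfac'' : (m₁.factorial : ℝ≥0∞) * m₂.factorial ≠ ∞ :=
    ENNReal.mul_ne_top (ENNReal.natCast_ne_top _) (ENNReal.natCast_ne_top _)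
  have he : e ≠ 0 := by
    rw [hedef]
    simpa using Real.exp_pos _
  -- The upper bound in the Poisson model puts `m₁! * m₂! * q` strictly below the limit of the lower
  -- bounds for the finite models. Those bounds do not depend on `i` and `j`, so the conclusion is
  -- uniform in the pair.
  have hq' : (m₁.factorial : ℝ≥0∞) * m₂.factorial * q < 1 * 1 * (e * e) * (I₁ * I₂) := by
    refine lt_of_lt_of_le (ENNReal.mul_lt_mul_right hfac' hfac'' hq) ?_
    calc _ = (m₁.factorial * Q (localEvent Y G' R 0 D₁)) *
          (m₂.factorial * Q (localEvent Y G' R 0 D₂)) := by ring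
      _ ≤ (e * I₁) * (e * I₂) := by
          exact mul_le_mul'
            (hG'.factorial_mul_measure_localEvent_le hκ hsymm hW' hY₀ hY R hb hD₁)
            (hG'.factorial_mul_measure_localEvent_le hκ hsymm hW' hY₀ hY R hb hD₂)
      _ = _ := by ring
  let inner : ℕ → ℝ≥0∞ := fun n => (n : ℝ≥0∞)⁻¹ * volume {x : EuclideanSpace ℝ (Fin d) |
      ∀ k, |x k| ≤ (n : ℝ) ^ (1 / (d : ℝ)) / 2 - R}
  have hinner : Tendsto (fun n => inner n * inner n - (n : ℝ≥0∞)⁻¹ * b₂) atTop (𝓝 1) := by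
    have h1 := tendsto_innerBox hd R
    have h2 := ENNReal.Tendsto.mul h1 (Or.inl one_ne_zero) h1 (Or.inl one_ne_zero)
    have h3 : Tendsto (fun n : ℕ => (n : ℝ≥0∞)⁻¹ * b₂) atTop (𝓝 (0 * b₂)) :=
      ENNReal.Tendsto.mul_const ENNReal.tendsto_inv_nat_nhds_zero (Or.inr hb₂)
    have h4 := ENNReal.Tendsto.sub h2 h3 (Or.inl (by simp))
    rwa [mul_one, zero_mul, tsub_zero] at h4
  have hlim : Tendsto (fun n : ℕ => (((n - 2).descFactorial (m₁ + m₂) : ℝ≥0∞) *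
      (n : ℝ≥0∞)⁻¹ ^ (m₁ + m₂)) * (inner n * inner n - (n : ℝ≥0∞)⁻¹ * b₂) *
      (1 - 2 * ((n : ℝ≥0∞)⁻¹ * b)) ^ n * (I₁ * I₂)) atTop (𝓝 (1 * 1 * (e * e) * (I₁ * I₂))) := by
    refine ENNReal.Tendsto.mul_const (ENNReal.Tendsto.mul (ENNReal.Tendsto.mul
      (tendsto_descFactorial_sub_two _) (Or.inl one_ne_zero) hinner (Or.inl one_ne_zero))
      (Or.inl (by simp)) (tendsto_one_sub_mul_inv_pow hb) (Or.inr (by simp))) (Or.inl ?_)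
    simpa using he
  filter_upwards [hlim.eventually_const_lt hq', eventually_gt_atTop 0] with n hn hn0 i j hij
  have hs : (0 : ℝ) < (n : ℝ) ^ (1 / (d : ℝ)) := Real.rpow_pos_of_pos (Nat.cast_pos.2 hn0) _
  set s := (n : ℝ) ^ (1 / (d : ℝ))
  let S : Set (EuclideanSpace ℝ (Fin d)) := {x | ∀ k, |x k| ≤ s / 2}
  let S' : Set (EuclideanSpace ℝ (Fin d)) := {x | ∀ k, |x k| ≤ s / 2 - R}
  have hSS' : S' ⊆ S := fun x hx k => (hx k).trans (sub_le_self _ hR)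
  have hlaw : ∀ v, (P n).map (scaledLocations n (X n) v) =
      (n : ℝ≥0∞)⁻¹ • volume.restrict S := by
    intro v
    rw [map_smul_uniformLocation hd ((hX n).measurable v) ((hX n).law v) hn0.ne',
      smul_unitBox d hs]
  have hprob : IsProbabilityMeasure ((n : ℝ≥0∞)⁻¹ •
      (volume : Measure (EuclideanSpace ℝ (Fin d))).restrict S) := by
    rw [← hlaw i]
    exact Measure.isProbabilityMeasure_map ((hG n).measurable_location i).aemeasurable
  have hmain := (hG n).le_measure_localEvent_inter hκ hsymm ((hW n).scaledLocations n)
    ((hX n).iIndepFun_scaledLocations n) (c := (n : ℝ≥0∞)⁻¹)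
    hlaw (measurableSet_forall_abs_le d (s / 2 - R))
    (fun x hx => closedBall_subset_forall_abs_le hx) hij D₁ D₂
  have hgood := sub_le_measure_goodPairs ((n : ℝ≥0∞)⁻¹ •
      (volume : Measure (EuclideanSpace ℝ (Fin d))).restrict S) (c := (n : ℝ≥0∞)⁻¹)
      (smul_restrict_le_smul _ _ _) R S'
  have hinner' : ((n : ℝ≥0∞)⁻¹ • (volume : Measure (EuclideanSpace ℝ (Fin d))).restrict S) S' =
      inner n := by
    rw [Measure.smul_apply, Measure.restrict_eq_self _ hSS', smul_eq_mul]
  rw [hinner'] at hgood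
  rw [Fintype.card_fin] at hmain
  have hfinal := calc
    (m₁.factorial : ℝ≥0∞) * m₂.factorial * q ≤ _ := hn.le
    _ ≤ ((n - 2).descFactorial (m₁ + m₂) : ℝ≥0∞) * (n : ℝ≥0∞)⁻¹ ^ (m₁ + m₂) *
        (((n : ℝ≥0∞)⁻¹ • (volume : Measure (EuclideanSpace ℝ (Fin d))).restrict S).prod
          ((n : ℝ≥0∞)⁻¹ • (volume : Measure (EuclideanSpace ℝ (Fin d))).restrict S))
          (goodPairs R S') * (1 - 2 * ((n : ℝ≥0∞)⁻¹ * b)) ^ n * (I₁ * I₂) := by gcongr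
    _ = _ := by rw [pow_add]; ring
    _ ≤ _ := hmain
  exact (ENNReal.mul_le_mul_iff_right hfac' hfac'').1 hfinal

end LocalLimit

/-! ### Chebyshev's inequality from one-sided bounds. -/

section SecondMoment

variable {Ω : Type*} [MeasurableSpace Ω] {P : Measure Ω} [IsProbabilityMeasure P]

/-- The four cells have total probability one, and so do their targets `q * q`, `q * (1 - q)`
(twice) and `(1 - q) * (1 - q)`. Hence being at most `δ` below every target forbids being more than
`3 * δ` above any. At the targets the integral vanishes. -/
lemma integral_centered_mul_le {A B : Set Ω} (hA : MeasurableSet A) (hB : MeasurableSet B)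
    {q δ : ℝ} (hq0 : 0 ≤ q) (hq1 : q ≤ 1)
    (h11 : q * q ≤ P.real (A ∩ B) + δ) (h10 : q * (1 - q) ≤ P.real (A \ B) + δ)
    (h01 : q * (1 - q) ≤ P.real (B \ A) + δ)
    (h00 : (1 - q) * (1 - q) ≤ P.real (Aᶜ ∩ Bᶜ) + δ) :
    ∫ ω, (A.indicator (1 : Ω → ℝ) ω - q) * (B.indicator (1 : Ω → ℝ) ω - q) ∂P ≤ 3 * δ := by
  have hAi : Integrable (A.indicator (1 : Ω → ℝ)) P := (integrable_const (1 : ℝ)).indicator hA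
  have hBi : Integrable (B.indicator (1 : Ω → ℝ)) P := (integrable_const (1 : ℝ)).indicator hB
  have hABi : Integrable ((A ∩ B).indicator (1 : Ω → ℝ)) P :=
    (integrable_const (1 : ℝ)).indicator (hA.inter hB)
  have hexp : ∀ ω, (A.indicator (1 : Ω → ℝ) ω - q) * (B.indicator (1 : Ω → ℝ) ω - q) =
      (A ∩ B).indicator (1 : Ω → ℝ) ω - q * A.indicator (1 : Ω → ℝ) ω -
        q * B.indicator (1 : Ω → ℝ) ω + q * q := by
    intro ω
    rw [Set.inter_indicator_one, Pi.mul_apply]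
    ring
  have hint : ∫ ω, (A.indicator (1 : Ω → ℝ) ω - q) * (B.indicator (1 : Ω → ℝ) ω - q) ∂P =
      P.real (A ∩ B) - q * P.real A - q * P.real B + q * q := by
    simp_rw [hexp]
    have h1 : Integrable (fun ω => (A ∩ B).indicator (1 : Ω → ℝ) ω -
        q * A.indicator (1 : Ω → ℝ) ω) P := hABi.sub (hAi.const_mul q)
    have h2 : Integrable (fun ω => (A ∩ B).indicator (1 : Ω → ℝ) ω -
        q * A.indicator (1 : Ω → ℝ) ω - q * B.indicator (1 : Ω → ℝ) ω) P :=
      h1.sub (hBi.const_mul q)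
    rw [integral_add h2 (integrable_const _), integral_sub h1 (hBi.const_mul q),
      integral_sub hABi (hAi.const_mul q), integral_const_mul, integral_const_mul,
      integral_indicator_one hA, integral_indicator_one hB, integral_indicator_one (hA.inter hB)]
    simp
  have hPA : P.real (A ∩ B) + P.real (A \ B) = P.real A := measureReal_inter_add_sdiff hB
  have hPB : P.real (A ∩ B) + P.real (B \ A) = P.real B := by
    rw [Set.inter_comm]
    exact measureReal_inter_add_sdiff hA
  have hPC : P.real (Aᶜ ∩ Bᶜ) + P.real (B \ A) = 1 - P.real A := by
    rw [← probReal_compl_eq_one_sub hA, ← measureReal_inter_add_sdiff (s := Aᶜ) hB.compl]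
    congr 2
    ext ω
    simp [and_comm]
  rw [hint, ← hPA, ← hPB]
  set a := P.real (A ∩ B)
  set b := P.real (A \ B)
  set c := P.real (B \ A)
  set e := P.real (Aᶜ ∩ Bᶜ)
  have hsum : a + b + c + e = 1 := by linarith
  have ha : a - q * q ≤ 3 * δ := by nlinarith
  have he : e - (1 - q) * (1 - q) ≤ 3 * δ := by nlinarith
  have hδ : 0 ≤ δ := by nlinarith
  -- The integral is `(1 - q) ^ 2 * a - q * (1 - q) * (b + c) + q ^ 2 * e`, so `a` and `e` are
  -- bounded from above and `b + c` from below. The errors have total weight at most `((1 - q) + q)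
  -- ^ 2 = 1` relative to `3 * δ`.
  have h1 := mul_le_mul_of_nonneg_right ha (mul_self_nonneg (1 - q))
  have h2 := mul_le_mul_of_nonneg_right he (mul_self_nonneg q)
  have h3 := mul_nonneg (mul_nonneg hq0 (sub_nonneg.2 hq1))
    (by linarith : 0 ≤ b + c - 2 * (q * (1 - q)) + 2 * δ)
  have h4 := mul_nonneg hδ (mul_nonneg hq0 (sub_nonneg.2 hq1))
  have he' : e = 1 - a - b - c := by linarith
  rw [he'] at h2
  nlinarith

/-- Chebyshev's inequality for the proportion of pairwise nearly independent events that occur. -/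
lemma measureReal_le_abs_sub_le {n : ℕ} (hn : n ≠ 0) {A : Fin n → Set Ω}
    (hA : ∀ i, MeasurableSet (A i)) {q δ : ℝ} (hq0 : 0 ≤ q) (hq1 : q ≤ 1) (hδ : 0 ≤ δ)
    (h11 : ∀ i j, i ≠ j → q * q ≤ P.real (A i ∩ A j) + δ)
    (h10 : ∀ i j, i ≠ j → q * (1 - q) ≤ P.real (A i \ A j) + δ)
    (h00 : ∀ i j, i ≠ j → (1 - q) * (1 - q) ≤ P.real ((A i)ᶜ ∩ (A j)ᶜ) + δ) {ε : ℝ} (hε : 0 < ε) :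
    P.real {ω | ε ≤ |(∑ i, (A i).indicator (1 : Ω → ℝ) ω) / n - q|} ≤
      ((n : ℝ)⁻¹ + 3 * δ) / ε ^ 2 := by
  have hn0 : (0 : ℝ) < n := Nat.cast_pos.2 (Nat.pos_of_ne_zero hn)
  have hmeas : ∀ i, Measurable fun ω => (A i).indicator (1 : Ω → ℝ) ω - q := fun i =>
    (measurable_one.indicator (hA i)).sub_const q
  have hbound : ∀ i ω, |(A i).indicator (1 : Ω → ℝ) ω - q| ≤ 1 := by
    intro i ω
    rw [abs_le]
    by_cases h : ω ∈ A i
    · rw [Set.indicator_of_mem h, Pi.one_apply]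
      constructor <;> linarith
    · rw [Set.indicator_of_notMem h]
      constructor <;> linarith
  have hbound2 : ∀ i j ω, |((A i).indicator (1 : Ω → ℝ) ω - q) *
      ((A j).indicator (1 : Ω → ℝ) ω - q)| ≤ 1 := by
    intro i j ω
    rw [abs_mul]
    exact mul_le_one₀ (hbound i ω) (abs_nonneg _) (hbound j ω)
  have hint : ∀ i j, Integrable (fun ω => ((A i).indicator (1 : Ω → ℝ) ω - q) *
      ((A j).indicator (1 : Ω → ℝ) ω - q)) P := fun i j =>
    (integrable_const (1 : ℝ)).mono' ((hmeas i).mul (hmeas j)).aestronglyMeasurable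
      (ae_of_all _ fun ω => hbound2 i j ω)
  have hsq : ∀ ω, ((∑ i, (A i).indicator (1 : Ω → ℝ) ω) / n - q) ^ 2 =
      ((n : ℝ)⁻¹ ^ 2) * ∑ i, ∑ j, ((A i).indicator (1 : Ω → ℝ) ω - q) *
        ((A j).indicator (1 : Ω → ℝ) ω - q) := by
    intro ω
    rw [← Finset.sum_mul_sum, Finset.sum_sub_distrib]
    simp only [Finset.sum_const, Finset.card_univ, Fintype.card_fin, nsmul_eq_mul]
    field_simp
  have hsecond : ∫ ω, ((∑ i, (A i).indicator (1 : Ω → ℝ) ω) / n - q) ^ 2 ∂P ≤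
      (n : ℝ)⁻¹ + 3 * δ := by
    simp_rw [hsq]
    rw [integral_const_mul, integral_finsetSum _ fun i _ => integrable_finsetSum _ fun j _ =>
      hint i j]
    have hrow : ∀ i, ∫ ω, ∑ j, ((A i).indicator (1 : Ω → ℝ) ω - q) *
        ((A j).indicator (1 : Ω → ℝ) ω - q) ∂P ≤ 1 + n * (3 * δ) := by
      intro i
      rw [integral_finsetSum _ fun j _ => hint i j]
      -- The diagonal term is bounded trivially by one; after division by `n ^ 2` the diagonal
      -- accounts for `1 / n`.
      calc _ ≤ ∑ j, ((if j = i then 1 else 0) + 3 * δ) := by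
            refine Finset.sum_le_sum fun j _ => ?_
            split_ifs with h
            · subst h
              have : ∫ ω, ((A j).indicator (1 : Ω → ℝ) ω - q) *
                  ((A j).indicator (1 : Ω → ℝ) ω - q) ∂P ≤ ∫ _, (1 : ℝ) ∂P :=
                integral_mono (hint j j) (integrable_const _) fun ω =>
                  (le_abs_self _).trans (hbound2 j j ω)
              rw [integral_const, probReal_univ, one_smul] at this
              linarith
            · rw [zero_add]
              exact integral_centered_mul_le (hA i) (hA j) hq0 hq1 (h11 i j (Ne.symm h))
                (h10 i j (Ne.symm h)) (h10 j i h) (h00 i j (Ne.symm h))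
        _ = _ := by simp [Finset.sum_add_distrib]
    calc _ ≤ (n : ℝ)⁻¹ ^ 2 * ∑ _i : Fin n, (1 + n * (3 * δ)) := by
          gcongr with i
          exact hrow i
      _ = _ := by
          simp only [Finset.sum_const, Finset.card_univ, Fintype.card_fin, nsmul_eq_mul]
          field_simp
  have hsqint : Integrable (fun ω => ((∑ i, (A i).indicator (1 : Ω → ℝ) ω) / n - q) ^ 2) P := by
    simp_rw [hsq]
    exact (integrable_finsetSum _ fun i _ => integrable_finsetSum _ fun j _ =>
      hint i j).const_mul _
  have hmarkov := mul_meas_ge_le_integral_of_nonneg (ae_of_all _ fun ω => sq_nonneg _) hsqint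
    (ε ^ 2)
  rw [le_div_iff₀ (by positivity), mul_comm]
  refine le_trans (mul_le_mul_of_nonneg_left (measureReal_mono fun ω hω => ?_) (sq_nonneg ε))
    (hmarkov.trans hsecond)
  have hω' : ε ≤ |(∑ i, (A i).indicator (1 : Ω → ℝ) ω) / n - q| := hω
  change ε ^ 2 ≤ _
  rw [← sq_abs (_ - q)]
  gcongr

end SecondMoment

/-! ### Ball types read off from the vertices near the root. -/

section Patterns

variable {Ω V E K : Type*} [NormedAddCommGroup E]

/-- The graphs whose `r`-neighbourhood of the root `0` is, or is not, `(H, a)`, according to the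
truth value of `b`. -/
def ballPattern (r : ℕ) (H : SimpleGraph K) (a : K) (b : Prop) (m : ℕ) :
    Set (SimpleGraph (Fin (m + 1))) :=
  {Γ | BallIso Γ 0 r H a ↔ b}

lemma relabelInvariant_ballPattern (r : ℕ) (H : SimpleGraph K) (a : K) (b : Prop) (m : ℕ) :
    RelabelInvariant (ballPattern r H a b m) := by
  intro Γ hΓ τ
  let f : Fin (m + 1) → Fin (m + 1) := Fin.cons 0 fun l => (τ l).succ
  have hf : Function.Injective f := Fin.cons_injective_iff.2
    ⟨by rintro ⟨l, hl⟩; exact Fin.succ_ne_zero _ hl,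
      (Fin.succ_injective m).comp τ.injective⟩
  have h := ballIso_comap_equiv_iff Γ (Equiv.ofBijective f hf.bijective_of_finite) 0 r H a
  exact h.trans hΓ

/-- The vertices near `i` determine whether the `r`-neighbourhood of `i` is `(H, a)`, in the
sense of `ballPattern`. -/
def patternEvent (Y : V → Ω → E) (G : Ω → SimpleGraph V) (R : ℝ) (r : ℕ) (H : SimpleGraph K) (a : K)
    (i : V) (b : Prop) : Set Ω :=
  ⋃ m, localEvent Y G R i (ballPattern r H a b m)

lemma ballIso_iff_of_mem_patternEvent {Y : V → Ω → E} {G : Ω → SimpleGraph V} {R : ℕ → ℝ}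
    (hR : Monotone R) {r : ℕ} {H : SimpleGraph K} {a : K} {i : V} {b : Prop} {ω : Ω}
    (h : ω ∈ patternEvent Y G (R r) r H a i b) (hlong : ω ∉ longEdgeEvent Y G R r i) :
    BallIso (G ω) i r H a ↔ b := by
  obtain ⟨m, f, hf, hD⟩ := Set.mem_iUnion.1 h
  have hi : i ∉ Set.range f := fun hi => by
    rw [hf] at hi
    exact hi.1 rfl
  have hiff := ballIso_comap_iff_of_nested (G ω) (Fin.cons i f : Fin (m + 1) → V) 0
    (fun j => insert i (nearSet Y (R j) i ω)) r (by simp)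
    (fun j k hjk => Set.insert_subset_insert fun v hv =>
      ⟨hv.1, Metric.closedBall_subset_closedBall (hR hjk) hv.2⟩)
    (fun j hj u hu v huv => by
      by_contra hv
      exact hlong ⟨j, hj, u, hu, v, hv, huv⟩)
    (Fin.cons_injective_iff.2 ⟨hi, f.injective⟩)
    (by rw [Fin.range_cons, hf]) H a
  exact hiff.symm.trans hD

/-- Finitely many near vertices can be enumerated, so one of the two opposite patterns occurs, and
the absence of long edges excludes the wrong one. -/
lemma mem_patternEvent_of_finite {Y : V → Ω → E} {G : Ω → SimpleGraph V} {R : ℕ → ℝ}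
    (hR : Monotone R) {r : ℕ} {H : SimpleGraph K} {a : K} {i : V} {b : Prop} {ω : Ω}
    (hfin : (nearSet Y (R r) i ω).Finite) (hlong : ω ∉ longEdgeEvent Y G R r i)
    (h : BallIso (G ω) i r H a ↔ b) : ω ∈ patternEvent Y G (R r) r H a i b := by
  have := hfin.to_subtype
  obtain ⟨m, ⟨e⟩⟩ := Finite.exists_equiv_fin (nearSet Y (R r) i ω)
  let f : Fin m ↪ V := e.symm.toEmbedding.trans (Function.Embedding.subtype _)
  have hf : Set.range f = nearSet Y (R r) i ω := by
    ext v
    constructor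
    · rintro ⟨l, rfl⟩
      exact (e.symm l).2
    · exact fun hv => ⟨e ⟨v, hv⟩, by simp [f]⟩
  by_cases hc : BallIso ((G ω).comap (Fin.cons i f : Fin (m + 1) → V)) 0 r H a ↔ b
  · exact Set.mem_iUnion.2 ⟨m, f, hf, hc⟩
  · have hmem : ω ∈ patternEvent Y G (R r) r H a i (¬ b) :=
      Set.mem_iUnion.2 ⟨m, f, hf, by unfold ballPattern; simp only [Set.mem_ofPred_eq]; tauto⟩
    have := ballIso_iff_of_mem_patternEvent hR hmem hlong
    tauto

lemma pairwise_disjoint_localEvent (Y : V → Ω → E) (G : Ω → SimpleGraph V) (R : ℝ) (i : V)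
    (D : ∀ m, Set (SimpleGraph (Fin (m + 1)))) :
    Pairwise fun m m' => Disjoint (localEvent Y G R i (D m)) (localEvent Y G R i (D m')) := by
  intro m m' hmm'
  refine Set.disjoint_left.2 fun ω h h' => hmm' ?_
  have := (encard_nearSet_of_mem_localEvent h).symm.trans (encard_nearSet_of_mem_localEvent h')
  exact_mod_cast this

end Patterns

/-! ### Asymptotic independence of the balls of two vertices. -/

section PatternLimit

variable {d : ℕ} {κ : ℝ≥0 → I → I → I} {Ω : ℕ → Type*} [∀ n, MeasurableSpace (Ω n)]
  {P : ∀ n, Measure (Ω n)} [∀ n, IsProbabilityMeasure (P n)]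
  {X : ∀ n, Fin n → Ω n → EuclideanSpace ℝ (Fin d)} {W : ∀ n, Fin n → Ω n → I}
  {G : ∀ n, Ω n → SimpleGraph (Fin n)}
  {Ω' : Type*} [MeasurableSpace Ω'] {Q : Measure Ω'} [IsProbabilityMeasure Q]
  {Y : ℕ → Ω' → EuclideanSpace ℝ (Fin d)} {W' : ℕ → Ω' → I} {G' : Ω' → SimpleGraph ℕ} {K : Type*}

/-- A Fatou argument: the product is a series over the numbers of near points of the two roots, and
a finite partial sum already exceeds `q`. On finitely many terms the local lower bounds can be
added, since the events are disjoint. -/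
lemma eventually_le_measure_patternEvent_inter (hd : 0 < d)
    (hκ : Measurable fun q : ℝ≥0 × I × I => κ q.1 q.2.1 q.2.2)
    (hsymm : ∀ t x y, κ t x y = κ t y x)
    (hX : ∀ n, IsUniformLocations (P n) (X n)) (hW : ∀ n, IsUniformWeights (P n) (W n) (X n))
    (hG : ∀ n, IsSIRG (P n) (scaledLocations n (X n)) (W n) κ (G n))
    (hY₀ : ∀ ω, Y 0 ω = 0) (hY : IsPoissonProcess Q (fun i => Y (i + 1)) volume)
    (hW' : IsUniformWeights Q W' Y) (hG' : IsSIRG Q Y W' κ G') {R : ℝ} (hR : 0 ≤ R)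
    (r : ℕ) (H : SimpleGraph K) (a : K) (b₁ b₂ : Prop) {q : ℝ≥0∞}
    (hq : q < Q (patternEvent Y G' R r H a 0 b₁) * Q (patternEvent Y G' R r H a 0 b₂)) :
    ∀ᶠ n in atTop, ∀ i j : Fin n, i ≠ j →
      q ≤ P n (patternEvent (scaledLocations n (X n)) (G n) R r H a i b₁ ∩
        patternEvent (scaledLocations n (X n)) (G n) R r H a j b₂) := by
  let L : Prop → ℕ → Set Ω' := fun b m => localEvent Y G' R 0 (ballPattern r H a b m)
  let Ln : ∀ n, Fin n → Prop → ℕ → Set (Ω n) := fun n i b m =>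
    localEvent (scaledLocations n (X n)) (G n) R i (ballPattern r H a b m)
  have hsum : ∀ b, Q (patternEvent Y G' R r H a 0 b) = ∑' m, Q (L b m) := fun b =>
    measure_iUnion (pairwise_disjoint_localEvent Y G' R 0 _)
      fun m => hG'.measurableSet_localEvent R 0 _
  have hprod : Q (patternEvent Y G' R r H a 0 b₁) * Q (patternEvent Y G' R r H a 0 b₂) =
      ∑' p : ℕ × ℕ, Q (L b₁ p.1) * Q (L b₂ p.2) := by
    rw [hsum, hsum, ENNReal.tsum_prod', ← ENNReal.tsum_mul_right]
    exact tsum_congr fun m => ENNReal.tsum_mul_left.symm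
  rw [hprod, ENNReal.tsum_eq_iSup_sum] at hq
  obtain ⟨F, hF⟩ := lt_iSup_iff.1 hq
  -- The infimum over pairs encodes uniformity in the vertices. Its minimum with the target
  -- converges, although the infimum is only bounded below.
  let v : ℕ → ℕ × ℕ → ℝ≥0∞ := fun n p =>
    ⨅ (i : Fin n) (j : Fin n) (_ : i ≠ j), P n (Ln n i b₁ p.1 ∩ Ln n j b₂ p.2)
  have hlim : ∀ p : ℕ × ℕ, Tendsto (fun n => min (v n p) (Q (L b₁ p.1) * Q (L b₂ p.2))) atTop
      (𝓝 (Q (L b₁ p.1) * Q (L b₂ p.2))) := by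
    intro p
    refine tendsto_order.2 ⟨fun x hx => ?_, fun x hx => Eventually.of_forall fun n =>
      (min_le_right _ _).trans_lt hx⟩
    obtain ⟨y, hxy, hy⟩ := exists_between hx
    filter_upwards [eventually_le_measure_localEvent_inter hd hκ hsymm hX hW hG hY₀ hY hW' hG' hR
      (relabelInvariant_ballPattern r H a b₁ p.1) (relabelInvariant_ballPattern r H a b₂ p.2) hy]
      with n hn
    exact lt_min (hxy.trans_le (le_iInf₂ fun i j => le_iInf fun hij => hn i j hij)) hx
  have hlimF := tendsto_finsetSum F fun p _ => hlim p
  filter_upwards [hlimF.eventually_const_lt hF] with n hn i j hij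
  calc q ≤ ∑ p ∈ F, min (v n p) (Q (L b₁ p.1) * Q (L b₂ p.2)) := hn.le
    _ ≤ ∑ p ∈ F, P n (Ln n i b₁ p.1 ∩ Ln n j b₂ p.2) := Finset.sum_le_sum fun p _ =>
        (min_le_left _ _).trans ((iInf₂_le i j).trans (iInf_le _ hij))
    _ = P n (⋃ p ∈ F, Ln n i b₁ p.1 ∩ Ln n j b₂ p.2) := by
        refine (measure_biUnion_finset ?_ fun p _ =>
          ((hG n).measurableSet_localEvent R i _).inter
            ((hG n).measurableSet_localEvent R j _)).symm
        intro p _ p' _ hpp'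
        by_cases h1 : p.1 = p'.1
        · have h2 : p.2 ≠ p'.2 := fun h2 => hpp' (Prod.ext h1 h2)
          exact (pairwise_disjoint_localEvent _ (G n) R j _ h2).mono Set.inter_subset_right
            Set.inter_subset_right
        · exact (pairwise_disjoint_localEvent _ (G n) R i _ h1).mono Set.inter_subset_left
            Set.inter_subset_left
    _ ≤ _ := by
        refine measure_mono (Set.iUnion₂_subset fun p _ => Set.inter_subset_inter ?_ ?_)
        · exact Set.subset_iUnion (fun m => Ln n i b₁ m) p.1
        · exact Set.subset_iUnion (fun m => Ln n j b₂ m) p.2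

/-- The neighbourhoods of two distinct vertices of a large finite model are asymptotically
distributed as independent copies of the neighbourhood of the root of the infinite model. -/
lemma eventually_measure_ballIso_mul_le (hd : 0 < d)
    (hκ : Measurable fun q : ℝ≥0 × I × I => κ q.1 q.2.1 q.2.2)
    (hsymm : ∀ t x y, κ t x y = κ t y x)
    (hfin : ∫⁻ x : EuclideanSpace ℝ (Fin d), meanConnection κ x ≠ ∞)
    (hX : ∀ n, IsUniformLocations (P n) (X n)) (hW : ∀ n, IsUniformWeights (P n) (W n) (X n))
    (hG : ∀ n, IsSIRG (P n) (scaledLocations n (X n)) (W n) κ (G n))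
    (hY₀ : ∀ ω, Y 0 ω = 0) (hY : IsPoissonProcess Q (fun i => Y (i + 1)) volume)
    (hW' : IsUniformWeights Q W' Y) (hG' : IsSIRG Q Y W' κ G')
    (r : ℕ) (H : SimpleGraph K) (a : K) (b₁ b₂ : Prop) {δ : ℝ≥0∞} (hδ : δ ≠ 0) :
    ∀ᶠ n in atTop, ∀ i j : Fin n, i ≠ j →
      Q {ω | BallIso (G' ω) 0 r H a ↔ b₁} * Q {ω | BallIso (G' ω) 0 r H a ↔ b₂} ≤
        P n {ω | (BallIso (G n ω) i r H a ↔ b₁) ∧ (BallIso (G n ω) j r H a ↔ b₂)} + δ := by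
  have hball : ∀ ρ : ℝ, volume (Metric.closedBall (0 : EuclideanSpace ℝ (Fin d)) ρ) ≠ ∞ :=
    fun ρ => measure_closedBall_lt_top.ne
  -- Five errors: one for each truncated factor in the infinite model, one for the long edges at
  -- each of the two vertices, and one for the passage to the limit.
  have hδ' : δ / 5 ≠ 0 := (ENNReal.div_pos hδ (by simp)).ne'
  set η := δ / 5
  have hηδ : 5 * η = δ := ENNReal.mul_div_cancel (by simp) (by simp)
  obtain ⟨R, hRmono, hR0, hRδ⟩ := exists_radii hfin hball r hδ'
  have hlongQ : Q (longEdgeEvent Y G' R r 0) ≤ η :=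
    (hG'.measure_longEdgeEvent_le hκ hW' (hY.hasMomentBounds hY₀) hR0 r).trans hRδ
  have hlongP : ∀ n i, P n (longEdgeEvent (scaledLocations n (X n)) (G n) R r i) ≤ η := fun n i =>
    ((hG n).measure_longEdgeEvent_le hκ ((hW n).scaledLocations n)
      ((hX n).hasMomentBounds hd i) hR0 r).trans hRδ
  have hnear : Q {ω | ¬ (nearSet Y (R r) 0 ω).Finite} = 0 := by
    refine measure_mono_null (fun ω hω => ?_) (hY.measure_countIn_eq_top
      (B := Metric.closedBall 0 (R r)) Metric.isClosed_closedBall.measurableSet (hball _))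
    change Set.encard _ = ⊤
    rw [Set.encard_eq_top_iff]
    intro hf
    refine hω ?_
    rw [nearSet_zero_eq_image_succ hY₀]
    exact hf.image _
  set p : Prop → ℝ≥0∞ := fun b => Q (patternEvent Y G' (R r) r H a 0 b)
  have hQp : ∀ b, Q {ω | BallIso (G' ω) 0 r H a ↔ b} ≤ p b + η := by
    intro b
    calc _ ≤ Q (patternEvent Y G' (R r) r H a 0 b ∪ (longEdgeEvent Y G' R r 0 ∪
          {ω | ¬ (nearSet Y (R r) 0 ω).Finite})) := by
          refine measure_mono fun ω hω => ?_
          by_cases h1 : ω ∈ longEdgeEvent Y G' R r 0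
          · exact Or.inr (Or.inl h1)
          · by_cases h2 : (nearSet Y (R r) 0 ω).Finite
            · exact Or.inl (mem_patternEvent_of_finite hRmono h2 h1 hω)
            · exact Or.inr (Or.inr h2)
      _ ≤ p b + (Q (longEdgeEvent Y G' R r 0) + 0) := by
          rw [← hnear]
          exact (measure_union_le _ _).trans (by gcongr; exact measure_union_le _ _)
      _ ≤ _ := by
          rw [add_zero]
          gcongr
  have hprod : Q {ω | BallIso (G' ω) 0 r H a ↔ b₁} * Q {ω | BallIso (G' ω) 0 r H a ↔ b₂} ≤
      p b₁ * p b₂ + 2 * η := by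
    calc _ ≤ Q {ω | BallIso (G' ω) 0 r H a ↔ b₁} * (p b₂ + η) := by
          gcongr
          exact hQp b₂
      _ ≤ Q {ω | BallIso (G' ω) 0 r H a ↔ b₁} * p b₂ + 1 * η := by
          rw [mul_add]
          gcongr
          exact prob_le_one
      _ ≤ (p b₁ + η) * p b₂ + 1 * η := by
          gcongr
          exact hQp b₁
      _ ≤ p b₁ * p b₂ + η * 1 + 1 * η := by
          rw [add_mul]
          gcongr
          exact prob_le_one
      _ = _ := by ring
  have hev : ∀ᶠ n in atTop, ∀ i j : Fin n, i ≠ j → p b₁ * p b₂ ≤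
      P n (patternEvent (scaledLocations n (X n)) (G n) (R r) r H a i b₁ ∩
        patternEvent (scaledLocations n (X n)) (G n) (R r) r H a j b₂) + η := by
    -- Subtracting a positive number is strict only for a nonzero product.
    by_cases h0 : p b₁ * p b₂ = 0
    · exact Eventually.of_forall fun n i j _ => by rw [h0]; exact zero_le
    · have hlt : p b₁ * p b₂ - η < p b₁ * p b₂ :=
        ENNReal.sub_lt_self (ENNReal.mul_ne_top (measure_ne_top _ _) (measure_ne_top _ _)) h0 hδ'
      filter_upwards [eventually_le_measure_patternEvent_inter hd hκ hsymm hX hW hG hY₀ hY hW' hG'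
        (hR0 r) r H a b₁ b₂ hlt] with n hn i j hij
      exact tsub_le_iff_right.1 (hn i j hij)
  filter_upwards [hev] with n hn i j hij
  have hincl : P n (patternEvent (scaledLocations n (X n)) (G n) (R r) r H a i b₁ ∩
      patternEvent (scaledLocations n (X n)) (G n) (R r) r H a j b₂) ≤
      P n {ω | (BallIso (G n ω) i r H a ↔ b₁) ∧ (BallIso (G n ω) j r H a ↔ b₂)} + (η + η) := by
    calc _ ≤ P n ({ω | (BallIso (G n ω) i r H a ↔ b₁) ∧ (BallIso (G n ω) j r H a ↔ b₂)} ∪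
          (longEdgeEvent (scaledLocations n (X n)) (G n) R r i ∪
            longEdgeEvent (scaledLocations n (X n)) (G n) R r j)) := by
          refine measure_mono fun ω hω => ?_
          by_cases h1 : ω ∈ longEdgeEvent (scaledLocations n (X n)) (G n) R r i
          · exact Or.inr (Or.inl h1)
          by_cases h2 : ω ∈ longEdgeEvent (scaledLocations n (X n)) (G n) R r j
          · exact Or.inr (Or.inr h2)
          exact Or.inl ⟨ballIso_iff_of_mem_patternEvent hRmono hω.1 h1,
            ballIso_iff_of_mem_patternEvent hRmono hω.2 h2⟩
      _ ≤ _ := (measure_union_le _ _).trans (by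
          gcongr
          exact (measure_union_le _ _).trans (add_le_add (hlongP n i) (hlongP n j)))
  calc _ ≤ p b₁ * p b₂ + 2 * η := hprod
    _ ≤ (P n {ω | (BallIso (G n ω) i r H a ↔ b₁) ∧ (BallIso (G n ω) j r H a ↔ b₂)} + (η + η) + η) +
        2 * η := by
        gcongr
        exact (hn i j hij).trans (by gcongr)
    _ = P n {ω | (BallIso (G n ω) i r H a ↔ b₁) ∧ (BallIso (G n ω) j r H a ↔ b₂)} + 5 * η := by
        ring
    _ = _ := by rw [hηδ]

end PatternLimit

/-! ### Convergence in probability of the proportion of vertices. -/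

section Convergence

lemma ballFraction_eq_sum_indicator {Ω K : Type*} {n : ℕ} (G : Ω → SimpleGraph (Fin n)) (r : ℕ)
    (H : SimpleGraph K) (a : K) (ω : Ω) :
    ballFraction (G ω) r H a =
      (∑ i, {ω | BallIso (G ω) i r H a}.indicator (1 : Ω → ℝ) ω) / n := by
  classical
  rw [ballFraction, Fintype.card_fin, Nat.card_eq_fintype_card, Fintype.card_subtype]
  simp [Set.indicator_apply]

/-- On a finite vertex set there are finitely many graphs, so every graph property defines an event.
-/
lemma IsSIRG.measurableSet_ballIso {Ω V E S K : Type*} [MeasurableSpace Ω] {P : Measure Ω}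
    [LinearOrder V] [Finite V] [NormedAddCommGroup E] [MeasurableSpace E] [MeasurableSpace S]
    {Y : V → Ω → E} {W : V → Ω → S} {κ : ℝ≥0 → S → S → I} {G : Ω → SimpleGraph V}
    (hG : IsSIRG P Y W κ G) (i : V) (r : ℕ) (H : SimpleGraph K) (a : K) :
    MeasurableSet {ω | BallIso (G ω) i r H a} :=
  measurableSet_comap_mem hG.measurable_adj id {Γ | BallIso Γ i r H a}

variable {d : ℕ} {κ : ℝ≥0 → I → I → I} {Ω : ℕ → Type*} [∀ n, MeasurableSpace (Ω n)]
  {P : ∀ n, Measure (Ω n)} [∀ n, IsProbabilityMeasure (P n)]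
  {X : ∀ n, Fin n → Ω n → EuclideanSpace ℝ (Fin d)} {W : ∀ n, Fin n → Ω n → I}
  {G : ∀ n, Ω n → SimpleGraph (Fin n)}
  {Ω' : Type*} [MeasurableSpace Ω'] {Q : Measure Ω'} [IsProbabilityMeasure Q]
  {Y : ℕ → Ω' → EuclideanSpace ℝ (Fin d)} {W' : ℕ → Ω' → I} {G' : Ω' → SimpleGraph ℕ} {K : Type*}

lemma tendsto_measure_le_abs_ballFraction_sub (hd : 0 < d)
    (hκ : Measurable fun q : ℝ≥0 × I × I => κ q.1 q.2.1 q.2.2)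
    (hsymm : ∀ t x y, κ t x y = κ t y x)
    (hfin : ∫⁻ x : EuclideanSpace ℝ (Fin d), meanConnection κ x ≠ ∞)
    (hX : ∀ n, IsUniformLocations (P n) (X n)) (hW : ∀ n, IsUniformWeights (P n) (W n) (X n))
    (hG : ∀ n, IsSIRG (P n) (scaledLocations n (X n)) (W n) κ (G n))
    (hY₀ : ∀ ω, Y 0 ω = 0) (hY : IsPoissonProcess Q (fun i => Y (i + 1)) volume)
    (hW' : IsUniformWeights Q W' Y) (hG' : IsSIRG Q Y W' κ G')
    (r : ℕ) (H : SimpleGraph K) (a : K) {ε : ℝ} (hε : 0 < ε) :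
    Tendsto (fun n => P n {ω | ε ≤ |ballFraction (G n ω) r H a -
      Q.real {ω' | BallIso (G' ω') 0 r H a}|}) atTop (𝓝 0) := by
  set q := Q.real {ω' | BallIso (G' ω') 0 r H a} with hq
  have hq0 : 0 ≤ q := measureReal_nonneg
  have hq1 : q ≤ 1 := measureReal_le_one
  -- Subadditivity suffices, so measurability of the ball event in the infinite graph plays no role.
  have hq' : 1 - q ≤ Q.real {ω' | ¬ BallIso (G' ω') 0 r H a} := by
    rw [sub_le_iff_le_add', hq, ← probReal_univ (μ := Q)]
    refine le_trans (measureReal_mono fun ω _ => ?_) (measureReal_union_le _ _)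
    exact em (BallIso (G' ω) 0 r H a)
  rw [ENNReal.tendsto_nhds_zero]
  intro η hη
  obtain ⟨θ, hθ0, hθη⟩ : ∃ θ : ℝ, 0 < θ ∧ ENNReal.ofReal θ ≤ η := by
    obtain ⟨x, hx0, hxη⟩ := ENNReal.lt_iff_exists_nnreal_btwn.1 hη
    exact ⟨x, by exact_mod_cast hx0, by rw [ENNReal.ofReal_coe_nnreal]; exact hxη.le⟩
  -- Chosen so that `3 * δ` is half of `θ * ε ^ 2`; the other half is left for `1 / n`.
  have hδ0 : 0 < θ * ε ^ 2 / 6 := by positivity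
  set δ := θ * ε ^ 2 / 6 with hδ
  have hev : ∀ b₁ b₂ : Prop, _ := fun b₁ b₂ =>
    eventually_measure_ballIso_mul_le hd hκ hsymm hfin hX hW hG hY₀ hY hW' hG' r H a b₁ b₂
      (ENNReal.ofReal_pos.2 hδ0).ne'
  have hinv : ∀ᶠ n : ℕ in atTop, (n : ℝ)⁻¹ ≤ θ * ε ^ 2 / 2 :=
    ((tendsto_inv_atTop_zero.comp tendsto_natCast_atTop_atTop).eventually_lt_const
      (by positivity : (0 : ℝ) < θ * ε ^ 2 / 2)).mono fun n hn => hn.le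
  -- The fourth case, false at `i` and true at `j`, is the second with the vertices exchanged.
  filter_upwards [hev True True, hev True False, hev False False, hinv, eventually_gt_atTop 0]
    with n h11 h10 h00 hn hn0
  have hreal : ∀ {x y z : ℝ≥0∞}, x * y ≤ z + ENNReal.ofReal δ → z ≠ ∞ →
      x.toReal * y.toReal ≤ z.toReal + δ := by
    intro x y z h hz
    have := ENNReal.toReal_mono (by finiteness) h
    rwa [ENNReal.toReal_mul, ENNReal.toReal_add hz (by finiteness),
      ENNReal.toReal_ofReal hδ0.le] at this
  simp only [iff_true, iff_false] at h11 h10 h00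
  have hA : ∀ i, MeasurableSet {ω | BallIso (G n ω) i r H a} := fun i =>
    (hG n).measurableSet_ballIso i r H a
  have hcheb := measureReal_le_abs_sub_le (P := P n) hn0.ne' hA hq0 hq1 hδ0.le
    (fun i j hij => hreal (h11 i j hij) (measure_ne_top _ _))
    (fun i j hij => (mul_le_mul_of_nonneg_left hq' hq0).trans
      (hreal (h10 i j hij) (measure_ne_top _ _)))
    (fun i j hij => (mul_le_mul hq' hq' (sub_nonneg.2 hq1) measureReal_nonneg).trans
      (hreal (h00 i j hij) (measure_ne_top _ _))) hε
  simp_rw [ballFraction_eq_sum_indicator (G n) r H a]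
  rw [← ofReal_measureReal]
  refine (ENNReal.ofReal_le_ofReal (hcheb.trans ?_)).trans hθη
  rw [div_le_iff₀ (by positivity)]
  linarith

end Convergence

theorem mainTheorem11
    (d : ℕ) (hd : 0 < d)
    -- profile and kernel
    (ρ : ℝ≥0 → I) (h : I → I → ℝ≥0 → ℝ≥0)
    (hmeas : Measurable fun q : ℝ≥0 × I × I => wdrcmKernel ρ h q.1 q.2.1 q.2.2)
    (hsymm : ∀ t x y, wdrcmKernel ρ h t x y = wdrcmKernel ρ h t y x)
    -- power-law tail bound for two independent uniform weights, with exponent larger than `d`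
    (α : ℝ) (hα : (d : ℝ) < α) (t₀ : ℝ≥0) (ht₀ : 0 < t₀)
    (htail : ∀ t : ℝ≥0, t₀ < t →
      ∫ w : I × I, (wdrcmKernel ρ h t w.1 w.2 : ℝ) ≤ (t : ℝ) ^ (-α))
    -- the finite models, with locations blown up by the factor `n ^ (1 / d)`
    {Ω : ℕ → Type*} [∀ n, MeasurableSpace (Ω n)]
    (P : ∀ n, Measure (Ω n)) [∀ n, IsProbabilityMeasure (P n)]
    (X : ∀ n, Fin n → Ω n → EuclideanSpace ℝ (Fin d))
    (W : ∀ n, Fin n → Ω n → I)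
    (hX : ∀ n, IsUniformLocations (P n) (X n))
    (hW : ∀ n, IsUniformWeights (P n) (W n) (X n))
    (G : ∀ n, Ω n → SimpleGraph (Fin n))
    (hG : ∀ n, IsSIRG (P n) (fun i ω => ((n : ℝ) ^ (1 / (d : ℝ))) • X n i ω) (W n)
      (wdrcmKernel ρ h) (G n))
    -- the infinite model: a unit-rate Poisson process, with the origin added as the root
    {Ω' : Type*} [MeasurableSpace Ω'] (Q : Measure Ω') [IsProbabilityMeasure Q]
    (Y : ℕ → Ω' → EuclideanSpace ℝ (Fin d))
    (W' : ℕ → Ω' → I)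
    (hY₀ : ∀ ω, Y 0 ω = 0)
    (hY : IsPoissonProcess Q (fun i => Y (i + 1)) volume)
    (hW' : IsUniformWeights Q W' Y)
    (G' : Ω' → SimpleGraph ℕ)
    (hG' : IsSIRG Q Y W' (wdrcmKernel ρ h) G') :
    ConvergesLocallyInProbability P G Q G' 0 := by
  have hfin : ∫⁻ x : EuclideanSpace ℝ (Fin d), meanConnection (wdrcmKernel ρ h) x ≠ ∞ :=
    lintegral_meanConnection_ne_top hmeas (by rwa [finrank_euclideanSpace_fin]) htail
  refine ⟨hG'.ae_isLocFinite hmeas hW' (hY.hasMomentBounds hY₀) hfin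
    fun ρ => measure_closedBall_lt_top.ne, fun r K H a _ ε hε => ?_⟩
  exact tendsto_measure_le_abs_ballFraction_sub hd hmeas hsymm hfin hX hW hG hY₀ hY hW' hG' r H a hε
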